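/- Let $a,b,c\in\mathbb C$, $\Theta=z\,\frac{d}{dz}$, let $(u)_n=u(u+1)\cdots(u+n-1)$, and consider the double series $$F^{2:1;1}_{1:1;1}\!\left({\alpha;\,\beta;\;p_1,p_2\atop \gamma;\;q_1,q_2}\,\middle|\,x,y\right)=\sum_{i,j\ge0}\frac{(\alpha)_{i+j}(\beta)_{i+j}(p_1)_i(p_2)_j}{(\gamma)_{i+j}(q_1)_i(q_2)_j\,i!\,j!}\,x^iy^j\qquad(|x|+|y|<1),$$ $$F^{1:2;2}_{2:0;0}\!\left({\alpha;\;p_1,p_2;\;q_1,q_2\atop \beta;\;\gamma}\,\middle|\,x,y\right)=\sum_{i,j\ge0}\frac{(\alpha)_{i+j}(p_1)_i(p_2)_j(q_1)_i(q_2)_j}{(\beta)_{i+j}(\gamma)_{i+j}\,i!\,j!}\,x^iy^j\qquad(|x|<1,\ |y|<1).$$ The symmetric tensor square of Euler's hypergeometric equation for ${}_2F_1(a,b;c;z)$ is the equation $$z(\Theta+2a)(\Theta+2b)(\Theta+a+b)\,Y-\Theta(\Theta+c-1)(\Theta+2c-2)\,Y+\frac{(2a+2b-2c+1)\,z}{z-1}\big((a+b-c+1)\Theta+2ab\big)Y=0.\qquad(\ast)$$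 Each of the following functions of $z$ satisfies $(\ast)$ at points $z\ne0,1$, provided that the lower parameters in it are not zero or negative integers: $$F^{2:1;1}_{1:1;1}\!\left({2a;\,2b;\;c-\frac12,\,a+b-c+\frac12\atop a+b+\frac12;\;2c-1,\,2a+2b-2c+1}\,\middle|\,z,1-z\right),$$ $$z^{1-c}(1-z)^{c-a-b-\frac12}\,F^{1:2;2}_{2:0;0}\!\left({\frac12;\;a-b+\frac12,\,a+b-c+\frac12;\;b-a+\frac12,\,c-a-b+\frac12\atop c;\;2-c}\,\middle|\,z,\frac{z}{z-1}\right),$$ $$z^{\frac12-c}(1-z)^{c-a-b}\,F^{1:2;2}_{2:0;0}\!\left({\frac12;\;a-b+\frac12,\,c-\frac12;\;b-a+\frac12,\,\frac32-c\atop a+b-c+1;\;c-a-b+1}\,\middle|\,1-z,1-\frac1z\right),$$ $$z^{\frac12-c}(1-z)^{c-a-b-\frac12}\,F^{1:2;2}_{2:0;0}\!\left({\frac12;\;c-\frac12,\,a+b-c+\frac12;\;\frac32-c,\,c-a-b+\frac12\atop a-b+1;\;b-a+1}\,\middle|\,\frac1z,\frac1{1-z}\right).$$ Here a univariate specialization of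 a bivariate function is the restriction, to the curve parameterized by $z$, of any branch (under analytic continuation) of the sum of the series, and the powers of $z$ and $1-z$ may be any holomorphic branches. The restriction of a branch is the holomorphic restriction where the branch is defined on the curve. Where the branch is defined only on a wedge along the curve (it may ramify there), the restriction is its limit on the curve, supposed to exist. In particular, for $0<z<1$ the first series converges absolutely at $(z,1-z)$, and its sum is a three times continuously differentiable solution of $(\ast)$ on $(0,1)$. -/

import Mathlib

open Set Filter Topology

/-- The Pochhammer symbol `(a)_n = a (a+1) ⋯ (a+n-1)`. -/
noncomputable def poch (a : ℂ) (n : ℕ) : ℂ := (ascPochhammer ℂ n).eval a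

/-- `q` is admissible as a lower parameter: it is not zero or a negative integer. -/
def LowerOK (q : ℂ) : Prop := ∀ n : ℕ, q ≠ -(n : ℂ)

/-- The term of index `(i, j)` of the series `F^{2:1;1}_{1:1;1}(a; b; p₁, p₂ / c; q₁, q₂ | x, y)`. -/
noncomputable def term211 (a b p₁ p₂ c q₁ q₂ : ℂ) (p : ℂ × ℂ) (k : ℕ × ℕ) : ℂ :=
  poch a (k.1 + k.2) * poch b (k.1 + k.2) * poch p₁ k.1 * poch p₂ k.2 /
    (poch c (k.1 + k.2) * poch q₁ k.1 * poch q₂ k.2 * (k.1.factorial : ℂ) * (k.2.factorial : ℂ)) *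
    p.1 ^ k.1 * p.2 ^ k.2

/-- The series `F^{2:1;1}_{1:1;1}(a; b; p₁, p₂ / c; q₁, q₂ | x, y)`, as a function of `(x, y)`. -/
noncomputable def F211 (a b p₁ p₂ c q₁ q₂ : ℂ) (p : ℂ × ℂ) : ℂ :=
  ∑' k : ℕ × ℕ, term211 a b p₁ p₂ c q₁ q₂ p k

/-- The term of index `(i, j)` of the series
`F^{1:2;2}_{2:0;0}(a; p₁, p₂; q₁, q₂ / b; c | x, y)`. -/
noncomputable def term122 (a p₁ p₂ q₁ q₂ b c : ℂ) (p : ℂ × ℂ) (k : ℕ × ℕ) : ℂ :=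
  poch a (k.1 + k.2) * poch p₁ k.1 * poch p₂ k.2 * poch q₁ k.1 * poch q₂ k.2 /
    (poch b (k.1 + k.2) * poch c (k.1 + k.2) * (k.1.factorial : ℂ) * (k.2.factorial : ℂ)) *
    p.1 ^ k.1 * p.2 ^ k.2

/-- The series `F^{1:2;2}_{2:0;0}(a; p₁, p₂; q₁, q₂ / b; c | x, y)`, as a function of `(x, y)`. -/
noncomputable def F122 (a p₁ p₂ q₁ q₂ b c : ℂ) (p : ℂ × ℂ) : ℂ :=
  ∑' k : ℕ × ℕ, term122 a p₁ p₂ q₁ q₂ b c p k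

/-- The convergence domain `|x| + |y| < 1` of the `F^{2:1;1}_{1:1;1}` series. -/
def dom211 : Set (ℂ × ℂ) := {p | ‖p.1‖ + ‖p.2‖ < 1}

/-- The convergence domain `|x| < 1`, `|y| < 1` of the `F^{1:2;2}_{2:0;0}` series. -/
def dom122 : Set (ℂ × ℂ) := {p | ‖p.1‖ < 1 ∧ ‖p.2‖ < 1}

/-- Analytic continuation through chains of function elements: `IsBranch D F W G` says that the
element `(W, G)` is obtained from the element `(D, F)` by finitely many direct analytic
continuations; consecutive elements coincide on some non-empty open set. -/
inductive IsBranch (D : Set (ℂ × ℂ)) (F : ℂ × ℂ → ℂ) :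
    Set (ℂ × ℂ) → (ℂ × ℂ → ℂ) → Prop
  | base : IsBranch D F D F
  | step (W : Set (ℂ × ℂ)) (G : ℂ × ℂ → ℂ) (W' : Set (ℂ × ℂ)) (G' : ℂ × ℂ → ℂ)
      (V : Set (ℂ × ℂ)) :
      IsBranch D F W G → IsOpen W' → IsPreconnected W' → DifferentiableOn ℂ G' W' →
      IsOpen V → V.Nonempty → V ⊆ W ∩ W' → EqOn G G' V → IsBranch D F W' G'

/-- `f` is, on the open set `U` of the parameter plane, the restriction to the parameterized curve
`γ` of a branch of `F` (given initially on `D`). Locally in `z`, there is a branch `G` on some `W`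
such that `f z` is the limit of `G` at the point `γ z`. Here `W` either contains the curve near
`γ z₀` (the case `ω = 0`), so that `f z = G (γ z)`, or it contains a wedge along the curve,
of half-disc cross-sections in the complex direction `(ω, 0)`. The second case is needed for branches that
ramify along the curve: the curves below lie in the singular locus of the differential
systems of the bivariate functions. -/
def IsBranchRestriction (D : Set (ℂ × ℂ)) (F : ℂ × ℂ → ℂ) (γ : ℂ → ℂ × ℂ)
    (U : Set ℂ) (f : ℂ → ℂ) : Prop :=
  ∀ z₀ ∈ U, ∃ (W : Set (ℂ × ℂ)) (G : ℂ × ℂ → ℂ), IsBranch D F W G ∧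
    ∃ (ω : ℂ) (ε : ℝ), 0 < ε ∧ ∀ z ∈ Metric.ball z₀ ε,
      (∀ s : ℂ, 0 < s.re → ‖s‖ < ε → γ z + (ω * s, 0) ∈ W) ∧
      Tendsto G (𝓝[W] (γ z)) (𝓝 (f z))

section Equation

variable {𝕜 : Type*} [NontriviallyNormedField 𝕜] [NormedAlgebra 𝕜 ℂ]

/-- The operator `Θ + α`, where `Θ = z d/dz`, on complex-valued functions of a variable `z` in `𝕜`
(below, `𝕜` is `ℂ` or `ℝ`). -/
noncomputable def eulerAdd (α : ℂ) (y : 𝕜 → ℂ) (z : 𝕜) : ℂ :=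
  algebraMap 𝕜 ℂ z * deriv y z + α * y z

/-- The left-hand side of the symmetric tensor square equation of Euler's hypergeometric equation
with parameters `a, b, c`. -/
noncomputable def symSqLHS (a b c : ℂ) (y : 𝕜 → ℂ) (z : 𝕜) : ℂ :=
  algebraMap 𝕜 ℂ z * eulerAdd (2 * a) (eulerAdd (2 * b) (eulerAdd (a + b) y)) z
    - eulerAdd 0 (eulerAdd (c - 1) (eulerAdd (2 * c - 2) y)) z
    + (2 * a + 2 * b - 2 * c + 1) * algebraMap 𝕜 ℂ z / (algebraMap 𝕜 ℂ z - 1) *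
      ((a + b - c + 1) * eulerAdd 0 y z + 2 * a * b * y z)

/-- `y` is a (three times continuously differentiable) solution of the symmetric tensor square
equation on the set `U`. -/
def IsSymSqSolution (a b c : ℂ) (U : Set 𝕜) (y : 𝕜 → ℂ) : Prop :=
  ContDiffOn 𝕜 3 y U ∧ ∀ z ∈ U, symSqLHS a b c y z = 0

end Equation

/-- `l` is a holomorphic branch of `log ∘ g` on `U`. -/
def IsLogBranch (U : Set ℂ) (g l : ℂ → ℂ) : Prop :=
  DifferentiableOn ℂ l U ∧ ∀ z ∈ U, Complex.exp (l z) = g z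

/-- The conclusion common to the three functions given by a power factor times a specialized
`F^{1:2;2}_{2:0;0}` function: on every open set `U`, for all branches `l₀`, `l₁` of `log z` and
`log (1 - z)`, and for every restriction `f` of a branch of `F` to the curve `γ`, the function
`z ^ α * (1 - z) ^ β * f z` solves the symmetric tensor square equation. -/
def PowerTimesBranchSolves (a b c α β : ℂ) (F : ℂ × ℂ → ℂ) (γ : ℂ → ℂ × ℂ) : Prop :=
  ∀ (U : Set ℂ) (l₀ l₁ f : ℂ → ℂ), IsOpen U →
    IsLogBranch U (fun z => z) l₀ → IsLogBranch U (fun z => 1 - z) l₁ →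
    IsBranchRestriction dom122 F γ U f →
    IsSymSqSolution a b c U (fun z => Complex.exp (α * l₀ z + β * l₁ z) * f z)

/-!
The curves on which the two double series are restricted lie in the singular locus of the systems of
partial differential equations that the series satisfy, so a third order equation for the
restriction cannot be read off by elimination alone: it is a limit of relations that hold off the curve.

Each double series satisfies three third order equations in Euler operators (`Sys211`, `Sys122`),
which are local and hence hold for all branches (`IsBranch.sys211`, `IsBranch.sys122`). For the
parameters at hand, one combination of the three equations becomes, in terms of the derivative `D`
along the parallel translates of the curve and the transversal derivative `T = ∂/∂x`, a sum of terms
`ρ · uᵐ · Dᵏ Tᵐ G`, where `u` is the difference of `x` and its value on the curve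
(`Sys211.tangential`, `Sys122.tangential`). When `G` has a limit `f` at the points of the curve,
within a wedge of half-disc cross-sections, then Cauchy's estimates on discs of radius proportional
to `|u|` give `uᵐ Tᵐ G → 0` for `m > 0`, locally uniformly along the curve, and by Weierstrass'
theorem the same for the derivatives along the curve (`WedgeData.tendsto_pow_mul_iterate_deriv`).
Only the terms with `m = 0` survive, and they form a third order ordinary differential equation for
`f` (`WedgeData.lineEq211`, `WedgeData.curveEq122`). The change of variable to `z` and the
multiplication by powers of `z` and `1 - z` turn it into the symmetric square equation
(`symSqLHS_mul_comp`).

On the real segment the first series converges at the boundary of its convergence domain. By Gauss'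
product the coefficient of index `(i, j)` is of the order of `(i + j) ^ (-3/2)` times a binomial
coefficient whose indices are shifted by a constant (`coefBound_coef211`), so the homogeneous parts
form an absolutely convergent series. The derivative along the segment, in contrast to that in the
direction of an axis, is a combination of series of the same type with the same exponent
(`coefBound_iterate_shiftD_coef211`), so the sum is smooth on the segment, and the equation follows by
the same passage to the limit, now along rays (`lineEq211_segment`).
-/

/-! ### Holomorphic functions of two variables -/

/-- Weierstrass' theorem on a complex normed space: a limit of holomorphic functions on an open set
that is uniform near each point is holomorphic. -/
theorem differentiableOn_of_forall_tendstoUniformlyOn_ball {E ι : Type*} [NormedAddCommGroup E]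
    [NormedSpace ℂ E] {l : Filter ι} [l.NeBot] {g : E → ℂ} {W : Set E}
    (h : ∀ p ∈ W, ∃ r > 0, ∃ F : ι → E → ℂ, (∀ n, DifferentiableOn ℂ (F n) (Metric.ball p r)) ∧
      TendstoUniformlyOn F g l (Metric.ball p r)) : DifferentiableOn ℂ g W := by
  intro p hp
  obtain ⟨r, hr, F, hF, hu⟩ := h p hp
  have hsub : ∀ q ∈ Metric.ball p (r / 2), Metric.ball q (r / 2) ⊆ Metric.ball p r := by
    intro q hq
    exact Metric.ball_subset_ball' (by rw [Metric.mem_ball] at hq; linarith)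
  have hat : ∀ n, ∀ q ∈ Metric.ball p (r / 2), DifferentiableAt ℂ (F n) q := fun n q hq =>
    (hF n).differentiableAt (Metric.isOpen_ball.mem_nhds (Metric.ball_subset_ball (by linarith) hq))
  have hc : UniformCauchySeqOn (fun n => fderiv ℂ (F n)) l (Metric.ball p (r / 2)) := by
    intro u hu'
    obtain ⟨ε, hε, hεu⟩ := Metric.mem_uniformity_dist.1 hu'
    have h1 := Metric.tendstoUniformlyOn_iff.1 hu (ε * r / 32) (by positivity)
    filter_upwards [h1.prod_mk h1] with m hm q hq
    apply hεu
    have hball := hsub q hq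
    have hd : ∀ w ∈ Metric.ball p r, ‖F m.1 w - F m.2 w‖ ≤ ε * r / 16 := by
      intro w hw
      rw [← dist_eq_norm]
      have := dist_triangle_left (F m.1 w) (F m.2 w) (g w)
      have h2 := hm.1 w hw
      have h3 := hm.2 w hw
      linarith
    have := Complex.norm_fderiv_le_div_of_mapsTo_ball (f := fun w => F m.1 w - F m.2 w) (c := q)
      (R₁ := r / 2) (R₂ := ε * r / 8)
      (((hF _).sub (hF _)).mono hball) (by
        intro w hw
        rw [mem_closedBall_iff_norm]
        refine (norm_sub_le _ _).trans ?_
        have h2 := hd w (hball hw)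
        have h3 := hd q (hball (Metric.mem_ball_self (by linarith)))
        linarith) (by linarith)
    rw [fderiv_fun_sub (hat _ _ hq) (hat _ _ hq)] at this
    rw [dist_eq_norm]
    refine this.trans_lt ?_
    have : ε * r / 8 / (r / 2) = ε / 4 := by field_simp; ring
    linarith
  have hex : ∀ q ∈ Metric.ball p (r / 2), ∃ L, Tendsto (fun n => fderiv ℂ (F n) q) l (𝓝 L) :=
    fun q hq => cauchy_map_iff_exists_tendsto.1 (hc.cauchy_map hq)
  choose! g' hg' using hex
  have hp' : p ∈ Metric.ball p (r / 2) := Metric.mem_ball_self (by linarith)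
  exact (hasFDerivAt_of_tendstoUniformlyOn Metric.isOpen_ball
    (hc.tendstoUniformlyOn_of_tendsto hg') (fun n q hq => (hat n q hq).hasFDerivAt)
    (fun q hq => hu.tendsto_at (Metric.ball_subset_ball (by linarith) hq))
    hp').differentiableAt.differentiableWithinAt

/-- A second order Taylor estimate whose constant depends only on a bound of the function on a disc. -/
theorem norm_sub_sub_deriv_le {φ : ℂ → ℂ} {R M : ℝ} (hR : 0 < R)
    (hd : DifferentiableOn ℂ φ (Metric.ball 0 R)) (hM : ∀ s ∈ Metric.ball (0 : ℂ) R, ‖φ s‖ ≤ M)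
    {h : ℂ} (hh : ‖h‖ < R / 4) :
    ‖φ h - φ 0 - h * deriv φ 0‖ ≤ 32 * M / R ^ 2 * ‖h‖ ^ 2 := by
  have hM0 : 0 ≤ M := (norm_nonneg _).trans (hM 0 (by simpa using hR))
  have hO : IsOpen (Metric.ball (0 : ℂ) R) := Metric.isOpen_ball
  have h1 : ∀ s ∈ Metric.ball (0 : ℂ) (R / 2), ‖deriv φ s‖ ≤ 4 * M / R := by
    intro s hs
    have hsub : Metric.closedBall s (R / 4) ⊆ Metric.ball 0 R := by
      intro w hw
      simp only [Metric.mem_closedBall, Metric.mem_ball, dist_eq_norm, sub_zero] at *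
      have := norm_add_le (w - s) s
      rw [sub_add_cancel] at this; linarith
    have := Complex.norm_deriv_le_of_forall_mem_sphere_norm_le (c := s) (R := R / 4) (C := M)
      (f := φ) (by linarith) ((hd.mono hsub).diffContOnCl_ball subset_rfl)
      (fun z hz => hM z (hsub (Metric.sphere_subset_closedBall hz)))
    calc _ ≤ _ := this
      _ = _ := by field_simp
  have hd' : DifferentiableOn ℂ (deriv φ) (Metric.ball 0 R) := hd.deriv hO
  have h2 : ∀ s ∈ Metric.ball (0 : ℂ) (R / 4), ‖deriv (deriv φ) s‖ ≤ 32 * M / R ^ 2 := by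
    intro s hs
    have hsub : Metric.closedBall s (R / 8) ⊆ Metric.ball 0 (R / 2) := by
      intro w hw
      simp only [Metric.mem_closedBall, Metric.mem_ball, dist_eq_norm, sub_zero] at *
      have := norm_add_le (w - s) s
      rw [sub_add_cancel] at this; linarith
    have := Complex.norm_deriv_le_of_forall_mem_sphere_norm_le (c := s) (R := R / 8)
      (C := 4 * M / R) (f := deriv φ) (by linarith)
      ((hd'.mono (hsub.trans (Metric.ball_subset_ball (by linarith)))).diffContOnCl_ball subset_rfl)
      (fun z hz => h1 z (hsub (Metric.sphere_subset_closedBall hz)))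
    calc _ ≤ _ := this
      _ = _ := by field_simp; ring
  have hdat : ∀ s ∈ Metric.ball (0 : ℂ) (R / 4), DifferentiableAt ℂ φ s := fun s hs =>
    hd.differentiableAt (hO.mem_nhds (Metric.ball_subset_ball (by linarith) hs))
  have hdat' : ∀ s ∈ Metric.ball (0 : ℂ) (R / 4), DifferentiableAt ℂ (deriv φ) s := fun s hs =>
    hd'.differentiableAt (hO.mem_nhds (Metric.ball_subset_ball (by linarith) hs))
  have h0m : (0 : ℂ) ∈ Metric.ball (0 : ℂ) (R / 4) := by simpa using hR
  have h3 : ∀ s ∈ Metric.ball (0 : ℂ) (R / 4),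
      ‖deriv φ s - deriv φ 0‖ ≤ 32 * M / R ^ 2 * ‖s‖ := by
    intro s hs
    have := (convex_ball (0 : ℂ) (R / 4)).norm_image_sub_le_of_norm_deriv_le hdat' h2 h0m hs
    simpa using this
  have hcb : Metric.closedBall (0 : ℂ) ‖h‖ ⊆ Metric.ball 0 (R / 4) := by
    intro w hw; simp at *; linarith
  have h4 := (convex_closedBall (0 : ℂ) ‖h‖).norm_image_sub_le_of_norm_hasDerivWithin_le
    (f := fun s => φ s - s * deriv φ 0) (f' := fun s => deriv φ s - deriv φ 0)
    (C := 32 * M / R ^ 2 * ‖h‖) (x := 0) (y := h)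
    (fun s hs => (((hdat s (hcb hs)).hasDerivAt.sub
      (by simpa using (hasDerivAt_id s).mul_const (deriv φ 0)))).hasDerivWithinAt)
    (fun s hs => (h3 s (hcb hs)).trans (by
      gcongr; simpa using hs)) (by simp) (by simp)
  calc _ = ‖φ h - h * deriv φ 0 - (φ 0 - 0 * deriv φ 0)‖ := by congr 1; ring
    _ ≤ _ := h4
    _ = _ := by simp; ring

/-- The partial derivative in the first variable. -/
noncomputable def dX (G : ℂ × ℂ → ℂ) (p : ℂ × ℂ) : ℂ := fderiv ℂ G p (1, 0)

/-- The partial derivative in the second variable. -/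
noncomputable def dY (G : ℂ × ℂ → ℂ) (p : ℂ × ℂ) : ℂ := fderiv ℂ G p (0, 1)

/-- Directional derivatives of holomorphic functions are holomorphic. -/
theorem differentiableOn_fderiv_apply {G : ℂ × ℂ → ℂ} {W : Set (ℂ × ℂ)} (hW : IsOpen W)
    (hG : DifferentiableOn ℂ G W) {v : ℂ × ℂ} (hv : ‖v‖ = 1) :
    DifferentiableOn ℂ (fun p => fderiv ℂ G p v) W := by
  -- The derivative is the locally uniform limit of the difference quotients.
  refine differentiableOn_of_forall_tendstoUniformlyOn_ball (l := atTop (α := ℕ)) ?_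
  intro p hp
  obtain ⟨M, R, hR, hsub, hM⟩ : ∃ M R : ℝ, 0 < R ∧ Metric.ball p (2 * R) ⊆ W ∧
      ∀ q ∈ Metric.ball p (2 * R), ‖G q‖ ≤ M := by
    have hc : ContinuousAt G p := (hG.differentiableAt (hW.mem_nhds hp)).continuousAt
    have h1 : ∀ᶠ q in 𝓝 p, ‖G q‖ ≤ ‖G p‖ + 1 ∧ q ∈ W :=
      (hc.norm.eventually (eventually_le_nhds (by linarith))).and (hW.mem_nhds hp)
    obtain ⟨r, hr, h2⟩ := Metric.eventually_nhds_iff_ball.1 h1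
    have e : 2 * (r / 2) = r := by ring
    exact ⟨‖G p‖ + 1, r / 2, by linarith, fun q hq => (h2 q (e ▸ hq)).2,
      fun q hq => (h2 q (e ▸ hq)).1⟩
  have hM0 : 0 ≤ M := (norm_nonneg _).trans (hM p (Metric.mem_ball_self (by linarith)))
  have hmem : ∀ q ∈ Metric.ball p R, ∀ s ∈ Metric.ball (0 : ℂ) R,
      q + s • v ∈ Metric.ball p (2 * R) := by
    intro q hq s hs
    rw [mem_ball_iff_norm] at *
    calc ‖q + s • v - p‖ = ‖(q - p) + s • v‖ := by congr 1; abel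
      _ ≤ ‖q - p‖ + ‖s • v‖ := norm_add_le _ _
      _ < 2 * R := by rw [norm_smul, hv]; simp at hs; linarith
  have hφ : ∀ q ∈ Metric.ball p R, ∀ s ∈ Metric.ball (0 : ℂ) R,
      HasDerivAt (fun s : ℂ => G (q + s • v)) (fderiv ℂ G (q + s • v) v) s := by
    intro q hq s hs
    have h1 := (hG.differentiableAt (hW.mem_nhds (hsub (hmem q hq s hs)))).hasFDerivAt
    have h2 : HasDerivAt (fun s : ℂ => q + s • v) v s := by
      simpa using ((hasDerivAt_id s).smul_const v).const_add q
    exact h1.comp_hasDerivAt s h2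
  obtain ⟨N, hN⟩ := exists_nat_gt (4 / R)
  have hs : ∀ n : ℕ, ‖((n : ℂ) + N + 1)⁻¹‖ = ((n : ℝ) + N + 1)⁻¹ := by
    intro n
    rw [norm_inv]
    norm_cast
  have hs4 : ∀ n : ℕ, ((n : ℝ) + N + 1)⁻¹ < R / 4 := by
    intro n
    have hn : (0 : ℝ) ≤ n := n.cast_nonneg
    rw [div_lt_iff₀ hR] at hN
    rw [inv_lt_comm₀ (by positivity) (by positivity), inv_div, div_lt_iff₀ hR]
    nlinarith
  have hne : ∀ n : ℕ, (n : ℂ) + N + 1 ≠ 0 := fun n => by norm_cast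
  refine ⟨R, hR, fun n q => ((n : ℂ) + N + 1) * (G (q + ((n : ℂ) + N + 1)⁻¹ • v) - G q), ?_, ?_⟩
  · intro n
    refine DifferentiableOn.const_mul (DifferentiableOn.sub ?_ (hG.mono
      ((Metric.ball_subset_ball (by linarith)).trans hsub))) _
    refine hG.comp (differentiableOn_id.add_const _) ?_
    intro q hq
    refine hsub (hmem q hq _ ?_)
    rw [mem_ball_zero_iff, hs]
    linarith [hs4 n]
  · rw [Metric.tendstoUniformlyOn_iff]
    intro ε hε
    have h0 : Tendsto (fun n : ℕ => 32 * M / R ^ 2 * ((n : ℝ) + N + 1)⁻¹) atTop (𝓝 0) := by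
      rw [← mul_zero (32 * M / R ^ 2)]
      refine Tendsto.const_mul _ (tendsto_inv_atTop_zero.comp ?_)
      exact tendsto_atTop_add_const_right _ _ (tendsto_atTop_add_const_right _ _
        tendsto_natCast_atTop_atTop)
    filter_upwards [h0.eventually (gt_mem_nhds hε)] with n hn q hq
    have h0R : (0 : ℂ) ∈ Metric.ball (0 : ℂ) R := Metric.mem_ball_self hR
    have key := norm_sub_sub_deriv_le (φ := fun s : ℂ => G (q + s • v)) hR
      (fun s hs' => (hφ q hq s hs').differentiableAt.differentiableWithinAt)
      (fun s hs' => hM _ (hmem q hq s hs')) (h := ((n : ℂ) + N + 1)⁻¹)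
      (by rw [hs]; exact hs4 n)
    rw [(hφ q hq 0 h0R).deriv, hs] at key
    simp only [zero_smul, add_zero] at key
    rw [dist_comm, dist_eq_norm]
    refine lt_of_le_of_lt ?_ hn
    have e : ((n : ℂ) + N + 1) * (G (q + ((n : ℂ) + N + 1)⁻¹ • v) - G q) - fderiv ℂ G q v
        = ((n : ℂ) + N + 1) * (G (q + ((n : ℂ) + N + 1)⁻¹ • v) - G q -
          ((n : ℂ) + N + 1)⁻¹ * fderiv ℂ G q v) := by
      rw [mul_sub ((n : ℂ) + N + 1) (_ - _), mul_inv_cancel_left₀ (hne n)]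
    have hn' : ‖(n : ℂ) + N + 1‖ = (n : ℝ) + N + 1 := by
      have := hs n
      rw [norm_inv] at this
      exact inv_injective this
    have hpos : (0 : ℝ) < (n : ℝ) + N + 1 := by positivity
    rw [e, norm_mul, hn']
    calc _ ≤ ((n : ℝ) + N + 1) * (32 * M / R ^ 2 * ((n : ℝ) + N + 1)⁻¹ ^ 2) := by gcongr
      _ = _ := by field_simp

section TwoVariables

variable {G H : ℂ × ℂ → ℂ} {W : Set (ℂ × ℂ)} {p : ℂ × ℂ}

theorem DifferentiableOn.dX (hW : IsOpen W) (hG : DifferentiableOn ℂ G W) :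
    DifferentiableOn ℂ (dX G) W :=
  differentiableOn_fderiv_apply hW hG (by simp)

theorem DifferentiableOn.dY (hW : IsOpen W) (hG : DifferentiableOn ℂ G W) :
    DifferentiableOn ℂ (dY G) W :=
  differentiableOn_fderiv_apply hW hG (by simp)

theorem Set.EqOn.dX (hW : IsOpen W) (h : EqOn G H W) : EqOn (dX G) (dX H) W := fun p hp => by
  simp only [_root_.dX, (h.eventuallyEq_of_mem (hW.mem_nhds hp)).fderiv_eq]

theorem Set.EqOn.dY (hW : IsOpen W) (h : EqOn G H W) : EqOn (dY G) (dY H) W := fun p hp => by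
  simp only [_root_.dY, (h.eventuallyEq_of_mem (hW.mem_nhds hp)).fderiv_eq]

theorem fderiv_eq_dX_dY (v : ℂ × ℂ) : fderiv ℂ G p v = v.1 * dX G p + v.2 * dY G p := by
  have : v = v.1 • ((1, 0) : ℂ × ℂ) + v.2 • ((0, 1) : ℂ × ℂ) := by ext <;> simp
  refine (congrArg (fderiv ℂ G p) this).trans ?_
  rw [map_add, map_smul, map_smul, smul_eq_mul, smul_eq_mul, dX, dY]

/-- The chain rule along a holomorphic curve. -/
theorem hasDerivAt_comp_curve (hG : DifferentiableAt ℂ G p) {γ₁ γ₂ : ℂ → ℂ} {γ₁' γ₂' z : ℂ}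
    (h₁ : HasDerivAt γ₁ γ₁' z) (h₂ : HasDerivAt γ₂ γ₂' z) (hp : p = (γ₁ z, γ₂ z)) :
    HasDerivAt (fun ζ => G (γ₁ ζ, γ₂ ζ)) (γ₁' * dX G p + γ₂' * dY G p) z := by
  subst hp
  have := hG.hasFDerivAt.comp_hasDerivAt z (h₁.prodMk h₂)
  rwa [fderiv_eq_dX_dY] at this

theorem hasDerivAt_left (hG : DifferentiableAt ℂ G p) :
    HasDerivAt (fun x => G (x, p.2)) (dX G p) p.1 := by
  simpa using hasDerivAt_comp_curve hG (hasDerivAt_id p.1) (hasDerivAt_const p.1 p.2) rfl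

theorem hasDerivAt_right (hG : DifferentiableAt ℂ G p) :
    HasDerivAt (fun y => G (p.1, y)) (dY G p) p.2 := by
  simpa using hasDerivAt_comp_curve hG (hasDerivAt_const p.2 p.1) (hasDerivAt_id p.2) rfl

theorem dX_dY_comm (hW : IsOpen W) (hG : DifferentiableOn ℂ G W) (hp : p ∈ W) :
    dX (dY G) p = dY (dX G) p := by
  have h1 : ∀ᶠ q in 𝓝 p, HasFDerivAt G (fderiv ℂ G q) q := by
    filter_upwards [hW.mem_nhds hp] with q hq
    exact (hG.differentiableAt (hW.mem_nhds hq)).hasFDerivAt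
  have e : fderiv ℂ G = fun q => dX G q • ContinuousLinearMap.fst ℂ ℂ ℂ +
      dY G q • ContinuousLinearMap.snd ℂ ℂ ℂ := by
    ext1 q
    refine ContinuousLinearMap.ext fun v => ?_
    rw [fderiv_eq_dX_dY]
    simp [mul_comm]
  have hx := ((hG.dX hW).differentiableAt (hW.mem_nhds hp)).hasFDerivAt
  have hy := ((hG.dY hW).differentiableAt (hW.mem_nhds hp)).hasFDerivAt
  have h2 := (hx.smul_const (ContinuousLinearMap.fst ℂ ℂ ℂ)).add
    (hy.smul_const (ContinuousLinearMap.snd ℂ ℂ ℂ))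
  replace h2 := h2.congr_of_eventuallyEq (Eventually.of_forall fun q => congrFun e q)
  simpa [dX, dY] using second_derivative_symmetric_of_eventually h1 h2 (1, 0) (0, 1)

/-- The identity theorem for holomorphic functions of two variables. -/
theorem eqOn_zero_of_eqOn_zero_of_isPreconnected (hW : IsOpen W) (hc : IsPreconnected W)
    (hG : DifferentiableOn ℂ G W) {V : Set (ℂ × ℂ)} (hV : IsOpen V) (hne : V.Nonempty)
    (hVW : V ⊆ W) (h : EqOn G 0 V) : EqOn G 0 W := by
  set Z : Set (ℂ × ℂ) := {q | ∀ᶠ w in 𝓝 q, G w = 0}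
  have hZ : IsOpen Z := isOpen_setOfPred_eventually_nhds
  suffices W ⊆ Z from fun q hq => (this hq).self_of_nhds
  refine hc.subset_of_closure_inter_subset hZ ?_ ?_
  · obtain ⟨q, hq⟩ := hne
    exact ⟨q, hVW hq, by filter_upwards [hV.mem_nhds hq] with w hw using h hw⟩
  · rintro q ⟨hq, hqW⟩
    obtain ⟨r, hr, hsub⟩ := Metric.isOpen_iff.1 hW q hqW
    obtain ⟨q', hq'Z, hq'⟩ := Metric.mem_closure_iff.1 hq r hr
    rw [dist_comm] at hq'
    filter_upwards [Metric.ball_mem_nhds q hr] with w hw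
    -- On the line through `q'` and `w` the function vanishes near `q'`, hence also at `w`.
    set ℓ : ℂ → ℂ × ℂ := fun s => q' + s • (w - q') with hℓ
    have hℓd : Differentiable ℂ ℓ := by fun_prop
    have hS : IsOpen (ℓ ⁻¹' Metric.ball q r) := Metric.isOpen_ball.preimage hℓd.continuous
    have hSc : IsPreconnected (ℓ ⁻¹' Metric.ball q r) := by
      refine Convex.isPreconnected ?_
      intro s hs t ht a b ha hb hab
      have : ℓ (a • s + b • t) = a • ℓ s + b • ℓ t := by
        have hab' : (a : ℂ) + b = 1 := by exact_mod_cast hab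
        ext
        · simp only [hℓ, Prod.fst_add, Prod.smul_fst, Prod.fst_sub, Complex.real_smul, smul_eq_mul]
          linear_combination -q'.1 * hab'
        · simp only [hℓ, Prod.snd_add, Prod.smul_snd, Prod.snd_sub, Complex.real_smul, smul_eq_mul]
          linear_combination -q'.2 * hab'
      rw [mem_preimage, this]
      exact convex_ball q r hs ht ha hb hab
    have hd : DifferentiableOn ℂ (G ∘ ℓ) (ℓ ⁻¹' Metric.ball q r) :=
      hG.comp hℓd.differentiableOn fun s hs => hsub hs
    have h0 : (0 : ℂ) ∈ ℓ ⁻¹' Metric.ball q r := by simpa [hℓ] using hq'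
    have h1 : (1 : ℂ) ∈ ℓ ⁻¹' Metric.ball q r := by simpa [hℓ] using hw
    have hev : G ∘ ℓ =ᶠ[𝓝 0] 0 := by
      have : Tendsto ℓ (𝓝 0) (𝓝 q') := by
        simpa [hℓ] using hℓd.continuous.tendsto 0
      exact this.eventually hq'Z
    have := (hd.analyticOnNhd hS).eqOn_zero_of_preconnected_of_eventuallyEq_zero hSc h0 hev h1
    simpa [hℓ] using this

end TwoVariables

/-! ### Euler operators and analytic continuation of differential equations -/

/-- The Euler operator `a x ∂/∂x + b y ∂/∂y + α`. -/
noncomputable def eul (a b α : ℂ) (G : ℂ × ℂ → ℂ) (p : ℂ × ℂ) : ℂ :=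
  a * (p.1 * dX G p) + b * (p.2 * dY G p) + α * G p

/-- Operators on functions of two variables that are local and preserve holomorphy; these are the
properties that make the equation `Φ G = 0` stable under analytic continuation. -/
structure IsLocalOp (Φ : (ℂ × ℂ → ℂ) → ℂ × ℂ → ℂ) : Prop where
  differentiableOn : ∀ {W : Set (ℂ × ℂ)} {G : ℂ × ℂ → ℂ}, IsOpen W → DifferentiableOn ℂ G W →
    DifferentiableOn ℂ (Φ G) W
  eqOn : ∀ {W : Set (ℂ × ℂ)} {G H : ℂ × ℂ → ℂ}, IsOpen W → EqOn G H W → EqOn (Φ G) (Φ H) W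

theorem isLocalOp_id : IsLocalOp fun G => G := ⟨fun _ h => h, fun _ h => h⟩

theorem IsLocalOp.eul {Φ : (ℂ × ℂ → ℂ) → ℂ × ℂ → ℂ} (h : IsLocalOp Φ) (a b α : ℂ) :
    IsLocalOp fun G => eul a b α (Φ G) := by
  refine ⟨fun hW hG => ?_, fun hW hGH p hp => ?_⟩
  · have h0 := h.differentiableOn hW hG
    have h1 := h0.dX hW
    have h2 := h0.dY hW
    unfold _root_.eul
    fun_prop
  · have h0 := h.eqOn hW hGH
    simp only [_root_.eul, h0.dX hW hp, h0.dY hW hp, h0 hp]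

theorem IsLocalOp.mul {Φ : (ℂ × ℂ → ℂ) → ℂ × ℂ → ℂ} (h : IsLocalOp Φ) {m : ℂ × ℂ → ℂ}
    (hm : Differentiable ℂ m) : IsLocalOp fun G p => m p * Φ G p :=
  ⟨fun hW hG => hm.differentiableOn.mul (h.differentiableOn hW hG),
    fun hW hGH p hp => by simp only [h.eqOn hW hGH hp]⟩

theorem IsLocalOp.sub {Φ Ψ : (ℂ × ℂ → ℂ) → ℂ × ℂ → ℂ} (h : IsLocalOp Φ) (h' : IsLocalOp Ψ) :
    IsLocalOp fun G p => Φ G p - Ψ G p :=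
  ⟨fun hW hG => (h.differentiableOn hW hG).sub (h'.differentiableOn hW hG),
    fun hW hGH p hp => by simp only [h.eqOn hW hGH hp, h'.eqOn hW hGH hp]⟩

section Branch

variable {D W : Set (ℂ × ℂ)} {F G : ℂ × ℂ → ℂ}

theorem IsBranch.isOpen_and_differentiableOn (h : IsBranch D F W G) (hD : IsOpen D)
    (hF : DifferentiableOn ℂ F D) : IsOpen W ∧ DifferentiableOn ℂ G W := by
  cases h with
  | base => exact ⟨hD, hF⟩
  | step => exact ⟨by assumption, by assumption⟩

/-- Permanence of differential equations under analytic continuation. -/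
theorem IsBranch.eqOn_zero (h : IsBranch D F W G)
    {Φ : (ℂ × ℂ → ℂ) → ℂ × ℂ → ℂ} (hΦ : IsLocalOp Φ) (h0 : EqOn (Φ F) 0 D) :
    EqOn (Φ G) 0 W := by
  induction h with
  | base => exact h0
  | step W G W' G' V hb hW' hc hd hV hne hsub heq ih =>
    refine eqOn_zero_of_eqOn_zero_of_isPreconnected hW' hc (hΦ.differentiableOn hW' hd) hV hne
      (hsub.trans inter_subset_right) ?_
    exact (hΦ.eqOn hV heq).symm.trans (ih.mono (hsub.trans inter_subset_left))

end Branch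

section Expansion

variable {G : ℂ × ℂ → ℂ} {W : Set (ℂ × ℂ)} {p : ℂ × ℂ} (a b α a' b' α' a'' b'' α'' : ℂ)

/-- Commuting `∂/∂x` with an Euler operator shifts its constant term. -/
theorem dX_eul (hW : IsOpen W) (hG : DifferentiableOn ℂ G W) :
    EqOn (dX (eul a b α G)) (eul a b (α + a) (dX G)) W := by
  intro p hp
  have hx := hasDerivAt_left ((hG.dX hW).differentiableAt (hW.mem_nhds hp))
  have hy := hasDerivAt_left ((hG.dY hW).differentiableAt (hW.mem_nhds hp))
  have h0 := hasDerivAt_left (hG.differentiableAt (hW.mem_nhds hp))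
  have h1 := ((((hasDerivAt_id p.1).mul hx).const_mul a).add ((hy.const_mul p.2).const_mul b)).add
    (h0.const_mul α)
  have h2 := hasDerivAt_left (((isLocalOp_id.eul a b α).differentiableOn hW hG).differentiableAt
    (hW.mem_nhds hp))
  rw [h2.unique h1, eul, dX_dY_comm hW hG hp]
  simp only [id]
  ring

theorem dY_eul (hW : IsOpen W) (hG : DifferentiableOn ℂ G W) :
    EqOn (dY (eul a b α G)) (eul a b (α + b) (dY G)) W := by
  intro p hp
  have hx := hasDerivAt_right ((hG.dX hW).differentiableAt (hW.mem_nhds hp))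
  have hy := hasDerivAt_right ((hG.dY hW).differentiableAt (hW.mem_nhds hp))
  have h0 := hasDerivAt_right (hG.differentiableAt (hW.mem_nhds hp))
  have h1 := (((hx.const_mul p.1).const_mul a).add (((hasDerivAt_id p.2).mul hy).const_mul b)).add
    (h0.const_mul α)
  have h2 := hasDerivAt_right (((isLocalOp_id.eul a b α).differentiableOn hW hG).differentiableAt
    (hW.mem_nhds hp))
  rw [h2.unique h1, eul, dX_dY_comm hW hG hp]
  simp only [id]
  ring

theorem eul_eul_apply (hW : IsOpen W) (hG : DifferentiableOn ℂ G W) (hp : p ∈ W) :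
    eul a b α (eul a' b' α' G) p =
      a * (p.1 * eul a' b' (α' + a') (dX G) p) + b * (p.2 * eul a' b' (α' + b') (dY G) p) +
        α * eul a' b' α' G p := by
  rw [eul, dX_eul a' b' α' hW hG hp, dY_eul a' b' α' hW hG hp]

/-- The composition of three Euler operators in terms of partial derivatives. -/
theorem eul_eul_eul_apply (hW : IsOpen W) (hG : DifferentiableOn ℂ G W) (hp : p ∈ W) :
    eul a b α (eul a' b' α' (eul a'' b'' α'' G)) p =
      a * a' * a'' * p.1 ^ 3 * dX (dX (dX G)) p
      + (a * a' * b'' + a * b' * a'' + b * a' * a'') * p.1 ^ 2 * p.2 * dX (dX (dY G)) p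
      + (a * b' * b'' + b * a' * b'' + b * b' * a'') * p.1 * p.2 ^ 2 * dX (dY (dY G)) p
      + b * b' * b'' * p.2 ^ 3 * dY (dY (dY G)) p
      + (a * a' * α'' + a * α' * a'' + α * a' * a'' + 3 * a * a' * a'') * p.1 ^ 2 * dX (dX G) p
      + (a * b' * α'' + b * a' * α'' + a * α' * b'' + b * α' * a'' + α * a' * b'' + α * b' * a''
        + (a * a' * b'' + a * b' * a'' + b * a' * a'')
        + (a * b' * b'' + b * a' * b'' + b * b' * a'')) * p.1 * p.2 * dX (dY G) p
      + (b * b' * α'' + b * α' * b'' + α * b' * b'' + 3 * b * b' * b'') * p.2 ^ 2 * dY (dY G) p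
      + (a + α) * (a' + α') * (a'' + α'') * p.1 * dX G p - α * α' * α'' * p.1 * dX G p
      + (b + α) * (b' + α') * (b'' + α'') * p.2 * dY G p - α * α' * α'' * p.2 * dY G p
      + α * α' * α'' * G p := by
  have hK := (isLocalOp_id.eul a'' b'' α'').differentiableOn hW hG
  have hX := hG.dX hW
  have hY := hG.dY hW
  have e1 : eul a' b' (α' + a') (dX (eul a'' b'' α'' G)) p =
      eul a' b' (α' + a') (eul a'' b'' (α'' + a'') (dX G)) p :=
    (isLocalOp_id.eul _ _ _).eqOn hW (dX_eul a'' b'' α'' hW hG) hp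
  have e2 : eul a' b' (α' + b') (dY (eul a'' b'' α'' G)) p =
      eul a' b' (α' + b') (eul a'' b'' (α'' + b'') (dY G)) p :=
    (isLocalOp_id.eul _ _ _).eqOn hW (dY_eul a'' b'' α'' hW hG) hp
  have c0 : EqOn (dY (dX G)) (dX (dY G)) W := fun q hq => (dX_dY_comm hW hG hq).symm
  have c1 : dX (dY (dX G)) p = dX (dX (dY G)) p := c0.dX hW hp
  have c2 : dY (dX (dX G)) p = dX (dX (dY G)) p := by rw [← dX_dY_comm hW hX hp, c1]
  have c3 : dY (dY (dX G)) p = dX (dY (dY G)) p := by rw [c0.dY hW hp, dX_dY_comm hW hY hp]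
  have c4 : dY (dX (dY G)) p = dX (dY (dY G)) p := (dX_dY_comm hW hY hp).symm
  rw [eul_eul_apply _ _ _ _ _ _ hW hK hp, e1, e2, eul_eul_apply _ _ _ _ _ _ hW hX hp,
    eul_eul_apply _ _ _ _ _ _ hW hY hp, eul_eul_apply _ _ _ _ _ _ hW hG hp]
  simp only [eul, c1, c2, c3, c4, c0 hp]
  ring

end Expansion

/-! ### Double power series -/

/-- The sum of the double power series with coefficients `A`. -/
noncomputable def dser (A : ℕ × ℕ → ℂ) (p : ℂ × ℂ) : ℂ := ∑' k : ℕ × ℕ, A k * p.1 ^ k.1 * p.2 ^ k.2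

/-- The double power series with coefficients `A` converges (absolutely) at every point of `D`. -/
def ConvOn (A : ℕ × ℕ → ℂ) (D : Set (ℂ × ℂ)) : Prop :=
  ∀ p ∈ D, Summable fun k : ℕ × ℕ => A k * p.1 ^ k.1 * p.2 ^ k.2

/-- Every point of `D` lies in an open bidisc around the origin whose corner is in `D`; the
convergence domains of double power series have this property. -/
def BidiscCovered (D : Set (ℂ × ℂ)) : Prop :=
  ∀ p ∈ D, ∃ r₁ r₂ : ℝ, ‖p.1‖ < r₁ ∧ ‖p.2‖ < r₂ ∧ ((r₁ : ℂ), (r₂ : ℂ)) ∈ D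

section DoubleSeries

variable {D : Set (ℂ × ℂ)} {A B : ℕ × ℕ → ℂ} {p : ℂ × ℂ}

theorem norm_term_le {r₁ r₂ : ℝ} (h₁ : ‖p.1‖ ≤ r₁) (h₂ : ‖p.2‖ ≤ r₂) (k : ℕ × ℕ) :
    ‖A k * p.1 ^ k.1 * p.2 ^ k.2‖ ≤ ‖A k * (r₁ : ℂ) ^ k.1 * (r₂ : ℂ) ^ k.2‖ := by
  have h1 : 0 ≤ r₁ := (norm_nonneg _).trans h₁
  have h2 : 0 ≤ r₂ := (norm_nonneg _).trans h₂
  simp only [norm_mul, norm_pow, Complex.norm_real, Real.norm_eq_abs, abs_of_nonneg h1,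
    abs_of_nonneg h2]
  gcongr

theorem ConvOn.differentiableOn (hA : ConvOn A D) (hD : BidiscCovered D) :
    DifferentiableOn ℂ (dser A) D := by
  refine differentiableOn_of_forall_tendstoUniformlyOn_ball (l := atTop (α := Finset (ℕ × ℕ))) ?_
  intro p hp
  obtain ⟨r₁, r₂, h₁, h₂, hr⟩ := hD p hp
  refine ⟨min (r₁ - ‖p.1‖) (r₂ - ‖p.2‖), lt_min (by linarith) (by linarith),
    fun s q => ∑ k ∈ s, A k * q.1 ^ k.1 * q.2 ^ k.2, fun s => ?_, ?_⟩
  · exact DifferentiableOn.fun_sum fun k _ => by fun_prop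
  · refine tendstoUniformlyOn_tsum (hA _ hr).norm fun k q hq => ?_
    rw [mem_ball_iff_norm, Prod.norm_def, max_lt_iff] at hq
    have a1 := norm_add_le (q.1 - p.1) p.1
    have a2 := norm_add_le (q.2 - p.2) p.2
    rw [sub_add_cancel] at a1 a2
    have b1 := hq.1.trans_le (min_le_left _ _)
    have b2 := hq.2.trans_le (min_le_right _ _)
    simp only [Prod.fst_sub, Prod.snd_sub] at b1 b2
    exact norm_term_le (by linarith) (by linarith) k

theorem hasSum_dX_dser (hA : ConvOn A D) (hD : BidiscCovered D) (hDo : IsOpen D) (hp : p ∈ D) :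
    HasSum (fun k : ℕ × ℕ => A k * (k.1 * p.1 ^ (k.1 - 1)) * p.2 ^ k.2) (dX (dser A) p) := by
  obtain ⟨r₁, r₂, h₁, h₂, hr⟩ := hD p hp
  have h := Complex.hasSum_deriv_of_summable_norm (z := p.1) (U := Metric.ball 0 r₁)
    (F := fun k : ℕ × ℕ => fun x : ℂ => A k * x ^ k.1 * p.2 ^ k.2) (hA _ hr).norm
    (fun k => by fun_prop) Metric.isOpen_ball
    (fun k w hw => norm_term_le (p := (w, p.2)) (by simpa using (mem_ball_zero_iff.1 hw).le) h₂.le k)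
    (by simpa using h₁)
  have hd := hasDerivAt_left ((hA.differentiableOn hD).differentiableAt (hDo.mem_nhds hp))
  have e : (fun w : ℂ => ∑' k : ℕ × ℕ, A k * w ^ k.1 * p.2 ^ k.2) = fun w => dser A (w, p.2) := rfl
  rw [e, hd.deriv] at h
  refine h.congr_fun fun k => ?_
  simp

theorem hasSum_dY_dser (hA : ConvOn A D) (hD : BidiscCovered D) (hDo : IsOpen D) (hp : p ∈ D) :
    HasSum (fun k : ℕ × ℕ => A k * p.1 ^ k.1 * (k.2 * p.2 ^ (k.2 - 1))) (dY (dser A) p) := by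
  obtain ⟨r₁, r₂, h₁, h₂, hr⟩ := hD p hp
  have h := Complex.hasSum_deriv_of_summable_norm (z := p.2) (U := Metric.ball 0 r₂)
    (F := fun k : ℕ × ℕ => fun y : ℂ => A k * p.1 ^ k.1 * y ^ k.2) (hA _ hr).norm
    (fun k => by fun_prop) Metric.isOpen_ball
    (fun k w hw => norm_term_le (p := (p.1, w)) h₁.le (by simpa using (mem_ball_zero_iff.1 hw).le) k)
    (by simpa using h₂)
  have hd := hasDerivAt_right ((hA.differentiableOn hD).differentiableAt (hDo.mem_nhds hp))
  have e : (fun w : ℂ => ∑' k : ℕ × ℕ, A k * p.1 ^ k.1 * w ^ k.2) = fun w => dser A (p.1, w) := rfl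
  rw [e, hd.deriv] at h
  refine h.congr_fun fun k => ?_
  simp

theorem hasSum_eul_dser (hA : ConvOn A D) (hD : BidiscCovered D) (hDo : IsOpen D) (hp : p ∈ D)
    (a b α : ℂ) :
    HasSum (fun k : ℕ × ℕ => ((a * k.1 + b * k.2 + α) * A k) * p.1 ^ k.1 * p.2 ^ k.2)
      (eul a b α (dser A) p) := by
  have h := ((((hasSum_dX_dser hA hD hDo hp).mul_left p.1).mul_left a).add
    (((hasSum_dY_dser hA hD hDo hp).mul_left p.2).mul_left b)).add ((hA p hp).hasSum.mul_left α)
  refine h.congr_fun fun k => ?_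
  have e : ∀ (x : ℂ) (n : ℕ), x * (n * x ^ (n - 1)) = n * x ^ n := by
    intro x n
    rcases n with _ | n
    · simp
    · simp [pow_succ]; ring
  linear_combination (-a * A k * p.2 ^ k.2) * e p.1 k.1 - b * A k * p.1 ^ k.1 * e p.2 k.2

/-- The Euler operators act diagonally on the coefficients of double power series. -/
theorem ConvOn.eul (hA : ConvOn A D) (hD : BidiscCovered D) (hDo : IsOpen D) (a b α : ℂ) :
    ConvOn (fun k => (a * k.1 + b * k.2 + α) * A k) D :=
  fun _ hp => (hasSum_eul_dser hA hD hDo hp a b α).summable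

theorem eqOn_eul_dser (hA : ConvOn A D) (hD : BidiscCovered D) (hDo : IsOpen D) (a b α : ℂ) :
    EqOn (eul a b α (dser A)) (dser fun k => (a * k.1 + b * k.2 + α) * A k) D :=
  fun _ hp => (hasSum_eul_dser hA hD hDo hp a b α).tsum_eq.symm

theorem eqOn_eul_eul_eul_dser (hA : ConvOn A D) (hD : BidiscCovered D) (hDo : IsOpen D)
    (a b α a' b' α' a'' b'' α'' : ℂ) :
    EqOn (_root_.eul a b α (_root_.eul a' b' α' (_root_.eul a'' b'' α'' (dser A))))
      (dser fun k => (a * k.1 + b * k.2 + α) * ((a' * k.1 + b' * k.2 + α') *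
        ((a'' * k.1 + b'' * k.2 + α'') * A k))) D := by
  have h1 := hA.eul hD hDo a'' b'' α''
  have h2 := h1.eul hD hDo a' b' α'
  have e1 := eqOn_eul_dser hA hD hDo a'' b'' α''
  have e2 := ((isLocalOp_id.eul a' b' α').eqOn hDo e1).trans (eqOn_eul_dser h1 hD hDo a' b' α')
  exact ((isLocalOp_id.eul a b α).eqOn hDo e2).trans (eqOn_eul_dser h2 hD hDo a b α)

theorem dser_eq_fst_mul_dser (h0 : ∀ j, A (0, j) = 0) (h : ∀ i j, A (i + 1, j) = B (i, j)) :
    dser A p = p.1 * dser B p := by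
  have hinj : Function.Injective fun k : ℕ × ℕ => (k.1 + 1, k.2) := by
    rintro ⟨i, j⟩ ⟨i', j'⟩ h
    simpa using h
  rw [dser, dser, ← tsum_mul_left, ← hinj.tsum_eq]
  · refine tsum_congr fun k => ?_
    rw [h, pow_succ]
    ring
  · rintro ⟨i, j⟩ hk
    rcases i with _ | i
    · simp [h0] at hk
    · exact ⟨(i, j), rfl⟩

theorem dser_eq_snd_mul_dser (h0 : ∀ i, A (i, 0) = 0) (h : ∀ i j, A (i, j + 1) = B (i, j)) :
    dser A p = p.2 * dser B p := by
  have hinj : Function.Injective fun k : ℕ × ℕ => (k.1, k.2 + 1) := by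
    rintro ⟨i, j⟩ ⟨i', j'⟩ h
    simpa using h
  rw [dser, dser, ← tsum_mul_left, ← hinj.tsum_eq]
  · refine tsum_congr fun k => ?_
    rw [h, pow_succ]
    ring
  · rintro ⟨i, j⟩ hk
    rcases j with _ | j
    · simp [h0] at hk
    · exact ⟨(i, j), rfl⟩

end DoubleSeries

section Pochhammer

theorem poch_zero (a : ℂ) : poch a 0 = 1 := by simp [poch]

theorem poch_succ (a : ℂ) (n : ℕ) : poch a (n + 1) = poch a n * (a + n) := by
  simp [poch, ascPochhammer_succ_eval]

theorem poch_succ_left (a : ℂ) (n : ℕ) : poch a (n + 1) = a * poch (a + 1) n := by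
  induction n with
  | zero => simp [poch_succ, poch_zero]
  | succ n ih => rw [poch_succ, ih, poch_succ]; push_cast; ring

theorem LowerOK.add_ne_zero {q : ℂ} (h : LowerOK q) (n : ℕ) : q + n ≠ 0 := fun h' =>
  h n (eq_neg_of_add_eq_zero_left h')

theorem LowerOK.poch_ne_zero {q : ℂ} (h : LowerOK q) (n : ℕ) : poch q n ≠ 0 := by
  induction n with
  | zero => simp [poch_zero]
  | succ n ih => rw [poch_succ]; exact mul_ne_zero ih (h.add_ne_zero n)

theorem LowerOK.add_nat {q : ℂ} (h : LowerOK q) (m : ℕ) : LowerOK (q + m) := fun n hn =>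
  h (m + n) (by push_cast; linear_combination hn)

end Pochhammer

/-- The coefficients of the series `F^{2:1;1}_{1:1;1}`. -/
noncomputable def coef211 (a b p₁ p₂ c q₁ q₂ : ℂ) (k : ℕ × ℕ) : ℂ :=
  poch a (k.1 + k.2) * poch b (k.1 + k.2) * poch p₁ k.1 * poch p₂ k.2 /
    (poch c (k.1 + k.2) * poch q₁ k.1 * poch q₂ k.2 * (k.1.factorial : ℂ) * (k.2.factorial : ℂ))

/-- The coefficients of the series `F^{1:2;2}_{2:0;0}`. -/
noncomputable def coef122 (a p₁ p₂ q₁ q₂ b c : ℂ) (k : ℕ × ℕ) : ℂ :=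
  poch a (k.1 + k.2) * poch p₁ k.1 * poch p₂ k.2 * poch q₁ k.1 * poch q₂ k.2 /
    (poch b (k.1 + k.2) * poch c (k.1 + k.2) * (k.1.factorial : ℂ) * (k.2.factorial : ℂ))

section Coefficients

variable {a b p₁ p₂ c q₁ q₂ : ℂ}

theorem coef211_succ_left (i j : ℕ) :
    coef211 a b p₁ p₂ c q₁ q₂ (i + 1, j) = coef211 a b p₁ p₂ c q₁ q₂ (i, j) *
      ((a + (i + j)) * (b + (i + j)) * (p₁ + i) / ((c + (i + j)) * (q₁ + i) * (i + 1))) := by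
  simp only [coef211, show i + 1 + j = i + j + 1 by ring, poch_succ, Nat.factorial_succ]
  rw [div_mul_div_comm]
  push_cast
  congr 1 <;> ring

theorem coef211_succ_right (i j : ℕ) :
    coef211 a b p₁ p₂ c q₁ q₂ (i, j + 1) = coef211 a b p₁ p₂ c q₁ q₂ (i, j) *
      ((a + (i + j)) * (b + (i + j)) * (p₂ + j) / ((c + (i + j)) * (q₂ + j) * (j + 1))) := by
  simp only [coef211, show i + (j + 1) = i + j + 1 by ring, poch_succ, Nat.factorial_succ]
  rw [div_mul_div_comm]
  push_cast
  congr 1 <;> ring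

theorem coef122_succ_left (i j : ℕ) :
    coef122 a p₁ p₂ q₁ q₂ b c (i + 1, j) = coef122 a p₁ p₂ q₁ q₂ b c (i, j) *
      ((a + (i + j)) * (p₁ + i) * (q₁ + i) / ((b + (i + j)) * (c + (i + j)) * (i + 1))) := by
  simp only [coef122, show i + 1 + j = i + j + 1 by ring, poch_succ, Nat.factorial_succ]
  rw [div_mul_div_comm]
  push_cast
  congr 1 <;> ring

theorem coef122_succ_right (i j : ℕ) :
    coef122 a p₁ p₂ q₁ q₂ b c (i, j + 1) = coef122 a p₁ p₂ q₁ q₂ b c (i, j) *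
      ((a + (i + j)) * (p₂ + j) * (q₂ + j) / ((b + (i + j)) * (c + (i + j)) * (j + 1))) := by
  simp only [coef122, show i + (j + 1) = i + j + 1 by ring, poch_succ, Nat.factorial_succ]
  rw [div_mul_div_comm]
  push_cast
  congr 1 <;> ring

end Coefficients

/-! ### The differential equations of the double hypergeometric functions -/

section Systems

/-- The differential equations of `F^{2:1;1}_{1:1;1}` at the point `p`: two equations that express
the ratios of coefficients neighbouring in one index, and one that relates the coefficients of
indices `(i + 1, j)` and `(i, j + 1)`. -/
def Sys211 (a b p₁ p₂ c q₁ q₂ : ℂ) (G : ℂ × ℂ → ℂ) (p : ℂ × ℂ) : Prop :=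
  eul 1 0 0 (eul 1 0 (q₁ - 1) (eul 1 1 (c - 1) G)) p -
      p.1 * eul 1 1 a (eul 1 1 b (eul 1 0 p₁ G)) p = 0 ∧
    eul 0 1 0 (eul 0 1 (q₂ - 1) (eul 1 1 (c - 1) G)) p -
      p.2 * eul 1 1 a (eul 1 1 b (eul 0 1 p₂ G)) p = 0 ∧
    p.1 * eul 1 0 p₁ (eul 0 1 0 (eul 0 1 (q₂ - 1) G)) p -
      p.2 * eul 0 1 p₂ (eul 1 0 0 (eul 1 0 (q₁ - 1) G)) p = 0

/-- The differential equations of `F^{1:2;2}_{2:0;0}` at the point `p`. -/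
def Sys122 (a p₁ p₂ q₁ q₂ b c : ℂ) (G : ℂ × ℂ → ℂ) (p : ℂ × ℂ) : Prop :=
  eul 1 0 0 (eul 1 1 (b - 1) (eul 1 1 (c - 1) G)) p -
      p.1 * eul 1 1 a (eul 1 0 p₁ (eul 1 0 q₁ G)) p = 0 ∧
    eul 0 1 0 (eul 1 1 (b - 1) (eul 1 1 (c - 1) G)) p -
      p.2 * eul 1 1 a (eul 0 1 p₂ (eul 0 1 q₂ G)) p = 0 ∧
    p.1 * eul 1 0 p₁ (eul 1 0 q₁ (eul 0 1 0 G)) p -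
      p.2 * eul 0 1 p₂ (eul 0 1 q₂ (eul 1 0 0 G)) p = 0

variable {a b p₁ p₂ c q₁ q₂ : ℂ} {D W : Set (ℂ × ℂ)} {F G : ℂ × ℂ → ℂ}

theorem sys211_dser (hA : ConvOn (coef211 a b p₁ p₂ c q₁ q₂) D) (hD : BidiscCovered D)
    (hDo : IsOpen D) (hc : LowerOK c) (hq₁ : LowerOK q₁) (hq₂ : LowerOK q₂) {p : ℂ × ℂ}
    (hp : p ∈ D) : Sys211 a b p₁ p₂ c q₁ q₂ (dser (coef211 a b p₁ p₂ c q₁ q₂)) p := by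
  have hcn : ∀ i j : ℕ, c + ((i : ℂ) + j) ≠ 0 := fun i j => by
    exact_mod_cast hc.add_ne_zero (i + j)
  have h1 := hq₁.add_ne_zero
  have h2 := hq₂.add_ne_zero
  have h3 : ∀ i : ℕ, (i : ℂ) + 1 ≠ 0 := fun i => by norm_cast
  simp only [Sys211, fun a b α a' b' α' a'' b'' α'' => eqOn_eul_eul_eul_dser hA hD hDo
    a b α a' b' α' a'' b'' α'' hp]
  refine ⟨sub_eq_zero.2 (dser_eq_fst_mul_dser (fun j => by simp) fun i j => ?_),
    sub_eq_zero.2 (dser_eq_snd_mul_dser (fun i => by simp) fun i j => ?_), ?_⟩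
  · have := hcn i j; have := h1 i; have := h3 i
    rw [coef211_succ_left]
    push_cast
    generalize coef211 a b p₁ p₂ c q₁ q₂ (i, j) = A
    field_simp
    ring
  · have := hcn i j; have := h2 j; have := h3 j
    rw [coef211_succ_right]
    push_cast
    generalize coef211 a b p₁ p₂ c q₁ q₂ (i, j) = A
    field_simp
    ring
  · -- Both terms are `x y` times the same series.
    set E : ℕ × ℕ → ℂ := fun k => (a + (k.1 + k.2)) * (b + (k.1 + k.2)) * (p₁ + k.1) *
      (p₂ + k.2) / (c + (k.1 + k.2)) * coef211 a b p₁ p₂ c q₁ q₂ k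
    refine sub_eq_zero.2 ((congrArg (p.1 * ·) (dser_eq_snd_mul_dser (B := E) (fun i => by simp)
      fun i j => ?_)).trans ((mul_left_comm _ _ _).trans
      (congrArg (p.2 * ·) (dser_eq_fst_mul_dser (B := E) (fun i => by simp) fun i j => ?_).symm)))
    · have := hcn i j; have := h2 j; have := h3 j
      rw [coef211_succ_right]
      push_cast
      simp only [E]
      generalize coef211 a b p₁ p₂ c q₁ q₂ (i, j) = A
      field_simp
      ring
    · have := hcn i j; have := h1 i; have := h3 i
      rw [coef211_succ_left]
      push_cast
      simp only [E]
      generalize coef211 a b p₁ p₂ c q₁ q₂ (i, j) = A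
      field_simp
      ring

theorem sys122_dser (hA : ConvOn (coef122 a p₁ p₂ q₁ q₂ b c) D) (hD : BidiscCovered D)
    (hDo : IsOpen D) (hb : LowerOK b) (hc : LowerOK c) {p : ℂ × ℂ}
    (hp : p ∈ D) : Sys122 a p₁ p₂ q₁ q₂ b c (dser (coef122 a p₁ p₂ q₁ q₂ b c)) p := by
  have hcn : ∀ i j : ℕ, c + ((i : ℂ) + j) ≠ 0 := fun i j => by
    exact_mod_cast hc.add_ne_zero (i + j)
  have hbn : ∀ i j : ℕ, b + ((i : ℂ) + j) ≠ 0 := fun i j => by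
    exact_mod_cast hb.add_ne_zero (i + j)
  have h3 : ∀ i : ℕ, (i : ℂ) + 1 ≠ 0 := fun i => by norm_cast
  simp only [Sys122, fun a b α a' b' α' a'' b'' α'' => eqOn_eul_eul_eul_dser hA hD hDo
    a b α a' b' α' a'' b'' α'' hp]
  refine ⟨sub_eq_zero.2 (dser_eq_fst_mul_dser (fun j => by simp) fun i j => ?_),
    sub_eq_zero.2 (dser_eq_snd_mul_dser (fun i => by simp) fun i j => ?_), ?_⟩
  · have := hcn i j; have := hbn i j; have := h3 i
    rw [coef122_succ_left]
    push_cast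
    generalize coef122 a p₁ p₂ q₁ q₂ b c (i, j) = A
    field_simp
    ring
  · have := hcn i j; have := hbn i j; have := h3 j
    rw [coef122_succ_right]
    push_cast
    generalize coef122 a p₁ p₂ q₁ q₂ b c (i, j) = A
    field_simp
    ring
  · -- Both terms are `x y` times the same series.
    set E : ℕ × ℕ → ℂ := fun k => (a + (k.1 + k.2)) * (p₁ + k.1) * (q₁ + k.1) *
      (p₂ + k.2) * (q₂ + k.2) / ((b + (k.1 + k.2)) * (c + (k.1 + k.2))) *
      coef122 a p₁ p₂ q₁ q₂ b c k
    refine sub_eq_zero.2 ((congrArg (p.1 * ·) (dser_eq_snd_mul_dser (B := E) (fun i => by simp)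
      fun i j => ?_)).trans ((mul_left_comm _ _ _).trans
      (congrArg (p.2 * ·) (dser_eq_fst_mul_dser (B := E) (fun i => by simp) fun i j => ?_).symm)))
    · have := hcn i j; have := hbn i j; have := h3 j
      rw [coef122_succ_right]
      push_cast
      simp only [E]
      generalize coef122 a p₁ p₂ q₁ q₂ b c (i, j) = A
      field_simp
      ring
    · have := hcn i j; have := hbn i j; have := h3 i
      rw [coef122_succ_left]
      push_cast
      simp only [E]
      generalize coef122 a p₁ p₂ q₁ q₂ b c (i, j) = A
      field_simp
      ring

theorem IsBranch.sys211 (h : IsBranch D F W G)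
    (h0 : ∀ p ∈ D, Sys211 a b p₁ p₂ c q₁ q₂ F p) : ∀ p ∈ W, Sys211 a b p₁ p₂ c q₁ q₂ G p := by
  have hop : ∀ a b α a' b' α' a'' b'' α'' : ℂ,
      IsLocalOp fun G => eul a b α (eul a' b' α' (eul a'' b'' α'' G)) := fun a b α a' b' α' a'' b'' α'' =>
    ((isLocalOp_id.eul _ _ _).eul _ _ _).eul _ _ _
  exact fun p hp => ⟨h.eqOn_zero ((hop _ _ _ _ _ _ _ _ _).sub
      ((hop _ _ _ _ _ _ _ _ _).mul differentiable_fst)) (fun q hq => (h0 q hq).1) hp,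
    h.eqOn_zero ((hop _ _ _ _ _ _ _ _ _).sub
      ((hop _ _ _ _ _ _ _ _ _).mul differentiable_snd)) (fun q hq => (h0 q hq).2.1) hp,
    h.eqOn_zero (((hop _ _ _ _ _ _ _ _ _).mul differentiable_fst).sub
      ((hop _ _ _ _ _ _ _ _ _).mul differentiable_snd)) (fun q hq => (h0 q hq).2.2) hp⟩

theorem IsBranch.sys122 (h : IsBranch D F W G)
    (h0 : ∀ p ∈ D, Sys122 a p₁ p₂ q₁ q₂ b c F p) : ∀ p ∈ W, Sys122 a p₁ p₂ q₁ q₂ b c G p := by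
  have hop : ∀ a b α a' b' α' a'' b'' α'' : ℂ,
      IsLocalOp fun G => eul a b α (eul a' b' α' (eul a'' b'' α'' G)) := fun a b α a' b' α' a'' b'' α'' =>
    ((isLocalOp_id.eul _ _ _).eul _ _ _).eul _ _ _
  exact fun p hp => ⟨h.eqOn_zero ((hop _ _ _ _ _ _ _ _ _).sub
      ((hop _ _ _ _ _ _ _ _ _).mul differentiable_fst)) (fun q hq => (h0 q hq).1) hp,
    h.eqOn_zero ((hop _ _ _ _ _ _ _ _ _).sub
      ((hop _ _ _ _ _ _ _ _ _).mul differentiable_snd)) (fun q hq => (h0 q hq).2.1) hp,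
    h.eqOn_zero (((hop _ _ _ _ _ _ _ _ _).mul differentiable_fst).sub
      ((hop _ _ _ _ _ _ _ _ _).mul differentiable_snd)) (fun q hq => (h0 q hq).2.2) hp⟩

end Systems

/-! ### Growth of Pochhammer symbols and convergence of the double series -/

theorem poch_eq_prod (s : ℂ) (n : ℕ) : poch s n = ∏ j ∈ Finset.range n, (s + j) := by
  induction n with
  | zero => simp [poch_zero]
  | succ n ih => rw [poch_succ, ih, Finset.prod_range_succ]

/-- The order of growth of the Pochhammer symbol `(s)_n`, where `σ` is the real part of `s`. -/
noncomputable def pochWeight (σ : ℝ) (n : ℕ) : ℝ := n.factorial * ((n : ℝ) + 1) ^ (σ - 1)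

theorem pochWeight_pos (σ : ℝ) (n : ℕ) : 0 < pochWeight σ n := by
  unfold pochWeight
  positivity

/-- This is Gauss' product formula for the Gamma function. -/
theorem tendsto_norm_poch_div {s : ℂ} (hs : LowerOK s) :
    Tendsto (fun n => ‖poch s n‖ / pochWeight s.re n) atTop (𝓝 ‖(Complex.Gamma s)⁻¹‖) := by
  rw [← tendsto_add_atTop_iff_nat 1]
  have hG : Complex.Gamma s ≠ 0 := Complex.Gamma_ne_zero fun m => hs m
  have h1 := ((Complex.GammaSeq_tendsto_Gamma s).inv₀ hG).norm
  have h2 : Tendsto (fun n : ℕ => ((n : ℝ) / (n + 2)) ^ s.re * (((n : ℝ) + 2) / (n + 1))) atTop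
      (𝓝 1) := by
    have ha : Tendsto (fun n : ℕ => (n : ℝ) / (n + 2)) atTop (𝓝 1) := by
      exact_mod_cast tendsto_natCast_div_add_atTop (2 : ℝ)
    have hb : Tendsto (fun n : ℕ => (n : ℝ) / (n + 1)) atTop (𝓝 1) := by
      exact_mod_cast tendsto_natCast_div_add_atTop (1 : ℝ)
    have h3 := (ha.rpow_const (p := s.re) (Or.inl one_ne_zero)).mul (hb.div ha one_ne_zero)
    rw [Real.one_rpow, div_one, one_mul] at h3
    refine h3.congr' ?_
    filter_upwards [eventually_ne_atTop 0] with n hn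
    have : (n : ℝ) ≠ 0 := by exact_mod_cast hn
    simp only [Pi.div_apply]
    field_simp
  have h3 := h2.mul h1
  rw [one_mul] at h3
  refine h3.congr' ?_
  filter_upwards [eventually_ne_atTop 0] with n hn
  have hn' : (0 : ℝ) < n := by positivity
  rw [Complex.GammaSeq, ← poch_eq_prod, norm_inv, norm_div, norm_mul, inv_div,
    Complex.norm_natCast_cpow_of_pos (Nat.pos_of_ne_zero hn), Complex.norm_natCast, pochWeight,
    Nat.factorial_succ, Real.div_rpow hn'.le (by positivity), Nat.cast_succ]
  have e : ((n : ℝ) + 1 + 1) = n + 2 := by ring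
  rw [e, Real.rpow_sub_one (by positivity)]
  have h4 : (n : ℝ) ^ s.re ≠ 0 := by positivity
  have h5 : ((n : ℝ) + 2) ^ s.re ≠ 0 := by positivity
  push_cast
  field_simp

theorem exists_norm_poch_le (s : ℂ) : ∃ C, 0 < C ∧ ∀ n, ‖poch s n‖ ≤ C * pochWeight s.re n := by
  have : ∃ l, Tendsto (fun n => ‖poch s n‖ / pochWeight s.re n) atTop (𝓝 l) := by
    by_cases hs : LowerOK s
    · exact ⟨_, tendsto_norm_poch_div hs⟩
    · refine ⟨0, tendsto_const_nhds.congr' ?_⟩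
      simp only [LowerOK, not_forall, not_not] at hs
      obtain ⟨m, hm⟩ := hs
      filter_upwards [eventually_gt_atTop m] with n hn
      have : poch s n = 0 := by
        rw [poch_eq_prod]
        exact Finset.prod_eq_zero (Finset.mem_range.2 hn) (by rw [hm]; ring)
      simp [this]
  obtain ⟨l, hl⟩ := this
  obtain ⟨C, hC⟩ := hl.bddAbove_range
  refine ⟨max C 1, by positivity, fun n => ?_⟩
  rw [← div_le_iff₀ (pochWeight_pos _ _)]
  exact (hC ⟨n, rfl⟩).trans (le_max_left _ _)

theorem LowerOK.exists_le_norm_poch {s : ℂ} (hs : LowerOK s) :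
    ∃ C, 0 < C ∧ ∀ n, pochWeight s.re n ≤ C * ‖poch s n‖ := by
  have hG : ‖(Complex.Gamma s)⁻¹‖ ≠ 0 := by
    simpa using Complex.Gamma_ne_zero fun m => hs m
  obtain ⟨C, hC⟩ := ((tendsto_norm_poch_div hs).inv₀ hG).bddAbove_range
  refine ⟨max C 1, by positivity, fun n => ?_⟩
  rw [← div_le_iff₀ (norm_pos_iff.2 (hs.poch_ne_zero n))]
  have := hC ⟨n, rfl⟩
  simp only [inv_div] at this
  exact this.trans (le_max_left _ _)

/-- The coefficients `A (i, j)` are dominated, up to the factor `(i + j + 1) ^ e`, by the binomial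
coefficients `(i + j + 2K).choose (i + K)`. The shift by `K` absorbs all powers of `(i + j) / i` and
`(i + j) / j`, and it does not change the order of growth of the sums over `i + j = n`. -/
def CoefBound (e : ℝ) (A : ℕ × ℕ → ℂ) : Prop :=
  ∃ (C : ℝ) (K : ℕ), 0 ≤ C ∧ ∀ i j : ℕ,
    ‖A (i, j)‖ ≤ C * (((i : ℝ) + j + 1) ^ e * (i + j + 2 * K).choose (i + K))

theorem factorial_add_le (i K : ℕ) : (i + K).factorial ≤ i.factorial * (K.factorial * (i + 1) ^ K) := by
  induction K with
  | zero => simp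
  | succ K ih =>
    rw [← add_assoc, Nat.factorial_succ, Nat.factorial_succ, pow_succ]
    calc (i + K + 1) * (i + K).factorial
        ≤ ((K + 1) * (i + 1)) * (i.factorial * (K.factorial * (i + 1) ^ K)) :=
          Nat.mul_le_mul (by nlinarith) ih
      _ = _ := by ring

/-- Raising both indices of a binomial coefficient by `K` gains, up to a constant, the factor
`((i + j + 1) / (i + 1)) ^ K * ((i + j + 1) / (j + 1)) ^ K`. -/
theorem choose_mul_pow_le (i j K : ℕ) :
    (i + j).choose i * (i + j + 1) ^ (2 * K) ≤
      K.factorial ^ 2 * (i + 1) ^ K * (j + 1) ^ K * (i + j + 2 * K).choose (i + K) := by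
  have e1 : (i + j).choose i * i.factorial * j.factorial = (i + j).factorial := by
    rw [Nat.choose_symm_add, Nat.add_choose_mul_factorial_mul_factorial]
  have e2 : (i + K + (j + K)).choose (i + K) * (i + K).factorial * (j + K).factorial =
      (i + K + (j + K)).factorial := by
    rw [Nat.choose_symm_add, Nat.add_choose_mul_factorial_mul_factorial]
  rw [show i + K + (j + K) = i + j + 2 * K by ring] at e2
  have h1 := factorial_add_le i K
  have h2 := factorial_add_le j K
  have h3 := Nat.factorial_mul_pow_le_factorial (m := i + j) (n := 2 * K)
  rw [← e1, ← e2] at h3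
  have hpos : 0 < i.factorial * j.factorial := by positivity
  refine Nat.le_of_mul_le_mul_right ?_ hpos
  calc (i + j).choose i * (i + j + 1) ^ (2 * K) * (i.factorial * j.factorial)
      = (i + j).choose i * i.factorial * j.factorial * (i + j + 1) ^ (2 * K) := by ring
    _ ≤ _ := h3
    _ ≤ (i + j + 2 * K).choose (i + K) * (i.factorial * (K.factorial * (i + 1) ^ K)) *
        (j.factorial * (K.factorial * (j + 1) ^ K)) := by gcongr
    _ = _ := by ring

theorem choose_mul_div_pow_le (i j K : ℕ) :
    ((i + j).choose i : ℝ) * ((((i : ℝ) + j + 1) / (i + 1)) ^ K * (((i : ℝ) + j + 1) / (j + 1)) ^ K) ≤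
      K.factorial ^ 2 * (i + j + 2 * K).choose (i + K) := by
  have h : (((i + j).choose i * (i + j + 1) ^ (2 * K) : ℕ) : ℝ) ≤
      ((K.factorial ^ 2 * (i + 1) ^ K * (j + 1) ^ K * (i + j + 2 * K).choose (i + K) : ℕ) : ℝ) :=
    Nat.cast_le.2 (choose_mul_pow_le i j K)
  push_cast at h
  rw [div_pow, div_pow, div_mul_div_comm, mul_div_assoc', div_le_iff₀ (by positivity), ← pow_add,
    ← two_mul]
  linarith

theorem pochWeight_div (σ τ : ℝ) (n : ℕ) :
    pochWeight σ n / pochWeight τ n = ((n : ℝ) + 1) ^ (σ - τ) := by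
  have : (n.factorial : ℝ) ≠ 0 := by positivity
  rw [pochWeight, pochWeight, mul_div_mul_left _ _ this, ← Real.rpow_sub (by positivity)]
  congr 1
  ring

section CoefBound

variable {a b p₁ p₂ c q₁ q₂ : ℂ}

/-- A real power of `i + 1` is bounded by the power of `n + 1` of the same exponent, up to a power
of `(n + 1) / (i + 1)`. -/
theorem rpow_le_rpow_mul_pow {u v e : ℝ} {K : ℕ} (hu : 0 < u) (huv : u ≤ v) (hK : |e| ≤ K) :
    u ^ e ≤ v ^ e * (v / u) ^ K := by
  have hv : 0 < v := hu.trans_le huv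
  have h1 : (u / v) ^ e ≤ (u / v) ^ (-(K : ℝ)) :=
    Real.rpow_le_rpow_of_exponent_ge (by positivity) (by rwa [div_le_one hv])
      (by linarith [neg_abs_le e])
  rw [Real.div_rpow hu.le hv.le, div_le_iff₀ (by positivity), Real.rpow_neg (by positivity),
    Real.rpow_natCast, ← inv_pow, inv_div] at h1
  rwa [mul_comm]

theorem coefBound_coef211 (hc : LowerOK c) (hq₁ : LowerOK q₁) (hq₂ : LowerOK q₂) :
    CoefBound ((a + b - c + p₁ - q₁ + p₂ - q₂).re - 1) (coef211 a b p₁ p₂ c q₁ q₂) := by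
  obtain ⟨Ca, ha0, ha⟩ := exists_norm_poch_le a
  obtain ⟨Cb, hb0, hb⟩ := exists_norm_poch_le b
  obtain ⟨C1, h10, h1⟩ := exists_norm_poch_le p₁
  obtain ⟨C2, h20, h2⟩ := exists_norm_poch_le p₂
  obtain ⟨Cc, hc0, hc'⟩ := hc.exists_le_norm_poch
  obtain ⟨D1, k10, k1⟩ := hq₁.exists_le_norm_poch
  obtain ⟨D2, k20, k2⟩ := hq₂.exists_le_norm_poch
  obtain ⟨K, hK⟩ := exists_nat_ge (max |(p₁ - q₁).re| |(p₂ - q₂).re|)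
  refine ⟨Ca * Cb * C1 * C2 * Cc * D1 * D2 * K.factorial ^ 2, K, by positivity, fun i j => ?_⟩
  set n := i + j with hn
  have hnc : (i : ℝ) + j + 1 = n + 1 := by rw [hn]; push_cast; ring
  have hW : ‖coef211 a b p₁ p₂ c q₁ q₂ (i, j)‖ ≤
      (Ca * pochWeight a.re n * (Cb * pochWeight b.re n) * (C1 * pochWeight p₁.re i) *
        (C2 * pochWeight p₂.re j)) / ((pochWeight c.re n / Cc) * (pochWeight q₁.re i / D1) *
        (pochWeight q₂.re j / D2) * i.factorial * j.factorial) := by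
    have w1 := pochWeight_pos c.re n
    have w2 := pochWeight_pos q₁.re i
    have w3 := pochWeight_pos q₂.re j
    have v1 : pochWeight c.re n / Cc ≤ ‖poch c n‖ := (div_le_iff₀' hc0).2 (hc' n)
    have v2 : pochWeight q₁.re i / D1 ≤ ‖poch q₁ i‖ := (div_le_iff₀' k10).2 (k1 i)
    have v3 : pochWeight q₂.re j / D2 ≤ ‖poch q₂ j‖ := (div_le_iff₀' k20).2 (k2 j)
    simp only [coef211, ← hn, norm_div, norm_mul, Complex.norm_natCast]
    have := ha n
    have := hb n
    have := h1 i
    have := h2 j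
    have := pochWeight_pos a.re n
    have := pochWeight_pos b.re n
    have := pochWeight_pos p₁.re i
    have := pochWeight_pos p₂.re j
    gcongr
  have hi : ((i : ℝ) + 1) ^ (p₁ - q₁).re ≤
      ((n : ℝ) + 1) ^ (p₁ - q₁).re * (((n : ℝ) + 1) / (i + 1)) ^ K :=
    rpow_le_rpow_mul_pow (by positivity) (by rw [hn]; push_cast; linarith [j.cast_nonneg (α := ℝ)])
      ((le_max_left _ _).trans hK)
  have hj : ((j : ℝ) + 1) ^ (p₂ - q₂).re ≤
      ((n : ℝ) + 1) ^ (p₂ - q₂).re * (((n : ℝ) + 1) / (j + 1)) ^ K :=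
    rpow_le_rpow_mul_pow (by positivity) (by rw [hn]; push_cast; linarith [i.cast_nonneg (α := ℝ)])
      ((le_max_right _ _).trans hK)
  have hch : ((n.choose i : ℕ) : ℝ) = n.factorial / (i.factorial * j.factorial) := by
    rw [eq_div_iff (by positivity), hn, Nat.choose_symm_add, ← mul_assoc]
    exact_mod_cast Nat.add_choose_mul_factorial_mul_factorial i j
  have hE : pochWeight a.re n * pochWeight b.re n / pochWeight c.re n =
      n.factorial * ((n : ℝ) + 1) ^ ((a + b - c).re - 1) := by
    rw [mul_div_assoc, pochWeight_div, pochWeight, mul_assoc, ← Real.rpow_add (by positivity)]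
    congr 2
    simp only [Complex.add_re, Complex.sub_re]
    ring
  have key : (Ca * pochWeight a.re n * (Cb * pochWeight b.re n) * (C1 * pochWeight p₁.re i) *
        (C2 * pochWeight p₂.re j)) / ((pochWeight c.re n / Cc) * (pochWeight q₁.re i / D1) *
        (pochWeight q₂.re j / D2) * i.factorial * j.factorial) =
      Ca * Cb * C1 * C2 * Cc * D1 * D2 * (n.choose i * (((n : ℝ) + 1) ^ ((a + b - c).re - 1) *
        (((i : ℝ) + 1) ^ (p₁ - q₁).re * ((j : ℝ) + 1) ^ (p₂ - q₂).re))) := by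
    rw [Complex.sub_re p₁, Complex.sub_re p₂, ← pochWeight_div p₁.re, ← pochWeight_div p₂.re, hch]
    have hE' : (n.factorial : ℝ) / (i.factorial * j.factorial) *
        (((n : ℝ) + 1) ^ ((a + b - c).re - 1) * (pochWeight p₁.re i / pochWeight q₁.re i *
          (pochWeight p₂.re j / pochWeight q₂.re j))) =
        (n.factorial * ((n : ℝ) + 1) ^ ((a + b - c).re - 1)) / (i.factorial * j.factorial) *
          (pochWeight p₁.re i / pochWeight q₁.re i * (pochWeight p₂.re j / pochWeight q₂.re j)) := by
      ring
    rw [hE', ← hE]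
    have w1 := (pochWeight_pos c.re n).ne'
    have w2 := (pochWeight_pos q₁.re i).ne'
    have w3 := (pochWeight_pos q₂.re j).ne'
    field_simp
  have hexp : ((n : ℝ) + 1) ^ ((a + b - c + p₁ - q₁ + p₂ - q₂).re - 1) =
      ((n : ℝ) + 1) ^ ((a + b - c).re - 1) *
        (((n : ℝ) + 1) ^ (p₁ - q₁).re * ((n : ℝ) + 1) ^ (p₂ - q₂).re) := by
    rw [← Real.rpow_add (by positivity), ← Real.rpow_add (by positivity)]
    congr 1
    simp only [Complex.add_re, Complex.sub_re]
    ring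
  have hfin := choose_mul_div_pow_le i j K
  rw [hnc, ← hn] at hfin
  rw [hnc, hexp]
  calc ‖coef211 a b p₁ p₂ c q₁ q₂ (i, j)‖
      ≤ Ca * Cb * C1 * C2 * Cc * D1 * D2 * (n.choose i * (((n : ℝ) + 1) ^ ((a + b - c).re - 1) *
        (((i : ℝ) + 1) ^ (p₁ - q₁).re * ((j : ℝ) + 1) ^ (p₂ - q₂).re))) := hW.trans key.le
    _ ≤ Ca * Cb * C1 * C2 * Cc * D1 * D2 * (n.choose i * (((n : ℝ) + 1) ^ ((a + b - c).re - 1) *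
        ((((n : ℝ) + 1) ^ (p₁ - q₁).re * (((n : ℝ) + 1) / (i + 1)) ^ K) *
          (((n : ℝ) + 1) ^ (p₂ - q₂).re * (((n : ℝ) + 1) / (j + 1)) ^ K)))) := by gcongr
    _ = Ca * Cb * C1 * C2 * Cc * D1 * D2 * (((n : ℝ) + 1) ^ ((a + b - c).re - 1) *
        (((n : ℝ) + 1) ^ (p₁ - q₁).re * ((n : ℝ) + 1) ^ (p₂ - q₂).re)) *
        (n.choose i * ((((n : ℝ) + 1) / (i + 1)) ^ K * (((n : ℝ) + 1) / (j + 1)) ^ K)) := by ring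
    _ ≤ Ca * Cb * C1 * C2 * Cc * D1 * D2 * (((n : ℝ) + 1) ^ ((a + b - c).re - 1) *
        (((n : ℝ) + 1) ^ (p₁ - q₁).re * ((n : ℝ) + 1) ^ (p₂ - q₂).re)) *
        (K.factorial ^ 2 * (n + 2 * K).choose (i + K)) := by gcongr
    _ = _ := by ring

variable {A : ℕ × ℕ → ℂ} {e : ℝ}

/-- The sum over `i + j = n` of the terms of a double series with dominated coefficients. -/
theorem CoefBound.exists_sum_antidiagonal_le (h : CoefBound e A) :
    ∃ (C : ℝ) (K : ℕ), 0 ≤ C ∧ ∀ x y : ℝ, 0 < x → 0 < y → ∀ n : ℕ,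
      ∑ k ∈ Finset.HasAntidiagonal.antidiagonal n, ‖A k‖ * x ^ k.1 * y ^ k.2 ≤
        C * ((n : ℝ) + 1) ^ e * ((x * y) ^ K)⁻¹ * (x + y) ^ (n + 2 * K) := by
  obtain ⟨C, K, hC, h⟩ := h
  refine ⟨C, K, hC, fun x y hx hy n => ?_⟩
  have hinj : Function.Injective fun k : ℕ × ℕ => (k.1 + K, k.2 + K) := by
    rintro ⟨i, j⟩ ⟨i', j'⟩ h
    simpa using h
  have h1 : ∑ k ∈ Finset.HasAntidiagonal.antidiagonal n,
      ((n + 2 * K).choose (k.1 + K) : ℝ) * x ^ (k.1 + K) * y ^ (k.2 + K) ≤ (x + y) ^ (n + 2 * K) := by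
    rw [(Commute.all x y).add_pow']
    have h2 : ∑ k ∈ Finset.HasAntidiagonal.antidiagonal n,
        ((n + 2 * K).choose (k.1 + K) : ℝ) * x ^ (k.1 + K) * y ^ (k.2 + K) =
        ∑ k ∈ (Finset.HasAntidiagonal.antidiagonal n).map ⟨_, hinj⟩,
          (n + 2 * K).choose k.1 • (x ^ k.1 * y ^ k.2) := by
      rw [Finset.sum_map]
      refine Finset.sum_congr rfl fun k _ => ?_
      simp [mul_assoc]
    rw [h2]
    refine Finset.sum_le_sum_of_subset_of_nonneg ?_ fun k _ _ => by positivity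
    intro k hk
    simp only [Finset.mem_map, Finset.HasAntidiagonal.mem_antidiagonal, Function.Embedding.coeFn_mk] at hk ⊢
    obtain ⟨l, hl, rfl⟩ := hk
    simp only
    omega
  calc ∑ k ∈ Finset.HasAntidiagonal.antidiagonal n, ‖A k‖ * x ^ k.1 * y ^ k.2
      ≤ ∑ k ∈ Finset.HasAntidiagonal.antidiagonal n, C * ((n : ℝ) + 1) ^ e * ((x * y) ^ K)⁻¹ *
        (((n + 2 * K).choose (k.1 + K) : ℝ) * x ^ (k.1 + K) * y ^ (k.2 + K)) := by
        refine Finset.sum_le_sum fun k hk => ?_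
        rw [Finset.HasAntidiagonal.mem_antidiagonal] at hk
        have h3 := h k.1 k.2
        have h4 : (k.1 : ℝ) + k.2 = n := by exact_mod_cast hk
        rw [h4, hk] at h3
        calc ‖A k‖ * x ^ k.1 * y ^ k.2 ≤ C * (((n : ℝ) + 1) ^ e * (n + 2 * K).choose (k.1 + K)) *
              x ^ k.1 * y ^ k.2 := by gcongr
          _ = _ := by
            rw [mul_pow, pow_add, pow_add]
            field_simp
    _ ≤ _ := by
      rw [← Finset.mul_sum]
      gcongr

theorem summable_of_summable_sum_antidiagonal {f : ℕ × ℕ → ℂ}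
    (h : Summable fun n => ∑ k ∈ Finset.HasAntidiagonal.antidiagonal n, ‖f k‖) : Summable f := by
  rw [← summable_norm_iff, ← Finset.HasAntidiagonal.sigmaAntidiagonalEquivProd.summable_iff]
  refine (summable_sigma_of_nonneg fun _ => norm_nonneg _).2 ⟨fun n => Summable.of_finite, h.congr fun n => ?_⟩
  rw [tsum_fintype, ← Finset.sum_coe_sort]
  rfl

/-- The homogeneous part of degree `n` of a double power series. -/
noncomputable def homPart (A : ℕ × ℕ → ℂ) (n : ℕ) (p : ℂ × ℂ) : ℂ :=
  ∑ k ∈ Finset.HasAntidiagonal.antidiagonal n, A k * p.1 ^ k.1 * p.2 ^ k.2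

theorem hasSum_homPart {p : ℂ × ℂ} (h : Summable fun k : ℕ × ℕ => A k * p.1 ^ k.1 * p.2 ^ k.2) :
    HasSum (fun n => homPart A n p) (dser A p) := by
  have h1 := Finset.HasAntidiagonal.sigmaAntidiagonalEquivProd.hasSum_iff.2 h.hasSum
  refine (h1.sigma fun n => hasSum_fintype _).congr_fun fun n => ?_
  rw [homPart, ← Finset.sum_coe_sort]
  rfl

theorem summable_succ_pow_mul_pow (M : ℕ) {r : ℝ} (h0 : 0 ≤ r) (h1 : r < 1) :
    Summable fun i : ℕ => ((i : ℝ) + 1) ^ M * r ^ i := by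
  obtain ⟨s, hrs, hs1⟩ := exists_between h1
  have hs : 0 < s := h0.trans_lt hrs
  have h : Summable fun n : ℕ => ((n + 1 : ℕ) : ℝ) ^ M * s ^ (n + 1) :=
    (summable_nat_add_iff (f := fun n : ℕ => (n : ℝ) ^ M * s ^ n) 1).2
      (summable_pow_mul_geometric_of_norm_lt_one M
        (by rw [Real.norm_eq_abs, abs_of_pos hs]; exact hs1))
  refine Summable.of_nonneg_of_le (fun n => by positivity) (fun n => ?_) (h.mul_left s⁻¹)
  calc ((n : ℝ) + 1) ^ M * r ^ n ≤ ((n : ℝ) + 1) ^ M * s ^ n := by gcongr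
    _ = s⁻¹ * (((n + 1 : ℕ) : ℝ) ^ M * s ^ (n + 1)) := by
      rw [pow_succ, Nat.cast_succ]
      field_simp

theorem CoefBound.summable (h : CoefBound e A) {p : ℂ × ℂ} {x y : ℝ} (hx : 0 < x) (hy : 0 < y)
    (hpx : ‖p.1‖ ≤ x) (hpy : ‖p.2‖ ≤ y) (hxy : x + y < 1 ∨ x + y ≤ 1 ∧ e < -1) :
    Summable fun k : ℕ × ℕ => A k * p.1 ^ k.1 * p.2 ^ k.2 := by
  obtain ⟨C, K, hC, h⟩ := h.exists_sum_antidiagonal_le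
  refine summable_of_summable_sum_antidiagonal ?_
  have hs : Summable fun n : ℕ => ((n : ℝ) + 1) ^ e * (x + y) ^ n := by
    rcases hxy with hxy | ⟨hxy, he⟩
    · obtain ⟨M, hM⟩ := exists_nat_ge e
      refine Summable.of_nonneg_of_le (fun n => by positivity) (fun n => ?_)
        (summable_succ_pow_mul_pow M (by positivity) hxy)
      have h2 : ((n : ℝ) + 1) ^ e ≤ ((n : ℝ) + 1) ^ M := by
        rw [← Real.rpow_natCast]
        exact Real.rpow_le_rpow_of_exponent_le (by linarith [n.cast_nonneg (α := ℝ)]) hM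
      gcongr
    · have h1 : Summable fun n : ℕ => ((n + 1 : ℕ) : ℝ) ^ e :=
        (summable_nat_add_iff (f := fun n : ℕ => (n : ℝ) ^ e) 1).2 (Real.summable_nat_rpow.2 he)
      refine Summable.of_nonneg_of_le (fun n => by positivity) (fun n => ?_) h1
      push_cast
      exact mul_le_of_le_one_right (by positivity) (pow_le_one₀ (by positivity) hxy)
  refine Summable.of_nonneg_of_le (fun n => by positivity) (fun n => ?_)
    (hs.mul_left (C * ((x * y) ^ K)⁻¹ * (x + y) ^ (2 * K)))
  refine (Finset.sum_le_sum fun k _ => ?_).trans ((h x y hx hy n).trans (le_of_eq ?_))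
  · simp only [norm_mul, norm_pow]
    gcongr
  · rw [pow_add]
    ring

theorem CoefBound.convOn (h : CoefBound e A) : ConvOn A dom211 := by
  intro p hp
  have hp' : ‖p.1‖ + ‖p.2‖ < 1 := hp
  refine h.summable (x := ‖p.1‖ + (1 - ‖p.1‖ - ‖p.2‖) / 4) (y := ‖p.2‖ + (1 - ‖p.1‖ - ‖p.2‖) / 4)
    ?_ ?_ ?_ ?_ (Or.inl ?_) <;> linarith [norm_nonneg p.1, norm_nonneg p.2]

theorem isOpen_dom211 : IsOpen dom211 :=
  isOpen_lt (continuous_fst.norm.add continuous_snd.norm) continuous_const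

theorem isOpen_dom122 : IsOpen dom122 :=
  (isOpen_lt continuous_fst.norm continuous_const).inter
    (isOpen_lt continuous_snd.norm continuous_const)

theorem bidiscCovered_dom211 : BidiscCovered dom211 := by
  intro p hp
  have hp' : ‖p.1‖ + ‖p.2‖ < 1 := hp
  have h1 := norm_nonneg p.1
  have h2 := norm_nonneg p.2
  refine ⟨‖p.1‖ + (1 - ‖p.1‖ - ‖p.2‖) / 4, ‖p.2‖ + (1 - ‖p.1‖ - ‖p.2‖) / 4, by linarith,
    by linarith, ?_⟩
  simp only [dom211, mem_ofPred_eq, Complex.norm_real, Real.norm_eq_abs]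
  rw [abs_of_pos (by linarith), abs_of_pos (by linarith)]
  linarith

theorem bidiscCovered_dom122 : BidiscCovered dom122 := by
  intro p hp
  have h1 := norm_nonneg p.1
  have h2 := norm_nonneg p.2
  refine ⟨(‖p.1‖ + 1) / 2, (‖p.2‖ + 1) / 2, by linarith [hp.1], by linarith [hp.2], ?_⟩
  simp only [dom122, mem_ofPred_eq, Complex.norm_real, Real.norm_eq_abs]
  rw [abs_of_pos (by linarith), abs_of_pos (by linarith)]
  exact ⟨by linarith [hp.1], by linarith [hp.2]⟩

end CoefBound

section Conv122

variable {a p₁ p₂ q₁ q₂ b c : ℂ}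

theorem convOn_coef122 (hb : LowerOK b) (hc : LowerOK c) :
    ConvOn (coef122 a p₁ p₂ q₁ q₂ b c) dom122 := by
  obtain ⟨Ca, ha0, ha⟩ := exists_norm_poch_le a
  obtain ⟨C1, h10, h1⟩ := exists_norm_poch_le p₁
  obtain ⟨C2, h20, h2⟩ := exists_norm_poch_le p₂
  obtain ⟨D1, k10, k1⟩ := exists_norm_poch_le q₁
  obtain ⟨D2, k20, k2⟩ := exists_norm_poch_le q₂
  obtain ⟨Cb, hb0, hb'⟩ := hb.exists_le_norm_poch
  obtain ⟨Cc, hc0, hc'⟩ := hc.exists_le_norm_poch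
  set e := (a - b - c).re + 1 with he
  obtain ⟨M, hM⟩ := exists_nat_ge (|e| + |(p₁ + q₁).re| + |(p₂ + q₂).re|)
  set C := Ca * C1 * C2 * D1 * D2 * Cb * Cc with hC
  have hC0 : 0 < C := by positivity
  have hpow : ∀ (i : ℕ) {t : ℝ}, t ≤ M → ((i : ℝ) + 1) ^ t ≤ ((i : ℝ) + 1) ^ M := fun i t ht => by
    rw [← Real.rpow_natCast]
    exact Real.rpow_le_rpow_of_exponent_le (by linarith [i.cast_nonneg (α := ℝ)]) ht
  have hbound : ∀ i j : ℕ, ‖coef122 a p₁ p₂ q₁ q₂ b c (i, j)‖ ≤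
      C * (((i : ℝ) + 1) ^ (2 * M) * ((j : ℝ) + 1) ^ (2 * M)) := by
    intro i j
    set n := i + j with hn
    have hW : ‖coef122 a p₁ p₂ q₁ q₂ b c (i, j)‖ ≤
        (Ca * pochWeight a.re n * (C1 * pochWeight p₁.re i) * (C2 * pochWeight p₂.re j) *
          (D1 * pochWeight q₁.re i) * (D2 * pochWeight q₂.re j)) /
          ((pochWeight b.re n / Cb) * (pochWeight c.re n / Cc) * i.factorial * j.factorial) := by
      have w1 := pochWeight_pos b.re n
      have w2 := pochWeight_pos c.re n
      have v1 : pochWeight b.re n / Cb ≤ ‖poch b n‖ := (div_le_iff₀' hb0).2 (hb' n)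
      have v2 : pochWeight c.re n / Cc ≤ ‖poch c n‖ := (div_le_iff₀' hc0).2 (hc' n)
      simp only [coef122, ← hn, norm_div, norm_mul, Complex.norm_natCast]
      have := ha n
      have := h1 i
      have := h2 j
      have := k1 i
      have := k2 j
      have := pochWeight_pos a.re n
      have := pochWeight_pos p₁.re i
      have := pochWeight_pos p₂.re j
      have := pochWeight_pos q₁.re i
      have := pochWeight_pos q₂.re j
      gcongr
    have hn1 : (0 : ℝ) < (n : ℝ) + 1 := by positivity
    have hi1 : (0 : ℝ) < (i : ℝ) + 1 := by positivity
    have hj1 : (0 : ℝ) < (j : ℝ) + 1 := by positivity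
    have hfac : (i.factorial : ℝ) * j.factorial ≤ n.factorial := by
      exact_mod_cast Nat.le_of_dvd (Nat.factorial_pos _) (Nat.factorial_mul_factorial_dvd_factorial_add i j)
    have hnij : (n : ℝ) + 1 ≤ ((i : ℝ) + 1) * ((j : ℝ) + 1) := by
      rw [hn]
      push_cast
      nlinarith [i.cast_nonneg (α := ℝ), j.cast_nonneg (α := ℝ),
        mul_nonneg (i.cast_nonneg (α := ℝ)) (j.cast_nonneg (α := ℝ))]
    have key : (Ca * pochWeight a.re n * (C1 * pochWeight p₁.re i) * (C2 * pochWeight p₂.re j) *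
          (D1 * pochWeight q₁.re i) * (D2 * pochWeight q₂.re j)) /
          ((pochWeight b.re n / Cb) * (pochWeight c.re n / Cc) * i.factorial * j.factorial) =
        C * (((i.factorial : ℝ) * j.factorial / n.factorial) * (((n : ℝ) + 1) ^ e *
          (((i : ℝ) + 1) ^ ((p₁ + q₁).re - 2) * ((j : ℝ) + 1) ^ ((p₂ + q₂).re - 2)))) := by
      have e1 : ((n : ℝ) + 1) ^ e * (((n : ℝ) + 1) ^ (b.re - 1) * ((n : ℝ) + 1) ^ (c.re - 1)) =
          ((n : ℝ) + 1) ^ (a.re - 1) := by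
        rw [← Real.rpow_add hn1, ← Real.rpow_add hn1, he]
        congr 1
        simp only [Complex.sub_re]
        ring
      have e2 : ((i : ℝ) + 1) ^ ((p₁ + q₁).re - 2) =
          ((i : ℝ) + 1) ^ (p₁.re - 1) * ((i : ℝ) + 1) ^ (q₁.re - 1) := by
        rw [← Real.rpow_add hi1]
        congr 1
        simp only [Complex.add_re]
        ring
      have e3 : ((j : ℝ) + 1) ^ ((p₂ + q₂).re - 2) =
          ((j : ℝ) + 1) ^ (p₂.re - 1) * ((j : ℝ) + 1) ^ (q₂.re - 1) := by
        rw [← Real.rpow_add hj1]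
        congr 1
        simp only [Complex.add_re]
        ring
      rw [e2, e3]
      simp only [pochWeight]
      rw [← e1]
      have r1 : ((n : ℝ) + 1) ^ (b.re - 1) ≠ 0 := by positivity
      have r2 : ((n : ℝ) + 1) ^ (c.re - 1) ≠ 0 := by positivity
      have r3 : (n.factorial : ℝ) ≠ 0 := by positivity
      have r4 : (i.factorial : ℝ) ≠ 0 := by positivity
      have r5 : (j.factorial : ℝ) ≠ 0 := by positivity
      rw [hC]
      generalize ((n : ℝ) + 1) ^ (b.re - 1) = x1 at *
      generalize ((n : ℝ) + 1) ^ (c.re - 1) = x2 at *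
      generalize ((n : ℝ) + 1) ^ e = x3 at *
      field_simp
    have m1 : (p₁ + q₁).re - 2 ≤ M := by
      linarith [le_abs_self (p₁ + q₁).re, abs_nonneg e, abs_nonneg (p₂ + q₂).re]
    have m2 : (p₂ + q₂).re - 2 ≤ M := by
      linarith [le_abs_self (p₂ + q₂).re, abs_nonneg e, abs_nonneg (p₁ + q₁).re]
    have m3 : e ≤ M := by
      linarith [le_abs_self e, abs_nonneg (p₂ + q₂).re, abs_nonneg (p₁ + q₁).re]
    refine hW.trans (key.le.trans ?_)
    calc C * (((i.factorial : ℝ) * j.factorial / n.factorial) * (((n : ℝ) + 1) ^ e *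
          (((i : ℝ) + 1) ^ ((p₁ + q₁).re - 2) * ((j : ℝ) + 1) ^ ((p₂ + q₂).re - 2))))
        ≤ C * (1 * ((((i : ℝ) + 1) * ((j : ℝ) + 1)) ^ M *
          (((i : ℝ) + 1) ^ M * ((j : ℝ) + 1) ^ M))) := by
          have g1 := (hpow n m3).trans (pow_le_pow_left₀ hn1.le hnij M)
          have g2 := hpow i m1
          have g3 := hpow j m2
          have g4 : (i.factorial : ℝ) * j.factorial / n.factorial ≤ 1 :=
            (div_le_one (by positivity)).2 hfac
          gcongr
      _ = _ := by rw [mul_pow]; ring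
  intro p hp
  rw [← summable_norm_iff]
  have hs := (summable_succ_pow_mul_pow (2 * M) (norm_nonneg p.1) hp.1).mul_of_nonneg
    (summable_succ_pow_mul_pow (2 * M) (norm_nonneg p.2) hp.2) (fun n => by positivity)
    (fun n => by positivity)
  refine Summable.of_nonneg_of_le (fun k => norm_nonneg _) (fun k => ?_) (hs.mul_left C)
  rw [norm_mul, norm_mul, norm_pow, norm_pow]
  calc _ ≤ C * (((k.1 : ℝ) + 1) ^ (2 * M) * ((k.2 : ℝ) + 1) ^ (2 * M)) * ‖p.1‖ ^ k.1 *
        ‖p.2‖ ^ k.2 := by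
        gcongr
        exact hbound k.1 k.2
    _ = _ := by ring

end Conv122

/-! ### Limits along a wedge -/

section Wedge

variable {G : ℂ × ℂ → ℂ} {W : Set (ℂ × ℂ)} {p : ℂ × ℂ}

theorem DifferentiableOn.iterate_dX (hW : IsOpen W) (hG : DifferentiableOn ℂ G W) (k : ℕ) :
    DifferentiableOn ℂ (_root_.dX^[k] G) W := by
  induction k with
  | zero => exact hG
  | succ k ih => rw [Function.iterate_succ_apply']; exact ih.dX hW

theorem iteratedDeriv_left (hW : IsOpen W) (hG : DifferentiableOn ℂ G W) (k : ℕ) (hp : p ∈ W) :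
    iteratedDeriv k (fun x => G (x, p.2)) p.1 = dX^[k] G p := by
  induction k generalizing p with
  | zero => simp
  | succ k ih =>
    have hev : ∀ᶠ x in 𝓝 p.1, (x, p.2) ∈ W :=
      (by fun_prop : Continuous fun x : ℂ => (x, p.2)).continuousAt.eventually (hW.mem_nhds hp)
    have h1 : iteratedDeriv k (fun x => G (x, p.2)) =ᶠ[𝓝 p.1] fun x => dX^[k] G (x, p.2) := by
      filter_upwards [hev] with x hx using ih (p := (x, p.2)) hx
    rw [iteratedDeriv_succ, h1.deriv_eq, Function.iterate_succ_apply',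
      (hasDerivAt_left ((hG.iterate_dX hW k).differentiableAt (hW.mem_nhds hp))).deriv]

/-- A Cauchy estimate for the partial derivatives in the first variable that only involves the
oscillation of the function. -/
theorem norm_iterate_dX_le (hW : IsOpen W) (hG : DifferentiableOn ℂ G W) {k : ℕ} (hk : k ≠ 0)
    {R δ : ℝ} (hR : 0 < R) (hsub : ∀ x ∈ Metric.closedBall p.1 R, (x, p.2) ∈ W) (L : ℂ)
    (hδ : ∀ x ∈ Metric.closedBall p.1 R, ‖G (x, p.2) - L‖ ≤ δ) :
    ‖dX^[k] G p‖ ≤ k.factorial * δ / R ^ k := by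
  obtain ⟨k, rfl⟩ := Nat.exists_eq_succ_of_ne_zero hk
  have hp : p ∈ W := hsub p.1 (Metric.mem_closedBall_self hR.le)
  have h1 : dX^[k + 1] G p = iteratedDeriv (k + 1) (fun x => G (x, p.2) - L) p.1 := by
    rw [← iteratedDeriv_left hW hG _ hp, iteratedDeriv_succ', iteratedDeriv_succ']
    congr 1
    ext x
    rw [deriv_sub_const]
  have hd : DifferentiableOn ℂ (fun x => G (x, p.2) - L) (Metric.closedBall p.1 R) :=
    (hG.comp (by fun_prop) hsub).sub_const L
  rw [Nat.succ_eq_add_one, h1]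
  exact Complex.norm_iteratedDeriv_le_of_forall_mem_sphere_norm_le (k + 1) hR
    (hd.diffContOnCl_ball subset_rfl) fun x hx => hδ x (Metric.sphere_subset_closedBall hx)

/-- The data of a wedge: `G` is holomorphic on an open set `W` that contains a half-disc (of
direction `ω` and radius `ε`) at every point of the curve `ζ ↦ (χ ζ, ζ)` over `B`, and it has the
boundary values `h` on this curve. -/
structure WedgeData (G : ℂ × ℂ → ℂ) (W : Set (ℂ × ℂ)) (χ : ℂ → ℂ) (B : Set ℂ) (ω : ℂ) (ε : ℝ)
    (h : ℂ → ℂ) : Prop where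
  isOpen : IsOpen W
  diff : DifferentiableOn ℂ G W
  isOpen_base : IsOpen B
  diff_curve : DifferentiableOn ℂ χ B
  ω_ne : ω ≠ 0
  ε_pos : 0 < ε
  mem : ∀ ζ ∈ B, ∀ s : ℂ, 0 < s.re → ‖s‖ < ε → (χ ζ + ω * s, ζ) ∈ W
  lim : ∀ ζ ∈ B, Tendsto G (𝓝[W] (χ ζ, ζ)) (𝓝 (h ζ))

variable {χ : ℂ → ℂ} {B : Set ℂ} {ω : ℂ} {ε : ℝ} {h : ℂ → ℂ}

theorem WedgeData.mem_of_pos (H : WedgeData G W χ B ω ε h) {ζ : ℂ} (hζ : ζ ∈ B) {t : ℝ} (ht : 0 < t)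
    (ht' : t < ε) : (χ ζ + ω * t, ζ) ∈ W :=
  H.mem ζ hζ t (by simpa using ht) (by simpa [abs_of_pos ht] using ht')

theorem WedgeData.mem_closure (H : WedgeData G W χ B ω ε h) {ζ : ℂ} (hζ : ζ ∈ B) :
    (χ ζ, ζ) ∈ closure W := by
  have h1 : Tendsto (fun t : ℝ => (χ ζ + ω * t, ζ)) (𝓝[>] 0) (𝓝 (χ ζ, ζ)) := by
    have : Continuous fun t : ℝ => (χ ζ + ω * t, ζ) := by fun_prop
    simpa using (this.tendsto 0).mono_left nhdsWithin_le_nhds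
  refine mem_closure_of_tendsto h1 ?_
  filter_upwards [Ioo_mem_nhdsGT H.ε_pos] with t ht using H.mem_of_pos hζ ht.1 ht.2

/-- The boundary values are attained locally uniformly. -/
theorem WedgeData.exists_norm_sub_le (H : WedgeData G W χ B ω ε h) {ζ₀ : ℂ} (hζ₀ : ζ₀ ∈ B) {δ : ℝ}
    (hδ : 0 < δ) : ∃ r > 0, ∃ η > 0, η ≤ ε ∧ ∀ ζ ∈ B, ‖ζ - ζ₀‖ < r → ∀ s : ℂ, 0 < s.re → ‖s‖ < η →
      ‖G (χ ζ + ω * s, ζ) - h ζ‖ ≤ δ := by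
  have h1 : ∀ᶠ p in 𝓝 (χ ζ₀, ζ₀), p ∈ W → dist (G p) (h ζ₀) < δ / 2 :=
    eventually_nhdsWithin_iff.1 ((H.lim ζ₀ hζ₀).eventually (Metric.ball_mem_nhds _ (half_pos hδ)))
  obtain ⟨ρ, hρ, h2⟩ := Metric.eventually_nhds_iff_ball.1 h1
  have hc : ContinuousAt χ ζ₀ :=
    (H.diff_curve.differentiableAt (H.isOpen_base.mem_nhds hζ₀)).continuousAt
  obtain ⟨r, hr, h3⟩ := Metric.continuousAt_iff.1 hc (ρ / 2) (half_pos hρ)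
  have hω : 0 < ‖ω‖ := norm_pos_iff.2 H.ω_ne
  have hball : ∀ ζ : ℂ, ‖ζ - ζ₀‖ < min r ρ → ∀ s : ℂ, ‖s‖ < min ε (ρ / (2 * ‖ω‖)) →
      (χ ζ + ω * s, ζ) ∈ Metric.ball (χ ζ₀, ζ₀) ρ := by
    intro ζ hζ s hs
    rw [mem_ball_iff_norm, Prod.norm_def, max_lt_iff]
    refine ⟨?_, hζ.trans_le (min_le_right _ _)⟩
    have a1 := h3 (by rw [dist_eq_norm]; exact hζ.trans_le (min_le_left _ _))
    rw [dist_eq_norm] at a1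
    have a2 : ‖ω * s‖ < ρ / 2 := by
      have := hs.trans_le (min_le_right _ _)
      rw [lt_div_iff₀ (by positivity)] at this
      rw [norm_mul]
      linarith
    calc ‖χ ζ + ω * s - χ ζ₀‖ = ‖(χ ζ - χ ζ₀) + ω * s‖ := by congr 1; ring
      _ ≤ ‖χ ζ - χ ζ₀‖ + ‖ω * s‖ := norm_add_le _ _
      _ < ρ := by linarith
  refine ⟨min r ρ, lt_min hr hρ, min ε (ρ / (2 * ‖ω‖)), lt_min H.ε_pos (by positivity),
    min_le_left _ _, fun ζ hζB hζ s hs0 hs => ?_⟩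
  have b1 := h2 _ (hball ζ hζ s hs) (H.mem ζ hζB s hs0 (hs.trans_le (min_le_left _ _)))
  have b2 : dist (h ζ) (h ζ₀) ≤ δ / 2 := by
    have : (𝓝[W] (χ ζ, ζ)).NeBot := mem_closure_iff_nhdsWithin_neBot.1 (H.mem_closure hζB)
    refine le_of_tendsto ((H.lim ζ hζB).dist tendsto_const_nhds) ?_
    have hmem : (χ ζ, ζ) ∈ Metric.ball (χ ζ₀, ζ₀) ρ := by
      simpa using hball ζ hζ 0 (by simpa using ⟨H.ε_pos, by positivity⟩)
    filter_upwards [self_mem_nhdsWithin,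
      mem_nhdsWithin_of_mem_nhds (Metric.isOpen_ball.mem_nhds hmem)] with p hp1 hp2
    exact (h2 p hp2 hp1).le
  rw [← dist_eq_norm]
  linarith [dist_triangle_right (G (χ ζ + ω * s, ζ)) (h ζ) (h ζ₀)]

/-- The derivative `t ^ k ∂ᵏG/∂xᵏ` at distance `t` from the curve. -/
noncomputable def wedgeFun (G : ℂ × ℂ → ℂ) (χ : ℂ → ℂ) (ω : ℂ) (k : ℕ) (t : ℝ) (ζ : ℂ) : ℂ :=
  (t : ℂ) ^ k * dX^[k] G (χ ζ + ω * t, ζ)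

/-- The Cauchy estimate on discs of radius proportional to the distance from the curve shows
that `t ^ k ∂ᵏG/∂xᵏ` tends to zero for `k > 0`. -/
theorem WedgeData.tendstoLocallyUniformlyOn (H : WedgeData G W χ B ω ε h) (k : ℕ) :
    TendstoLocallyUniformlyOn (wedgeFun G χ ω k) (if k = 0 then h else 0) (𝓝[>] 0) B := by
  rw [Metric.tendstoLocallyUniformlyOn_iff]
  intro δ hδ ζ₀ hζ₀
  have hω : 0 < ‖ω‖ := norm_pos_iff.2 H.ω_ne
  obtain ⟨r, hr, η, hη, hηε, h1⟩ := H.exists_norm_sub_le hζ₀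
    (δ := δ * (‖ω‖ / 2) ^ k / (2 * k.factorial)) (by positivity)
  refine ⟨B ∩ Metric.ball ζ₀ r, inter_mem_nhdsWithin _ (Metric.ball_mem_nhds _ hr), ?_⟩
  filter_upwards [Ioo_mem_nhdsGT (show (0 : ℝ) < η / 2 by positivity)] with t ht ζ hζ
  have hζr : ‖ζ - ζ₀‖ < r := by simpa [dist_eq_norm] using hζ.2
  rcases Nat.eq_zero_or_pos k with rfl | hk
  · have := h1 ζ hζ.1 hζr t (by simpa using ht.1) (by
      simp only [Complex.norm_real, Real.norm_eq_abs, abs_of_pos ht.1]; linarith [ht.2])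
    simp only [pow_zero, mul_one, Nat.factorial_zero, Nat.cast_one] at this
    rw [dist_comm, dist_eq_norm]
    simp only [wedgeFun, if_true, pow_zero, one_mul, Function.iterate_zero, id]
    linarith
  · -- The disc of radius `|ω| t / 2` around the point lies in the half-disc.
    have hs : ∀ x ∈ Metric.closedBall (χ ζ + ω * t) (‖ω‖ * t / 2), ∃ s : ℂ, x = χ ζ + ω * s ∧
        0 < s.re ∧ ‖s‖ < η := by
      intro x hx
      rw [mem_closedBall_iff_norm] at hx
      refine ⟨t + (x - (χ ζ + ω * t)) / ω, by field_simp [H.ω_ne]; ring, ?_⟩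
      have h2 : ‖(x - (χ ζ + ω * t)) / ω‖ ≤ t / 2 := by
        rw [norm_div, div_le_iff₀ hω]
        linarith
      have h3 := (Complex.abs_re_le_norm _).trans h2
      rw [abs_le] at h3
      refine ⟨by rw [Complex.add_re, Complex.ofReal_re]; linarith [ht.1], ?_⟩
      refine (norm_add_le _ _).trans_lt ?_
      rw [Complex.norm_real, Real.norm_eq_abs, abs_of_pos ht.1]
      linarith [ht.2, ht.1]
    have h2 := norm_iterate_dX_le (p := (χ ζ + ω * t, ζ)) H.isOpen H.diff hk.ne'
      (R := ‖ω‖ * t / 2) (by have := ht.1; positivity) (fun x hx => by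
        obtain ⟨s, rfl, hs0, hs1⟩ := hs x hx
        exact H.mem ζ hζ.1 s hs0 (hs1.trans_le hηε)) (h ζ) (fun x hx => by
        obtain ⟨s, rfl, hs0, hs1⟩ := hs x hx
        exact h1 ζ hζ.1 hζr s hs0 hs1)
    rw [if_neg hk.ne', dist_comm, dist_eq_norm, wedgeFun, Pi.zero_apply, sub_zero, norm_mul, norm_pow,
      Complex.norm_real, Real.norm_eq_abs, abs_of_pos ht.1]
    have ht0 := ht.1
    calc t ^ k * ‖dX^[k] G (χ ζ + ω * t, ζ)‖
        ≤ t ^ k * (k.factorial * (δ * (‖ω‖ / 2) ^ k / (2 * k.factorial)) / (‖ω‖ * t / 2) ^ k) := by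
          gcongr
      _ = δ / 2 := by
          rw [show ‖ω‖ * t / 2 = ‖ω‖ / 2 * t by ring, mul_pow]
          field_simp
      _ < δ := by linarith

theorem WedgeData.differentiableOn_wedgeFun (H : WedgeData G W χ B ω ε h) (k : ℕ) :
    ∀ᶠ t in 𝓝[>] 0, DifferentiableOn ℂ (wedgeFun G χ ω k t) B := by
  filter_upwards [Ioo_mem_nhdsGT H.ε_pos] with t ht
  refine DifferentiableOn.const_mul ?_ _
  exact (H.diff.iterate_dX H.isOpen k).comp ((H.diff_curve.add_const _).prodMk differentiableOn_id)
    fun ζ hζ => H.mem_of_pos hζ ht.1 ht.2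

theorem DifferentiableOn.iterate_deriv {f : ℂ → ℂ} (hB : IsOpen B) (hf : DifferentiableOn ℂ f B)
    (m : ℕ) : DifferentiableOn ℂ (_root_.deriv^[m] f) B := by
  induction m with
  | zero => exact hf
  | succ m ih => rw [Function.iterate_succ_apply']; exact ih.deriv hB

theorem TendstoLocallyUniformlyOn.iterate_deriv {ι : Type*} {l : Filter ι} {f : ι → ℂ → ℂ}
    {g : ℂ → ℂ} (hB : IsOpen B) (hfg : TendstoLocallyUniformlyOn f g l B)
    (hf : ∀ᶠ i in l, DifferentiableOn ℂ (f i) B) (m : ℕ) :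
    TendstoLocallyUniformlyOn (fun i => _root_.deriv^[m] (f i)) (_root_.deriv^[m] g) l B := by
  induction m with
  | zero => exact hfg
  | succ m ih =>
    simp only [Function.iterate_succ_apply']
    exact ih.deriv (hf.mono fun i hi => hi.iterate_deriv hB m) hB

theorem WedgeData.differentiableOn_boundary (H : WedgeData G W χ B ω ε h) :
    DifferentiableOn ℂ h B := by
  simpa using (H.tendstoLocallyUniformlyOn 0).differentiableOn (H.differentiableOn_wedgeFun 0)
    H.isOpen_base

/-- The tangential derivatives on the parallel curves converge to the derivatives of the boundary values. -/
theorem WedgeData.tendsto_iterate_deriv (H : WedgeData G W χ B ω ε h) (m : ℕ) {ζ : ℂ}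
    (hζ : ζ ∈ B) :
    Tendsto (fun t : ℝ => deriv^[m] (fun ζ => G (χ ζ + ω * t, ζ)) ζ) (𝓝[>] 0)
      (𝓝 (deriv^[m] h ζ)) := by
  have := ((H.tendstoLocallyUniformlyOn 0).iterate_deriv H.isOpen_base
    (H.differentiableOn_wedgeFun 0) m).tendsto_at hζ
  have e : (fun t : ℝ => fun ζ => G (χ ζ + ω * t, ζ)) = wedgeFun G χ ω 0 := by
    ext t ζ
    simp [wedgeFun]
  rw [if_pos rfl, ← e] at this
  exact this

theorem iterate_deriv_const_mul (a : ℂ) (f : ℂ → ℂ) (m : ℕ) :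
    deriv^[m] (fun ζ => a * f ζ) = fun ζ => a * deriv^[m] f ζ := by
  induction m generalizing f with
  | zero => rfl
  | succ m ih =>
    rw [Function.iterate_succ_apply, Function.iterate_succ_apply, ← ih]
    congr 1
    ext ζ
    exact deriv_const_mul_field a

/-- The `k`-th transversal derivative is `o(t⁻ᵏ)` at distance `t` from the curve, and so are its
tangential derivatives. -/
theorem WedgeData.tendsto_pow_mul_iterate_deriv (H : WedgeData G W χ B ω ε h) {k : ℕ} (hk : k ≠ 0)
    (m : ℕ) {ζ : ℂ} (hζ : ζ ∈ B) :
    Tendsto (fun t : ℝ => (t : ℂ) ^ k * deriv^[m] (fun ζ => dX^[k] G (χ ζ + ω * t, ζ)) ζ) (𝓝[>] 0)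
      (𝓝 0) := by
  have := ((H.tendstoLocallyUniformlyOn k).iterate_deriv H.isOpen_base
    (H.differentiableOn_wedgeFun k) m).tendsto_at hζ
  have h0 : deriv^[m] (0 : ℂ → ℂ) = 0 := by
    have := iterate_deriv_const_mul 0 0 m
    simpa using! this
  rw [if_neg hk, h0] at this
  refine this.congr fun t => ?_
  have e : wedgeFun G χ ω k t = fun ζ => (t : ℂ) ^ k * dX^[k] G (χ ζ + ω * t, ζ) := rfl
  rw [e, iterate_deriv_const_mul]

end Wedge

/-! ### Derivatives along translates of a curve -/

section Tangent

/-- The derivative of `ζ ↦ H (χ ζ + s, ζ)` in terms of `c = χ'`. -/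
noncomputable def tan₁ (c : ℂ) (H : ℂ × ℂ → ℂ) (p : ℂ × ℂ) : ℂ := dY H p + c * dX H p

/-- The second derivative of `ζ ↦ H (χ ζ + s, ζ)` in terms of `c = χ'` and `c' = χ''`. -/
noncomputable def tan₂ (c c' : ℂ) (H : ℂ × ℂ → ℂ) (p : ℂ × ℂ) : ℂ :=
  dY (dY H) p + 2 * c * dX (dY H) p + c ^ 2 * dX (dX H) p + c' * dX H p

/-- The third derivative of `ζ ↦ H (χ ζ + s, ζ)` in terms of `c = χ'`, `c' = χ''` and
`c'' = χ'''`. -/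
noncomputable def tan₃ (c c' c'' : ℂ) (H : ℂ × ℂ → ℂ) (p : ℂ × ℂ) : ℂ :=
  dY (dY (dY H)) p + 3 * c * dX (dY (dY H)) p + 3 * c ^ 2 * dX (dX (dY H)) p +
    c ^ 3 * dX (dX (dX H)) p + 3 * c' * (dX (dY H) p + c * dX (dX H) p) + c'' * dX H p

variable {H : ℂ × ℂ → ℂ} {W : Set (ℂ × ℂ)} {B : Set ℂ} {χ c c' c'' : ℂ → ℂ} {s : ℂ}

theorem hasDerivAt_along_curve (hW : IsOpen W) (hH : DifferentiableOn ℂ H W) {ζ d : ℂ}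
    (hχ : HasDerivAt χ d ζ) (hp : (χ ζ + s, ζ) ∈ W) :
    HasDerivAt (fun ζ => H (χ ζ + s, ζ)) (tan₁ d H (χ ζ + s, ζ)) ζ := by
  have := hasDerivAt_comp_curve (hH.differentiableAt (hW.mem_nhds hp)) (hχ.add_const s)
    (hasDerivAt_id ζ) rfl
  exact this.congr_deriv (by rw [tan₁]; ring)

theorem hasDerivAt_tan₁ (hW : IsOpen W) (hH : DifferentiableOn ℂ H W) {ζ : ℂ}
    (hχ : HasDerivAt χ (c ζ) ζ) (hc : HasDerivAt c (c' ζ) ζ) (hp : (χ ζ + s, ζ) ∈ W) :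
    HasDerivAt (fun ζ => tan₁ (c ζ) H (χ ζ + s, ζ)) (tan₂ (c ζ) (c' ζ) H (χ ζ + s, ζ)) ζ := by
  have h1 := hasDerivAt_along_curve hW (hH.dY hW) hχ hp
  have h2 := hasDerivAt_along_curve hW (hH.dX hW) hχ hp
  refine (h1.add (hc.mul h2)).congr_deriv ?_
  simp only [tan₁, tan₂]
  rw [← dX_dY_comm hW hH hp]
  ring

theorem hasDerivAt_tan₂ (hW : IsOpen W) (hH : DifferentiableOn ℂ H W) {ζ : ℂ}
    (hχ : HasDerivAt χ (c ζ) ζ) (hc : HasDerivAt c (c' ζ) ζ) (hc' : HasDerivAt c' (c'' ζ) ζ)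
    (hp : (χ ζ + s, ζ) ∈ W) :
    HasDerivAt (fun ζ => tan₂ (c ζ) (c' ζ) H (χ ζ + s, ζ))
      (tan₃ (c ζ) (c' ζ) (c'' ζ) H (χ ζ + s, ζ)) ζ := by
  have hX := hH.dX hW
  have hY := hH.dY hW
  have h1 := hasDerivAt_along_curve hW (hY.dY hW) hχ hp
  have h2 := hasDerivAt_along_curve hW (hY.dX hW) hχ hp
  have h3 := hasDerivAt_along_curve hW (hX.dX hW) hχ hp
  have h4 := hasDerivAt_along_curve hW hX hχ hp
  refine (((h1.add ((hc.const_mul 2).mul h2)).add ((hc.pow 2).mul h3)).add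
    (hc'.mul h4)).congr_deriv ?_
  simp only [tan₁, tan₃]
  have e1 : dY (dX H) (χ ζ + s, ζ) = dX (dY H) (χ ζ + s, ζ) := (dX_dY_comm hW hH hp).symm
  have e2 : dY (dX (dY H)) (χ ζ + s, ζ) = dX (dY (dY H)) (χ ζ + s, ζ) :=
    (dX_dY_comm hW hY hp).symm
  have e3 : dY (dX (dX H)) (χ ζ + s, ζ) = dX (dX (dY H)) (χ ζ + s, ζ) := by
    have : EqOn (dY (dX H)) (dX (dY H)) W := fun q hq => (dX_dY_comm hW hH hq).symm
    rw [← dX_dY_comm hW hX hp]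
    exact this.dX hW hp
  rw [e1, e2, e3]
  simp only [Pi.pow_apply]
  push_cast
  ring

theorem iterate_deriv_one_along_curve (hW : IsOpen W) (hH : DifferentiableOn ℂ H W)
    (hp : ∀ ζ ∈ B, (χ ζ + s, ζ) ∈ W) (hχ : ∀ ζ ∈ B, HasDerivAt χ (c ζ) ζ) {ζ : ℂ} (hζ : ζ ∈ B) :
    deriv^[1] (fun ζ => H (χ ζ + s, ζ)) ζ = tan₁ (c ζ) H (χ ζ + s, ζ) :=
  (hasDerivAt_along_curve hW hH (hχ ζ hζ) (hp ζ hζ)).deriv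

theorem iterate_deriv_two_along_curve (hW : IsOpen W) (hH : DifferentiableOn ℂ H W) (hB : IsOpen B)
    (hp : ∀ ζ ∈ B, (χ ζ + s, ζ) ∈ W) (hχ : ∀ ζ ∈ B, HasDerivAt χ (c ζ) ζ)
    (hc : ∀ ζ ∈ B, HasDerivAt c (c' ζ) ζ) {ζ : ℂ} (hζ : ζ ∈ B) :
    deriv^[2] (fun ζ => H (χ ζ + s, ζ)) ζ = tan₂ (c ζ) (c' ζ) H (χ ζ + s, ζ) := by
  have : deriv^[1] (fun ζ => H (χ ζ + s, ζ)) =ᶠ[𝓝 ζ] fun ζ => tan₁ (c ζ) H (χ ζ + s, ζ) := by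
    filter_upwards [hB.mem_nhds hζ] with ξ hξ using iterate_deriv_one_along_curve hW hH hp hχ hξ
  rw [Function.iterate_succ_apply', this.deriv_eq]
  exact (hasDerivAt_tan₁ hW hH (hχ ζ hζ) (hc ζ hζ) (hp ζ hζ)).deriv

theorem iterate_deriv_three_along_curve (hW : IsOpen W) (hH : DifferentiableOn ℂ H W)
    (hB : IsOpen B) (hp : ∀ ζ ∈ B, (χ ζ + s, ζ) ∈ W) (hχ : ∀ ζ ∈ B, HasDerivAt χ (c ζ) ζ)
    (hc : ∀ ζ ∈ B, HasDerivAt c (c' ζ) ζ) (hc' : ∀ ζ ∈ B, HasDerivAt c' (c'' ζ) ζ) {ζ : ℂ}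
    (hζ : ζ ∈ B) : deriv^[3] (fun ζ => H (χ ζ + s, ζ)) ζ =
      tan₃ (c ζ) (c' ζ) (c'' ζ) H (χ ζ + s, ζ) := by
  have : deriv^[2] (fun ζ => H (χ ζ + s, ζ)) =ᶠ[𝓝 ζ]
      fun ζ => tan₂ (c ζ) (c' ζ) H (χ ζ + s, ζ) := by
    filter_upwards [hB.mem_nhds hζ] with ξ hξ using
      iterate_deriv_two_along_curve hW hH hB hp hχ hc hξ
  rw [Function.iterate_succ_apply', this.deriv_eq]
  exact (hasDerivAt_tan₂ hW hH (hχ ζ hζ) (hc ζ hζ) (hc' ζ hζ) (hp ζ hζ)).deriv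

end Tangent

/-! ### The equation along the curve -/

section Algebra

variable {G : ℂ × ℂ → ℂ} {W : Set (ℂ × ℂ)} {p : ℂ × ℂ}

theorem tan₁_dX (hW : IsOpen W) (hG : DifferentiableOn ℂ G W) (hp : p ∈ W) (c : ℂ) :
    tan₁ c (dX G) p = dX (dY G) p + c * dX (dX G) p := by
  rw [tan₁, dX_dY_comm hW hG hp]

theorem tan₂_dX (hW : IsOpen W) (hG : DifferentiableOn ℂ G W) (hp : p ∈ W) (c c' : ℂ) :
    tan₂ c c' (dX G) p = dX (dY (dY G)) p + 2 * c * dX (dX (dY G)) p + c ^ 2 * dX (dX (dX G)) p +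
      c' * dX (dX G) p := by
  have h : EqOn (dY (dX G)) (dX (dY G)) W := fun q hq => (dX_dY_comm hW hG hq).symm
  rw [tan₂, h.dY hW hp, h.dX hW hp, dX_dY_comm hW (hG.dY hW) hp]

theorem tan₁_dX_dX (hW : IsOpen W) (hG : DifferentiableOn ℂ G W) (hp : p ∈ W) (c : ℂ) :
    tan₁ c (dX (dX G)) p = dX (dX (dY G)) p + c * dX (dX (dX G)) p := by
  have h : EqOn (dY (dX G)) (dX (dY G)) W := fun q hq => (dX_dY_comm hW hG hq).symm
  rw [tan₁_dX hW (hG.dX hW) hp, h.dX hW hp]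

/-- The combination `x² L₂ - y² L₁ - (x + y) (2 - x - y) C` of the three equations `L₁`, `L₂`, `C` of
`Sys211`, in terms of the tangential derivative `∂/∂y - ∂/∂x` along the lines parallel to `x + y = 1`
and the transversal derivative `∂/∂x`. Every term with a transversal derivative has the factor
`x + y - 1`; this is where the relations between the parameters are used. -/
theorem Sys211.tangential {α β p₁ p₂ : ℂ} (hW : IsOpen W) (hG : DifferentiableOn ℂ G W)
    (hp : p ∈ W) (h : Sys211 α β p₁ p₂ ((α + β + 1) / 2) (2 * p₁) (2 * p₂) G p) :
    α * β * (p.1 * p.2 ^ 2 * p₁ - p.1 ^ 2 * p.2 * p₂) * G p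
    + (p.1 ^ 2 * ((α + β + 1) * p₂ * p.2 - p.2 ^ 2 * ((α + 1) * (β + 1) * (p₂ + 1) - α * β * p₂))
        + p.1 * p.2 ^ 3 * ((1 + α) * (1 + β) * p₁ - α * β * p₁)
        - 2 * (p.1 + p.2) * (2 - p.1 - p.2) * p.1 * p.2 * p₁ * p₂) * tan₁ (-1) G p
    + p.2 ^ 2 * (p.1 ^ 2 * ((α + β + 1) / 2 + 2 * p₂ + 1 - p.2 * (α + β + p₂ + 3))
        + p.1 * p.2 ^ 2 * p₁ - (p.1 + p.2) * (2 - p.1 - p.2) * p.1 * p₁) * tan₂ (-1) 0 G p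
    + p.1 ^ 2 * p.2 ^ 3 * (1 - p.2) * tan₃ (-1) 0 0 G p
    + (p.1 + p.2 - 1) * ((α + β + 1) * (p.1 * p.2 ^ 2 * p₁ - p.1 ^ 2 * p.2 * p₂) * dX G p
      + (2 * p₁ * p.1 * p.2 ^ 3 + 2 * p₂ * p.1 ^ 3 * p.2 - (α + β + 3) * p.1 ^ 2 * p.2 ^ 2)
        * tan₁ (-1) (dX G) p
      + p.1 ^ 2 * p.2 ^ 2 * (p.1 - p.2) * tan₂ (-1) 0 (dX G) p) = 0 := by
  obtain ⟨h1, h2, h3⟩ := h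
  simp only [eul_eul_eul_apply _ _ _ _ _ _ _ _ _ hW hG hp] at h1 h2 h3
  rw [tan₂_dX hW hG hp, tan₁_dX hW hG hp, tan₁, tan₂, tan₃]
  linear_combination p.1 ^ 2 * h2 - p.2 ^ 2 * h1 - (p.1 + p.2) * (2 - p.1 - p.2) * h3

/-- The combination `x y (y L₂ - x L₁) - (x + y) (2 x y - x - y) C` of the three equations `L₁`, `L₂`,
`C` of `Sys122`, in terms of the derivatives along the translates of the curve `x = k`,
`k = y / (y - 1)`, and the transversal derivative `∂/∂x`. Here `w = 1 / (y - 1)`, and `-w ^ 2`,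
`2 * w ^ 3`, `-6 * w ^ 4` are the derivatives of `k` with respect to `y`. A term with `m` transversal
derivatives has the factor `(x - k) ^ m`; this is where the relations between the parameters are used. -/
theorem Sys122.tangential {p₁ p₂ b : ℂ} (hW : IsOpen W) (hG : DifferentiableOn ℂ G W)
    {x y k w : ℂ} (hp : (x, y) ∈ W) (hw : w * (y - 1) = 1) (hk : k = y * w)
    (h : Sys122 (1 / 2) p₁ p₂ (1 - p₁) (1 - p₂) b (2 - b) G (x, y)) :
    x * y / 2 * (x ^ 2 * (p₁ * (1 - p₁)) - y ^ 2 * (p₂ * (1 - p₂))) * G (x, y)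
    + (x * y * (y * (y * b * (2 - b) - y ^ 2 * (3 / 2 * (1 + p₂) * (2 - p₂) - p₂ * (1 - p₂) / 2))
        + x ^ 2 * y * p₁ * (1 - p₁)) - (x + y) * (2 * x * y - x - y) * x * y * p₁ * (1 - p₁))
        * tan₁ (-w ^ 2) G (x, y)
    + x * y ^ 4 * (3 - 9 / 2 * y) * tan₂ (-w ^ 2) (2 * w ^ 3) G (x, y)
    + x * y ^ 5 * (1 - y) * tan₃ (-w ^ 2) (2 * w ^ 3) (-6 * w ^ 4) G (x, y)
    + (x - k) * (
      (y - 1) ^ 2 * y * x * (3 * k ^ 4 + 3 * k ^ 3 * x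
        + k ^ 3 * (-(p₁ * (1 - p₁)) + p₂ * (1 - p₂) - b * (2 - b) - 6)
        + k ^ 2 * x ^ 2 * (p₁ * (1 - p₁) + 3)
        + k ^ 2 * x * (p₁ * (1 - p₁) + p₂ * (1 - p₂) - b * (2 - b) - 6)
        + k ^ 2 * (2 * (p₁ * (1 - p₁)) - p₂ * (1 - p₂) + 2 * (b * (2 - b)) + 3)
        + k * x ^ 2 * (-2 * (p₁ * (1 - p₁)) - 6)
        + k * x * (-2 * (p₁ * (1 - p₁)) + 2 * (b * (2 - b)) + 3)
        + k * (-(p₁ * (1 - p₁)) + p₂ * (1 - p₂) - b * (2 - b)) + x ^ 2 * (p₁ * (1 - p₁) + 3)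
        + x * (p₁ * (1 - p₁) - p₂ * (1 - p₂) - b * (2 - b))) * dX G (x, y)
      + (y - 1) ^ 3 * y * x * (-3 * k ^ 4 - 3 * k ^ 3 * x + 9 * k ^ 3 - 2 * k ^ 2 * x ^ 2
        + 6 * k ^ 2 * x - 4 * k ^ 2 + 4 * k * x ^ 2 - 3 * k * x - 2 * x ^ 2)
        * tan₁ (-w ^ 2) (dX G) (x, y)
      + y ^ 3 * (y - 1) ^ 2 * x * (3 * k ^ 2 + 2 * k * x - 2 * k - 2 * x)
        * tan₂ (-w ^ 2) (2 * w ^ 3) (dX G) (x, y))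
    + (x - k) ^ 2 * (
      y * x * (9 / 2 * k ^ 2 + 7 * k * x - k + 9 / 2 * x ^ 2 - x) * dX (dX G) (x, y)
      + y * (y - 1) ^ 2 * x * (-3 * k ^ 3 - 4 * k ^ 2 * x + k ^ 2 - k * x ^ 2 + 2 * k * x + x ^ 2)
        * tan₁ (-w ^ 2) (dX (dX G)) (x, y))
    + (x - k) ^ 3 * (y * x * (x + k) ^ 2 * dX (dX (dX G)) (x, y)) = 0 := by
  obtain ⟨h1, h2, h3⟩ := h
  simp only [eul_eul_eul_apply _ _ _ _ _ _ _ _ _ hW hG hp] at h1 h2 h3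
  rw [tan₂_dX hW hG hp, tan₁_dX_dX hW hG hp, tan₁_dX hW hG hp, tan₁, tan₂, tan₃]
  have hy : y = 1 + w⁻¹ := by
    have : w ≠ 0 := left_ne_zero_of_mul_eq_one hw
    field_simp
    linear_combination hw
  have hw0 : w ≠ 0 := left_ne_zero_of_mul_eq_one hw
  have key := congr($h2 * (x * y ^ 2) - $h1 * (x ^ 2 * y) -
    $h3 * ((x + y) * (2 * x * y - x - y)))
  simp only [zero_mul, sub_zero] at key
  rw [← key]
  clear h1 h2 h3 key
  generalize dX (dX (dX G)) (x, y) = g1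
  generalize dX (dX (dY G)) (x, y) = g2
  generalize dX (dY (dY G)) (x, y) = g3
  generalize dY (dY (dY G)) (x, y) = g4
  generalize dX (dX G) (x, y) = g5
  generalize dX (dY G) (x, y) = g6
  generalize dY (dY G) (x, y) = g7
  generalize dX G (x, y) = g8
  generalize dY G (x, y) = g9
  generalize G (x, y) = g0
  rw [hk]
  clear hW hG hp hw hk
  subst hy
  field_simp
  ring

end Algebra

/-! ### The equation satisfied by the boundary values -/

theorem hasDerivAt_inv_sub_one {z : ℂ} (hz : z ≠ 1) :
    HasDerivAt (fun z : ℂ => (z - 1)⁻¹) (-(z - 1)⁻¹ ^ 2) z := by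
  refine (((hasDerivAt_id z).sub_const 1).inv (sub_ne_zero.2 hz)).congr_deriv ?_
  simp [neg_div, inv_pow]

section Limit

variable {G : ℂ × ℂ → ℂ} {W : Set (ℂ × ℂ)}

/-- The third order equation on the line `x + y = 1`, for the tangential derivatives
`f₀, f₁, f₂, f₃` (with respect to `y`) of a solution of the equations of `F^{2:1;1}_{1:1;1}`. -/
def LineEq211 (α β p₁ p₂ y f₀ f₁ f₂ f₃ : ℂ) : Prop :=
  α * β * ((1 - y) * y ^ 2 * p₁ - (1 - y) ^ 2 * y * p₂) * f₀
    + ((1 - y) ^ 2 * ((α + β + 1) * p₂ * y - y ^ 2 * ((α + 1) * (β + 1) * (p₂ + 1) - α * β * p₂))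
        + (1 - y) * y ^ 3 * ((1 + α) * (1 + β) * p₁ - α * β * p₁)
        - 2 * (1 - y) * y * p₁ * p₂) * f₁
    + y ^ 2 * ((1 - y) ^ 2 * ((α + β + 1) / 2 + 2 * p₂ + 1 - y * (α + β + p₂ + 3))
        + (1 - y) * y ^ 2 * p₁ - (1 - y) * p₁) * f₂
    + (1 - y) ^ 3 * y ^ 3 * f₃ = 0

/-- The third order equation on the curve `x = y / (y - 1)`, for the tangential derivatives
`f₀, f₁, f₂, f₃` (with respect to `y`) of a solution of the equations of `F^{1:2;2}_{2:0;0}`. -/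
def CurveEq122 (p₁ p₂ b x y f₀ f₁ f₂ f₃ : ℂ) : Prop :=
  x * y / 2 * (x ^ 2 * (p₁ * (1 - p₁)) - y ^ 2 * (p₂ * (1 - p₂))) * f₀
    + (x * y * (y * (y * b * (2 - b) - y ^ 2 * (3 / 2 * (1 + p₂) * (2 - p₂) - p₂ * (1 - p₂) / 2))
        + x ^ 2 * y * p₁ * (1 - p₁)) - (x + y) * (2 * x * y - x - y) * x * y * p₁ * (1 - p₁)) * f₁
    + x * y ^ 4 * (3 - 9 / 2 * y) * f₂
    + x * y ^ 5 * (1 - y) * f₃ = 0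

/-- The limit of `Sys211.tangential` at a point of the line. -/
theorem lineEq211_of_tendsto {α β p₁ p₂ y f₀ f₁ f₂ f₃ : ℂ} {ι : Type*} {l : Filter ι} [l.NeBot]
    {p : ι → ℂ × ℂ} (hW : IsOpen W) (hG : DifferentiableOn ℂ G W) (hpW : ∀ᶠ i in l, p i ∈ W)
    (h : ∀ q ∈ W, Sys211 α β p₁ p₂ ((α + β + 1) / 2) (2 * p₁) (2 * p₂) G q)
    (hp : Tendsto p l (𝓝 (1 - y, y))) (h₀ : Tendsto (fun i => G (p i)) l (𝓝 f₀))
    (h₁ : Tendsto (fun i => tan₁ (-1) G (p i)) l (𝓝 f₁))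
    (h₂ : Tendsto (fun i => tan₂ (-1) 0 G (p i)) l (𝓝 f₂))
    (h₃ : Tendsto (fun i => tan₃ (-1) 0 0 G (p i)) l (𝓝 f₃))
    (h₀₁ : Tendsto (fun i => ((p i).1 + (p i).2 - 1) * dX G (p i)) l (𝓝 0))
    (h₁₁ : Tendsto (fun i => ((p i).1 + (p i).2 - 1) * tan₁ (-1) (dX G) (p i)) l (𝓝 0))
    (h₂₁ : Tendsto (fun i => ((p i).1 + (p i).2 - 1) * tan₂ (-1) 0 (dX G) (p i)) l (𝓝 0)) :
    LineEq211 α β p₁ p₂ y f₀ f₁ f₂ f₃ := by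
  have poly : ∀ φ : ℂ × ℂ → ℂ, Continuous φ → Tendsto (fun i => φ (p i)) l (𝓝 (φ (1 - y, y))) :=
    fun φ hφ => (hφ.tendsto _).comp hp
  have c₀ := poly (fun q => α * β * (q.1 * q.2 ^ 2 * p₁ - q.1 ^ 2 * q.2 * p₂)) (by fun_prop)
  have c₁ := poly (fun q => q.1 ^ 2 * ((α + β + 1) * p₂ * q.2 -
      q.2 ^ 2 * ((α + 1) * (β + 1) * (p₂ + 1) - α * β * p₂))
    + q.1 * q.2 ^ 3 * ((1 + α) * (1 + β) * p₁ - α * β * p₁)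
    - 2 * (q.1 + q.2) * (2 - q.1 - q.2) * q.1 * q.2 * p₁ * p₂) (by fun_prop)
  have c₂ := poly (fun q => q.2 ^ 2 * (q.1 ^ 2 * ((α + β + 1) / 2 + 2 * p₂ + 1 -
      q.2 * (α + β + p₂ + 3))
    + q.1 * q.2 ^ 2 * p₁ - (q.1 + q.2) * (2 - q.1 - q.2) * q.1 * p₁)) (by fun_prop)
  have c₃ := poly (fun q => q.1 ^ 2 * q.2 ^ 3 * (1 - q.2)) (by fun_prop)
  have c₀₁ := poly (fun q => (α + β + 1) * (q.1 * q.2 ^ 2 * p₁ - q.1 ^ 2 * q.2 * p₂))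
    (by fun_prop)
  have c₁₁ := poly (fun q => 2 * p₁ * q.1 * q.2 ^ 3 + 2 * p₂ * q.1 ^ 3 * q.2 -
    (α + β + 3) * q.1 ^ 2 * q.2 ^ 2) (by fun_prop)
  have c₂₁ := poly (fun q => q.1 ^ 2 * q.2 ^ 2 * (q.1 - q.2)) (by fun_prop)
  have key := (((((c₀.mul h₀).add (c₁.mul h₁)).add (c₂.mul h₂)).add (c₃.mul h₃)).add
    (((c₀₁.mul h₀₁).add (c₁₁.mul h₁₁)).add (c₂₁.mul h₂₁)))
  have zero := tendsto_nhds_unique (Tendsto.congr' (f₂ := fun _ => (0 : ℂ)) ?_ key)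
    tendsto_const_nhds
  · rw [LineEq211]
    linear_combination zero
  · filter_upwards [hpW] with i hi
    linear_combination (h _ hi).tangential hW hG hi

/-- The limit of `Sys122.tangential` at a point of the curve. -/
theorem curveEq122_of_tendsto {p₁ p₂ b y w : ℂ} {f₀ f₁ f₂ f₃ : ℂ} {ι : Type*} {l : Filter ι}
    [l.NeBot] {x : ι → ℂ} (hW : IsOpen W) (hG : DifferentiableOn ℂ G W)
    (hpW : ∀ᶠ i in l, (x i, y) ∈ W)
    (h : ∀ q ∈ W, Sys122 (1 / 2) p₁ p₂ (1 - p₁) (1 - p₂) b (2 - b) G q)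
    (hw : w * (y - 1) = 1) (hx : Tendsto x l (𝓝 (y * w)))
    (h₀ : Tendsto (fun i => G (x i, y)) l (𝓝 f₀))
    (h₁ : Tendsto (fun i => tan₁ (-w ^ 2) G (x i, y)) l (𝓝 f₁))
    (h₂ : Tendsto (fun i => tan₂ (-w ^ 2) (2 * w ^ 3) G (x i, y)) l (𝓝 f₂))
    (h₃ : Tendsto (fun i => tan₃ (-w ^ 2) (2 * w ^ 3) (-6 * w ^ 4) G (x i, y)) l (𝓝 f₃))
    (h₀₁ : Tendsto (fun i => (x i - y * w) * dX G (x i, y)) l (𝓝 0))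
    (h₁₁ : Tendsto (fun i => (x i - y * w) * tan₁ (-w ^ 2) (dX G) (x i, y)) l (𝓝 0))
    (h₂₁ : Tendsto (fun i => (x i - y * w) * tan₂ (-w ^ 2) (2 * w ^ 3) (dX G) (x i, y)) l (𝓝 0))
    (h₀₂ : Tendsto (fun i => (x i - y * w) ^ 2 * dX (dX G) (x i, y)) l (𝓝 0))
    (h₁₂ : Tendsto (fun i => (x i - y * w) ^ 2 * tan₁ (-w ^ 2) (dX (dX G)) (x i, y)) l (𝓝 0))
    (h₀₃ : Tendsto (fun i => (x i - y * w) ^ 3 * dX (dX (dX G)) (x i, y)) l (𝓝 0)) :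
    CurveEq122 p₁ p₂ b (y * w) y f₀ f₁ f₂ f₃ := by
  have poly : ∀ φ : ℂ → ℂ, Continuous φ → Tendsto (fun i => φ (x i)) l (𝓝 (φ (y * w))) :=
    fun φ hφ => (hφ.tendsto _).comp hx
  have c₀ := poly (fun x => x * y / 2 * (x ^ 2 * (p₁ * (1 - p₁)) - y ^ 2 * (p₂ * (1 - p₂))))
    (by fun_prop)
  have c₁ := poly (fun x => x * y * (y * (y * b * (2 - b) -
      y ^ 2 * (3 / 2 * (1 + p₂) * (2 - p₂) - p₂ * (1 - p₂) / 2)) + x ^ 2 * y * p₁ * (1 - p₁)) -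
      (x + y) * (2 * x * y - x - y) * x * y * p₁ * (1 - p₁)) (by fun_prop)
  have c₂ := poly (fun x => x * y ^ 4 * (3 - 9 / 2 * y)) (by fun_prop)
  have c₃ := poly (fun x => x * y ^ 5 * (1 - y)) (by fun_prop)
  generalize hk : y * w = k at *
  have c₀₁ := poly (fun x => (y - 1) ^ 2 * y * x * (3 * k ^ 4 + 3 * k ^ 3 * x
        + k ^ 3 * (-(p₁ * (1 - p₁)) + p₂ * (1 - p₂) - b * (2 - b) - 6)
        + k ^ 2 * x ^ 2 * (p₁ * (1 - p₁) + 3)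
        + k ^ 2 * x * (p₁ * (1 - p₁) + p₂ * (1 - p₂) - b * (2 - b) - 6)
        + k ^ 2 * (2 * (p₁ * (1 - p₁)) - p₂ * (1 - p₂) + 2 * (b * (2 - b)) + 3)
        + k * x ^ 2 * (-2 * (p₁ * (1 - p₁)) - 6)
        + k * x * (-2 * (p₁ * (1 - p₁)) + 2 * (b * (2 - b)) + 3)
        + k * (-(p₁ * (1 - p₁)) + p₂ * (1 - p₂) - b * (2 - b)) + x ^ 2 * (p₁ * (1 - p₁) + 3)
        + x * (p₁ * (1 - p₁) - p₂ * (1 - p₂) - b * (2 - b)))) (by fun_prop)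
  have c₁₁ := poly (fun x => (y - 1) ^ 3 * y * x * (-3 * k ^ 4 - 3 * k ^ 3 * x + 9 * k ^ 3
        - 2 * k ^ 2 * x ^ 2 + 6 * k ^ 2 * x - 4 * k ^ 2 + 4 * k * x ^ 2 - 3 * k * x - 2 * x ^ 2))
    (by fun_prop)
  have c₂₁ := poly (fun x => y ^ 3 * (y - 1) ^ 2 * x *
    (3 * k ^ 2 + 2 * k * x - 2 * k - 2 * x)) (by fun_prop)
  have c₀₂ := poly (fun x => y * x * (9 / 2 * k ^ 2 + 7 * k * x - k + 9 / 2 * x ^ 2 - x))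
    (by fun_prop)
  have c₁₂ := poly (fun x => y * (y - 1) ^ 2 * x *
    (-3 * k ^ 3 - 4 * k ^ 2 * x + k ^ 2 - k * x ^ 2 + 2 * k * x + x ^ 2)) (by fun_prop)
  have c₀₃ := poly (fun x => y * x * (x + k) ^ 2) (by fun_prop)
  have key := ((((((c₀.mul h₀).add (c₁.mul h₁)).add (c₂.mul h₂)).add (c₃.mul h₃)).add
    (((c₀₁.mul h₀₁).add (c₁₁.mul h₁₁)).add (c₂₁.mul h₂₁))).add
    ((c₀₂.mul h₀₂).add (c₁₂.mul h₁₂))).add (c₀₃.mul h₀₃)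
  have zero := tendsto_nhds_unique (Tendsto.congr' (f₂ := fun _ => (0 : ℂ)) ?_ key)
    tendsto_const_nhds
  · rw [CurveEq122]
    linear_combination zero
  · filter_upwards [hpW] with i hi
    linear_combination (h _ hi).tangential hW hG hi hw hk.symm

variable {B : Set ℂ} {ω : ℂ} {ε : ℝ} {h : ℂ → ℂ}

theorem WedgeData.lineEq211 {α β p₁ p₂ : ℂ} (H : WedgeData G W (fun ζ => 1 - ζ) B ω ε h)
    (hs : ∀ q ∈ W, Sys211 α β p₁ p₂ ((α + β + 1) / 2) (2 * p₁) (2 * p₂) G q) {ζ : ℂ} (hζ : ζ ∈ B) :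
    LineEq211 α β p₁ p₂ ζ (h ζ) (deriv^[1] h ζ) (deriv^[2] h ζ) (deriv^[3] h ζ) := by
  have hχ : ∀ ζ ∈ B, HasDerivAt (fun ζ : ℂ => 1 - ζ) ((fun _ => -1) ζ) ζ :=
    fun ζ _ => (hasDerivAt_id ζ).const_sub 1
  have hc : ∀ ζ ∈ B, HasDerivAt (fun _ : ℂ => (-1 : ℂ)) ((fun _ => 0) ζ) ζ :=
    fun ζ _ => hasDerivAt_const ζ _
  have hc' : ∀ ζ ∈ B, HasDerivAt (fun _ : ℂ => (0 : ℂ)) ((fun _ => 0) ζ) ζ :=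
    fun ζ _ => hasDerivAt_const ζ _
  have hT := H.diff.dX H.isOpen
  have mem : ∀ᶠ t : ℝ in 𝓝[>] 0, ∀ ζ ∈ B, (1 - ζ + ω * t, ζ) ∈ W := by
    filter_upwards [Ioo_mem_nhdsGT H.ε_pos] with t ht ζ hζ using H.mem_of_pos hζ ht.1 ht.2
  have hu : ∀ {f g : ℝ → ℂ}, (∀ᶠ t in 𝓝[>] 0, f t = g t) →
      Tendsto (fun t : ℝ => (t : ℂ) ^ 1 * f t) (𝓝[>] 0) (𝓝 0) →
      Tendsto (fun t : ℝ => (1 - ζ + ω * t + ζ - 1) * g t) (𝓝[>] 0) (𝓝 0) := by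
    intro f g hfg hf
    have := hf.const_mul ω
    rw [mul_zero] at this
    refine this.congr' ?_
    filter_upwards [hfg] with t ht
    rw [ht]
    ring
  refine lineEq211_of_tendsto (l := 𝓝[>] (0 : ℝ)) (p := fun t => (1 - ζ + ω * t, ζ)) H.isOpen H.diff
    (mem.mono fun t ht => ht ζ hζ) hs ?_ (H.tendsto_iterate_deriv 0 hζ)
    ((H.tendsto_iterate_deriv 1 hζ).congr' ?_) ((H.tendsto_iterate_deriv 2 hζ).congr' ?_)
    ((H.tendsto_iterate_deriv 3 hζ).congr' ?_)
    (hu (.of_forall fun _ => rfl) (H.tendsto_pow_mul_iterate_deriv one_ne_zero 0 hζ))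
    (hu ?_ (H.tendsto_pow_mul_iterate_deriv one_ne_zero 1 hζ))
    (hu ?_ (H.tendsto_pow_mul_iterate_deriv one_ne_zero 2 hζ))
  · have : Continuous fun t : ℝ => (1 - ζ + ω * t, ζ) := by fun_prop
    simpa using (this.tendsto 0).mono_left nhdsWithin_le_nhds
  · filter_upwards [mem] with t ht
    exact iterate_deriv_one_along_curve H.isOpen H.diff ht hχ hζ
  · filter_upwards [mem] with t ht
    exact iterate_deriv_two_along_curve H.isOpen H.diff H.isOpen_base ht hχ hc hζ
  · filter_upwards [mem] with t ht
    exact iterate_deriv_three_along_curve H.isOpen H.diff H.isOpen_base ht hχ hc hc' hζ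
  · filter_upwards [mem] with t ht
    exact iterate_deriv_one_along_curve H.isOpen hT ht hχ hζ
  · filter_upwards [mem] with t ht
    exact iterate_deriv_two_along_curve H.isOpen hT H.isOpen_base ht hχ hc hζ

theorem WedgeData.curveEq122 {p₁ p₂ b : ℂ} (H : WedgeData G W (fun ζ => ζ / (ζ - 1)) B ω ε h)
    (hB1 : ∀ ζ ∈ B, ζ ≠ 1)
    (hs : ∀ q ∈ W, Sys122 (1 / 2) p₁ p₂ (1 - p₁) (1 - p₂) b (2 - b) G q) {ζ : ℂ} (hζ : ζ ∈ B) :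
    CurveEq122 p₁ p₂ b (ζ / (ζ - 1)) ζ (h ζ) (deriv^[1] h ζ) (deriv^[2] h ζ) (deriv^[3] h ζ) := by
  have hinv : ∀ ζ ∈ B, HasDerivAt (fun ζ : ℂ => (ζ - 1)⁻¹) (-((ζ - 1)⁻¹) ^ 2) ζ :=
    fun ζ hζ => hasDerivAt_inv_sub_one (hB1 ζ hζ)
  have hχ : ∀ ζ ∈ B, HasDerivAt (fun ζ : ℂ => ζ / (ζ - 1))
      ((fun ζ : ℂ => -((ζ - 1)⁻¹) ^ 2) ζ) ζ := by
    intro ζ hζ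
    have h1 := sub_ne_zero.2 (hB1 ζ hζ)
    refine ((hasDerivAt_id ζ).mul (hinv ζ hζ)).congr_deriv ?_
    simp only [id]
    field_simp
    ring
  have hc : ∀ ζ ∈ B, HasDerivAt (fun ζ : ℂ => -((ζ - 1)⁻¹) ^ 2)
      ((fun ζ : ℂ => 2 * ((ζ - 1)⁻¹) ^ 3) ζ) ζ := by
    intro ζ hζ
    refine (((hinv ζ hζ).pow 2).neg).congr_deriv ?_
    push_cast
    ring
  have hc' : ∀ ζ ∈ B, HasDerivAt (fun ζ : ℂ => 2 * ((ζ - 1)⁻¹) ^ 3)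
      ((fun ζ : ℂ => -6 * ((ζ - 1)⁻¹) ^ 4) ζ) ζ := by
    intro ζ hζ
    refine (((hinv ζ hζ).pow 3).const_mul 2).congr_deriv ?_
    push_cast
    ring
  have hT := H.diff.dX H.isOpen
  have hTT := hT.dX H.isOpen
  have mem : ∀ᶠ t : ℝ in 𝓝[>] 0, ∀ ζ ∈ B, (ζ / (ζ - 1) + ω * t, ζ) ∈ W := by
    filter_upwards [Ioo_mem_nhdsGT H.ε_pos] with t ht ζ hζ using H.mem_of_pos hζ ht.1 ht.2
  have hu : ∀ (k : ℕ) {f g : ℝ → ℂ}, (∀ᶠ t in 𝓝[>] 0, f t = g t) →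
      Tendsto (fun t : ℝ => (t : ℂ) ^ k * f t) (𝓝[>] 0) (𝓝 0) →
      Tendsto (fun t : ℝ => (ζ / (ζ - 1) + ω * t - ζ * (ζ - 1)⁻¹) ^ k * g t) (𝓝[>] 0) (𝓝 0) := by
    intro k f g hfg hf
    have := hf.const_mul (ω ^ k)
    rw [mul_zero] at this
    refine this.congr' ?_
    filter_upwards [hfg] with t ht
    rw [ht, div_eq_mul_inv, add_sub_cancel_left, mul_pow, mul_assoc]
  have hu₁ : ∀ {f g : ℝ → ℂ}, (∀ᶠ t in 𝓝[>] 0, f t = g t) →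
      Tendsto (fun t : ℝ => (t : ℂ) ^ 1 * f t) (𝓝[>] 0) (𝓝 0) →
      Tendsto (fun t : ℝ => (ζ / (ζ - 1) + ω * t - ζ * (ζ - 1)⁻¹) * g t) (𝓝[>] 0) (𝓝 0) :=
    fun hfg hf => by simpa only [pow_one] using hu 1 hfg hf
  rw [div_eq_mul_inv]
  refine curveEq122_of_tendsto (l := 𝓝[>] (0 : ℝ)) (x := fun t => ζ / (ζ - 1) + ω * t) H.isOpen
    H.diff (mem.mono fun t ht => ht ζ hζ) hs (inv_mul_cancel₀ (sub_ne_zero.2 (hB1 ζ hζ))) ?_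
    (H.tendsto_iterate_deriv 0 hζ)
    ((H.tendsto_iterate_deriv 1 hζ).congr' ?_) ((H.tendsto_iterate_deriv 2 hζ).congr' ?_)
    ((H.tendsto_iterate_deriv 3 hζ).congr' ?_)
    (hu₁ (.of_forall fun _ => rfl) (H.tendsto_pow_mul_iterate_deriv one_ne_zero 0 hζ))
    (hu₁ ?_ (H.tendsto_pow_mul_iterate_deriv one_ne_zero 1 hζ))
    (hu₁ ?_ (H.tendsto_pow_mul_iterate_deriv one_ne_zero 2 hζ))
    (hu 2 (.of_forall fun _ => rfl) (H.tendsto_pow_mul_iterate_deriv two_ne_zero 0 hζ))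
    (hu 2 ?_ (H.tendsto_pow_mul_iterate_deriv two_ne_zero 1 hζ))
    (hu 3 (.of_forall fun _ => rfl) (H.tendsto_pow_mul_iterate_deriv three_ne_zero 0 hζ))
  · have : Continuous fun t : ℝ => ζ / (ζ - 1) + ω * t := by fun_prop
    simpa [div_eq_mul_inv] using (this.tendsto 0).mono_left nhdsWithin_le_nhds
  · filter_upwards [mem] with t ht
    exact iterate_deriv_one_along_curve H.isOpen H.diff ht hχ hζ
  · filter_upwards [mem] with t ht
    exact iterate_deriv_two_along_curve H.isOpen H.diff H.isOpen_base ht hχ hc hζ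
  · filter_upwards [mem] with t ht
    exact iterate_deriv_three_along_curve H.isOpen H.diff H.isOpen_base ht hχ hc hc' hζ
  · filter_upwards [mem] with t ht
    exact iterate_deriv_one_along_curve H.isOpen hT ht hχ hζ
  · filter_upwards [mem] with t ht
    exact iterate_deriv_two_along_curve H.isOpen hT H.isOpen_base ht hχ hc hζ
  · filter_upwards [mem] with t ht
    exact iterate_deriv_one_along_curve H.isOpen hTT ht hχ hζ

end Limit

/-! ### The symmetric square equation in terms of derivatives -/

section SymSq

/-- The left-hand side of the symmetric square equation at `z`, as a linear form in the values
`y₀, y₁, y₂, y₃` of the derivatives of the unknown function. -/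
noncomputable def symSqForm (a b c z y₀ y₁ y₂ y₃ : ℂ) : ℂ :=
  z * (z ^ 3 * y₃ + (3 * a + 3 * b + 3) * z ^ 2 * y₂
      + (1 + 3 * a + 3 * b + 4 * a * b + 2 * (a + b) ^ 2) * z * y₁
      + 4 * a * b * (a + b) * y₀)
    - (z ^ 3 * y₃ + 3 * c * z ^ 2 * y₂ + c * (2 * c - 1) * z * y₁)
    + (2 * a + 2 * b - 2 * c + 1) * z / (z - 1) *
      ((a + b - c + 1) * (z * y₁) + 2 * a * b * y₀)

variable {𝕜 : Type*} [NontriviallyNormedField 𝕜] [NormedAlgebra 𝕜 ℂ]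

/-- The derivative of `(Θ + α) y` is `(Θ + α + 1) y'`. -/
theorem hasDerivAt_eulerAdd {U : Set 𝕜} (hU : IsOpen U) {y y₁ y₂ : 𝕜 → ℂ}
    (h : ∀ z ∈ U, HasDerivAt y (y₁ z) z) (h₁ : ∀ z ∈ U, HasDerivAt y₁ (y₂ z) z) (α : ℂ) {z : 𝕜}
    (hz : z ∈ U) : HasDerivAt (eulerAdd α y) (eulerAdd (1 + α) y₁ z) z := by
  have e : eulerAdd α y =ᶠ[𝓝 z] fun z => algebraMap 𝕜 ℂ z * y₁ z + α * y z := by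
    filter_upwards [hU.mem_nhds hz] with w hw
    rw [eulerAdd, (h w hw).deriv]
  have hid : HasDerivAt (fun z : 𝕜 => algebraMap 𝕜 ℂ z) 1 z := by
    simpa [Algebra.algebraMap_eq_smul_one] using (hasDerivAt_id z).smul_const (1 : ℂ)
  refine HasDerivAt.congr_of_eventuallyEq ?_ e
  refine ((hid.mul (h₁ z hz)).add ((h z hz).const_mul α)).congr_deriv ?_
  rw [eulerAdd, (h₁ z hz).deriv]
  ring

theorem symSqLHS_eq_symSqForm {U : Set 𝕜} (hU : IsOpen U) {y y₁ y₂ y₃ : 𝕜 → ℂ}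
    (h : ∀ z ∈ U, HasDerivAt y (y₁ z) z) (h₁ : ∀ z ∈ U, HasDerivAt y₁ (y₂ z) z)
    (h₂ : ∀ z ∈ U, HasDerivAt y₂ (y₃ z) z) (a b c : ℂ) {z : 𝕜} (hz : z ∈ U) :
    symSqLHS a b c y z = symSqForm a b c (algebraMap 𝕜 ℂ z) (y z) (y₁ z) (y₂ z) (y₃ z) := by
  have e₁ : ∀ α : ℂ, ∀ z ∈ U, HasDerivAt (eulerAdd α y) (eulerAdd (1 + α) y₁ z) z :=
    fun α z hz => hasDerivAt_eulerAdd hU h h₁ α hz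
  have e₂ : ∀ α : ℂ, ∀ z ∈ U, HasDerivAt (eulerAdd α y₁) (eulerAdd (1 + α) y₂ z) z :=
    fun α z hz => hasDerivAt_eulerAdd hU h₁ h₂ α hz
  have v : ∀ (α : ℂ) {f : 𝕜 → ℂ} {d : ℂ}, HasDerivAt f d z →
      eulerAdd α f z = algebraMap 𝕜 ℂ z * d + α * f z := fun α f d hf => by
    rw [eulerAdd, hf.deriv]
  have t : ∀ α β γ : ℂ, eulerAdd α (eulerAdd β (eulerAdd γ y)) z =
      algebraMap 𝕜 ℂ z * (algebraMap 𝕜 ℂ z * eulerAdd (1 + (1 + γ)) y₂ z +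
        (1 + β) * eulerAdd (1 + γ) y₁ z) +
      α * (algebraMap 𝕜 ℂ z * eulerAdd (1 + γ) y₁ z + β * eulerAdd γ y z) := fun α β γ => by
    rw [v α (hasDerivAt_eulerAdd hU (e₁ γ) (e₂ (1 + γ)) β hz), v (1 + β) (e₂ (1 + γ) z hz),
      v β (e₁ γ z hz)]
  rw [symSqLHS, t, t, symSqForm]
  simp only [v _ (h z hz), v _ (h₁ z hz), v _ (h₂ z hz)]
  ring

/-- The equation for a function of the form `E · h ∘ Y`, where `E' = g E`. -/
theorem symSqLHS_mul_comp {U : Set ℂ} (hU : IsOpen U) {E g g' g'' Y Y' Y'' Y''' h₀ h₁ h₂ h₃ : ℂ → ℂ}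
    (hE : ∀ z ∈ U, HasDerivAt E (g z * E z) z) (hg : ∀ z ∈ U, HasDerivAt g (g' z) z)
    (hg' : ∀ z ∈ U, HasDerivAt g' (g'' z) z) (hY : ∀ z ∈ U, HasDerivAt Y (Y' z) z)
    (hY' : ∀ z ∈ U, HasDerivAt Y' (Y'' z) z) (hY'' : ∀ z ∈ U, HasDerivAt Y'' (Y''' z) z)
    (hh₀ : ∀ z ∈ U, HasDerivAt h₀ (h₁ (Y z)) (Y z))
    (hh₁ : ∀ z ∈ U, HasDerivAt h₁ (h₂ (Y z)) (Y z))
    (hh₂ : ∀ z ∈ U, HasDerivAt h₂ (h₃ (Y z)) (Y z)) (a b c : ℂ) {z : ℂ} (hz : z ∈ U) :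
    symSqLHS a b c (fun z => E z * h₀ (Y z)) z = E z * symSqForm a b c z (h₀ (Y z))
      (g z * h₀ (Y z) + Y' z * h₁ (Y z))
      ((g z ^ 2 + g' z) * h₀ (Y z) + (2 * g z * Y' z + Y'' z) * h₁ (Y z) + Y' z ^ 2 * h₂ (Y z))
      ((g z ^ 3 + 3 * g z * g' z + g'' z) * h₀ (Y z)
        + (3 * (g z ^ 2 + g' z) * Y' z + 3 * g z * Y'' z + Y''' z) * h₁ (Y z)
        + (3 * g z * Y' z ^ 2 + 3 * Y' z * Y'' z) * h₂ (Y z) + Y' z ^ 3 * h₃ (Y z)) := by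
  have k₀ : ∀ z ∈ U, HasDerivAt (fun z => h₀ (Y z)) (h₁ (Y z) * Y' z) z :=
    fun z hz => (hh₀ z hz).comp z (hY z hz)
  have k₁ : ∀ z ∈ U, HasDerivAt (fun z => h₁ (Y z)) (h₂ (Y z) * Y' z) z :=
    fun z hz => (hh₁ z hz).comp z (hY z hz)
  have k₂ : ∀ z ∈ U, HasDerivAt (fun z => h₂ (Y z)) (h₃ (Y z) * Y' z) z :=
    fun z hz => (hh₂ z hz).comp z (hY z hz)
  rw [symSqLHS_eq_symSqForm hU (y := fun z => E z * h₀ (Y z))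
    (y₁ := fun z => E z * (g z * h₀ (Y z) + Y' z * h₁ (Y z)))
    (y₂ := fun z => E z * ((g z ^ 2 + g' z) * h₀ (Y z) + (2 * g z * Y' z + Y'' z) * h₁ (Y z)
      + Y' z ^ 2 * h₂ (Y z)))
    (y₃ := fun z => E z * ((g z ^ 3 + 3 * g z * g' z + g'' z) * h₀ (Y z)
        + (3 * (g z ^ 2 + g' z) * Y' z + 3 * g z * Y'' z + Y''' z) * h₁ (Y z)
        + (3 * g z * Y' z ^ 2 + 3 * Y' z * Y'' z) * h₂ (Y z) + Y' z ^ 3 * h₃ (Y z)))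
    (fun z hz => ?_) (fun z hz => ?_) (fun z hz => ?_) a b c hz]
  · simp only [symSqForm, Algebra.algebraMap_self, RingHom.id_apply]
    ring
  · refine ((hE z hz).mul (k₀ z hz)).congr_deriv ?_
    ring
  · refine ((hE z hz).mul (((hg z hz).mul (k₀ z hz)).add ((hY' z hz).mul (k₁ z hz)))).congr_deriv ?_
    simp only [Pi.add_apply, Pi.mul_apply]
    ring
  · refine ((hE z hz).mul ((((((hg z hz).pow 2).add (hg' z hz)).mul (k₀ z hz)).add
      (((((hg z hz).const_mul 2).mul (hY' z hz)).add (hY'' z hz)).mul (k₁ z hz))).add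
      (((hY' z hz).pow 2).mul (k₂ z hz)))).congr_deriv ?_
    simp only [Pi.add_apply, Pi.mul_apply, Pi.pow_apply]
    push_cast
    ring

end SymSq

/-! ### Restrictions of branches -/

section Restriction

variable {D : Set (ℂ × ℂ)} {F : ℂ × ℂ → ℂ} {γ : ℂ → ℂ × ℂ} {U S : Set ℂ} {f χ Z : ℂ → ℂ}

/-- Locally, the restriction of a branch is given by the boundary values on a wedge, the curve
being parameterized by its second coordinate `ζ`, with `z = Z ζ`. Where the branch is holomorphic
on the curve, any wedge in its domain will do. -/
theorem IsBranchRestriction.exists_wedgeData (hf : IsBranchRestriction D F γ U f) (hD : IsOpen D)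
    (hF : DifferentiableOn ℂ F D) (hU : IsOpen U) (hS : IsOpen S) (hχ : DifferentiableOn ℂ χ S)
    (hZ : DifferentiableOn ℂ Z S) (hγ : ∀ ζ ∈ S, γ (Z ζ) = (χ ζ, ζ)) {ζ₀ : ℂ} (hζ₀ : ζ₀ ∈ S)
    (hU₀ : Z ζ₀ ∈ U) :
    ∃ W G B ω ε, IsBranch D F W G ∧ ζ₀ ∈ B ∧ B ⊆ S ∧ (∀ ζ ∈ B, Z ζ ∈ U) ∧
      WedgeData G W χ B ω ε (fun ζ => f (Z ζ)) := by
  obtain ⟨W, G, hG, ω, ε, hε, h⟩ := hf _ hU₀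
  obtain ⟨hW, hGd⟩ := hG.isOpen_and_differentiableOn hD hF
  have hBo : IsOpen (S ∩ Z ⁻¹' (U ∩ Metric.ball (Z ζ₀) ε)) :=
    hZ.continuousOn.isOpen_inter_preimage hS (hU.inter Metric.isOpen_ball)
  have lim : ∀ ζ ∈ S ∩ Z ⁻¹' (U ∩ Metric.ball (Z ζ₀) ε),
      Tendsto G (𝓝[W] (χ ζ, ζ)) (𝓝 (f (Z ζ))) := fun ζ hζ => by
    rw [← hγ ζ hζ.1]
    exact (h _ hζ.2.2).2
  have h₀ : ζ₀ ∈ S ∩ Z ⁻¹' (U ∩ Metric.ball (Z ζ₀) ε) := ⟨hζ₀, hU₀, Metric.mem_ball_self hε⟩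
  by_cases hω : ω = 0
  · subst hω
    have hmem : (χ ζ₀, ζ₀) ∈ W := by
      have := (h _ h₀.2.2).1 ((ε / 2 : ℝ) : ℂ) (by rw [Complex.ofReal_re]; positivity)
        (by rw [Complex.norm_real, Real.norm_eq_abs, abs_of_pos (by positivity)]; linarith)
      rw [hγ ζ₀ hζ₀] at this
      simpa using this
    obtain ⟨ρ, hρ, hball⟩ := Metric.isOpen_iff.1 hW _ hmem
    have hcurve : ContinuousOn (fun ζ => (χ ζ, ζ)) S := hχ.continuousOn.prodMk continuousOn_id
    have hB'o := (hcurve.mono inter_subset_left).isOpen_inter_preimage hBo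
      (Metric.isOpen_ball (x := (χ ζ₀, ζ₀)) (ε := ρ / 2))
    refine ⟨W, G, S ∩ Z ⁻¹' (U ∩ Metric.ball (Z ζ₀) ε) ∩
      (fun ζ => (χ ζ, ζ)) ⁻¹' Metric.ball (χ ζ₀, ζ₀) (ρ / 2), 1, ρ / 2, hG,
      ⟨h₀, Metric.mem_ball_self (half_pos hρ)⟩, fun ζ hζ => hζ.1.1, fun ζ hζ => hζ.1.2.1, hW, hGd, hB'o, hχ.mono fun ζ hζ => hζ.1.1, one_ne_zero,
      half_pos hρ, fun ζ hζ s _ hs => hball ?_, fun ζ hζ => lim ζ hζ.1⟩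
    have h1 : dist (χ ζ, ζ) (χ ζ₀, ζ₀) < ρ / 2 := hζ.2
    have h2 : dist (χ ζ + 1 * s, ζ) (χ ζ, ζ) ≤ ‖s‖ := by
      rw [dist_eq_norm]
      simp [Prod.norm_def]
    rw [Metric.mem_ball]
    linarith [dist_triangle (χ ζ + 1 * s, ζ) (χ ζ, ζ) (χ ζ₀, ζ₀)]
  · refine ⟨W, G, _, ω, ε, hG, h₀, fun ζ hζ => hζ.1, fun ζ hζ => hζ.2.1, hW, hGd, hBo,
      hχ.mono fun ζ hζ => hζ.1, hω, hε, fun ζ hζ s hs0 hs => ?_, lim⟩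
    have := (h _ hζ.2.2).1 s hs0 hs
    rw [hγ ζ hζ.1] at this
    simpa using this

theorem hasDerivAt_iterate_deriv {B : Set ℂ} (hB : IsOpen B) {h : ℂ → ℂ}
    (hh : DifferentiableOn ℂ h B) (m : ℕ) {ζ : ℂ} (hζ : ζ ∈ B) :
    HasDerivAt (deriv^[m] h) (deriv^[m + 1] h ζ) ζ := by
  rw [Function.iterate_succ_apply']
  exact ((hh.iterate_deriv hB m).differentiableAt (hB.mem_nhds hζ)).hasDerivAt

theorem isSymSqSolution_of_local {a b c : ℂ} (hU : IsOpen U) {y : ℂ → ℂ}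
    (h : ∀ z ∈ U, DifferentiableAt ℂ y z ∧ symSqLHS a b c y z = 0) : IsSymSqSolution a b c U y :=
  ⟨(DifferentiableOn.contDiffOn (n := 3) (fun z hz => (h z hz).1.differentiableWithinAt) hU),
    fun z hz => (h z hz).2⟩

theorem symSqLHS_congr {a b c : ℂ} {y y' : ℂ → ℂ} {z : ℂ} (h : y =ᶠ[𝓝 z] y') :
    symSqLHS a b c y z = symSqLHS a b c y' z := by
  have key : ∀ α : ℂ, ∀ {f g : ℂ → ℂ}, f =ᶠ[𝓝 z] g → eulerAdd α f =ᶠ[𝓝 z] eulerAdd α g := by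
    intro α f g hfg
    filter_upwards [hfg, hfg.deriv] with w h1 h2
    rw [eulerAdd, eulerAdd, h1, h2]
  simp only [symSqLHS, (key _ (key _ (key _ h))).eq_of_nhds, (key _ h).eq_of_nhds, h.eq_of_nhds]

theorem symSqForm_eq_zero_of_lineEq211 {a b c z f₀ f₁ f₂ f₃ : ℂ} (hz : z ≠ 1)
    (h : LineEq211 (2 * a) (2 * b) (c - 1 / 2) (a + b - c + 1 / 2) (1 - z) f₀ f₁ f₂ f₃) :
    symSqForm a b c z f₀ (-f₁) f₂ (-f₃) = 0 := by
  have := sub_ne_zero.2 hz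
  simp only [LineEq211, sub_sub_cancel] at h
  rw [symSqForm]
  linear_combination (norm := (field_simp; ring)) 1 / (z - 1) ^ 2 * h

/-- Any branch of `F^{2:1;1}_{1:1;1}` restricted to the line solves the equation. -/
theorem isSymSqSolution_branch211 (a b c : ℂ) (hγ : LowerOK (a + b + 1 / 2))
    (hq₁ : LowerOK (2 * c - 1)) (hq₂ : LowerOK (2 * a + 2 * b - 2 * c + 1)) (hU : IsOpen U)
    (h1 : 1 ∉ U)
    (hf : IsBranchRestriction dom211 (F211 (2 * a) (2 * b) (c - 1 / 2) (a + b - c + 1 / 2)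
      (a + b + 1 / 2) (2 * c - 1) (2 * a + 2 * b - 2 * c + 1)) (fun z => (z, 1 - z)) U f) :
    IsSymSqSolution a b c U f := by
  have hconv := (coefBound_coef211 (a := 2 * a) (b := 2 * b) (p₁ := c - 1 / 2)
    (p₂ := a + b - c + 1 / 2) hγ hq₁ hq₂).convOn
  refine isSymSqSolution_of_local hU fun z hz => ?_
  obtain ⟨W, G, B, ω, ε, hG, hzB, -, hBU, H⟩ := hf.exists_wedgeData isOpen_dom211
    (hconv.differentiableOn bidiscCovered_dom211) hU isOpen_univ (χ := fun ζ => 1 - ζ)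
    (Z := fun ζ => 1 - ζ) (by fun_prop) (by fun_prop) (fun ζ _ => by simp) (ζ₀ := 1 - z) trivial
    (by simpa using hz)
  have hs := hG.sys211 fun p hp =>
    sys211_dser hconv bidiscCovered_dom211 isOpen_dom211 hγ hq₁ hq₂ hp
  have hs' : ∀ q ∈ W, Sys211 (2 * a) (2 * b) (c - 1 / 2) (a + b - c + 1 / 2)
      ((2 * a + 2 * b + 1) / 2) (2 * (c - 1 / 2)) (2 * (a + b - c + 1 / 2)) G q := by
    rw [show (2 * a + 2 * b + 1) / 2 = a + b + 1 / 2 by ring,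
      show 2 * (c - 1 / 2) = 2 * c - 1 by ring,
      show 2 * (a + b - c + 1 / 2) = 2 * a + 2 * b - 2 * c + 1 by ring]
    exact hs
  have hV : IsOpen {z : ℂ | 1 - z ∈ B} := H.isOpen_base.preimage (by fun_prop)
  have hh := fun m ζ hζ => hasDerivAt_iterate_deriv H.isOpen_base H.differentiableOn_boundary m
    (ζ := ζ) hζ
  have hY : ∀ z ∈ {z : ℂ | 1 - z ∈ B}, HasDerivAt (fun z : ℂ => 1 - z) ((fun _ => -1) z) z :=
    fun z _ => (hasDerivAt_id z).const_sub 1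
  have e : f = fun z => 1 * (fun ζ => f (1 - ζ)) (1 - z) := by
    ext z
    simp
  constructor
  · have := (hh 0 _ hzB).comp z (hY z hzB)
    refine (this.congr_of_eventuallyEq (.of_forall fun w => ?_)).differentiableAt
    simp
  · have key := symSqLHS_mul_comp hV (E := fun _ => 1) (g := fun _ => 0) (g' := fun _ => 0)
      (g'' := fun _ => 0) (Y' := fun _ => -1) (Y'' := fun _ => 0) (Y''' := fun _ => 0)
      (fun z _ => (hasDerivAt_const z 1).congr_deriv (by simp)) (fun z _ => hasDerivAt_const z 0)
      (fun z _ => hasDerivAt_const z 0) hY (fun z _ => hasDerivAt_const z _)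
      (fun z _ => hasDerivAt_const z _) (fun z hz => hh 0 _ hz) (fun z hz => hh 1 _ hz)
      (fun z hz => hh 2 _ hz) a b c hzB
    rw [Function.iterate_zero, id, ← e] at key
    rw [key, one_mul]
    have ode := symSqForm_eq_zero_of_lineEq211 (fun h => h1 (h ▸ hz)) (H.lineEq211 hs' hzB)
    rw [symSqForm] at ode ⊢
    linear_combination ode

theorem IsLogBranch.hasDerivAt {g l : ℂ → ℂ} (hl : IsLogBranch U g l) (hU : IsOpen U) {z g' : ℂ}
    (hz : z ∈ U) (hg : HasDerivAt g g' z) : HasDerivAt l (g' / g z) z := by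
  have h1 := (hl.1.differentiableAt (hU.mem_nhds hz)).hasDerivAt
  have h2 : (fun z => Complex.exp (l z)) =ᶠ[𝓝 z] g := by
    filter_upwards [hU.mem_nhds hz] with w hw using hl.2 w hw
  have h3 := h1.cexp.unique (hg.congr_of_eventuallyEq h2)
  rw [hl.2 z hz] at h3
  have h0 : g z ≠ 0 := (hl.2 z hz).symm.trans_ne (Complex.exp_ne_zero _)
  refine h1.congr_deriv ?_
  rw [← h3]
  field_simp

/-- Any branch of `F^{1:2;2}_{2:0;0}` restricted to a curve `x = y / (y - 1)`, parameterized by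
`y = Y z`, and multiplied by powers of `z` and `1 - z`, solves the equation as soon as the
equation is formally a consequence of `CurveEq122`. -/
theorem powerTimesBranchSolves_of_curveEq122 {a b c α β p₁ p₂ q : ℂ} {Y Y' Y'' Y''' : ℂ → ℂ}
    (hq : LowerOK q) (hq' : LowerOK (2 - q))
    (hY₀ : ∀ z, z ≠ 0 → z ≠ 1 → Y z ≠ 1 ∧ Z (Y z) = z)
    (hY : ∀ z, z ≠ 0 → z ≠ 1 → HasDerivAt Y (Y' z) z)
    (hY' : ∀ z, z ≠ 0 → z ≠ 1 → HasDerivAt Y' (Y'' z) z)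
    (hY'' : ∀ z, z ≠ 0 → z ≠ 1 → HasDerivAt Y'' (Y''' z) z) (hS : IsOpen S)
    (hYS : ∀ z, z ≠ 0 → z ≠ 1 → Y z ∈ S) (hS1 : ∀ ζ ∈ S, ζ ≠ 1)
    (hZ : DifferentiableOn ℂ Z S) (hγ : ∀ ζ ∈ S, γ (Z ζ) = (ζ / (ζ - 1), ζ))
    (alg : ∀ z, z ≠ 0 → z ≠ 1 → ∀ g g' g'' h₀ h₁ h₂ h₃ : ℂ, g = α / z + β / (z - 1) →
      g' = -α / z ^ 2 - β / (z - 1) ^ 2 → g'' = 2 * α / z ^ 3 + 2 * β / (z - 1) ^ 3 →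
      CurveEq122 p₁ p₂ q (Y z / (Y z - 1)) (Y z) h₀ h₁ h₂ h₃ →
      symSqForm a b c z h₀ (g * h₀ + Y' z * h₁)
        ((g ^ 2 + g') * h₀ + (2 * g * Y' z + Y'' z) * h₁ + Y' z ^ 2 * h₂)
        ((g ^ 3 + 3 * g * g' + g'') * h₀
          + (3 * (g ^ 2 + g') * Y' z + 3 * g * Y'' z + Y''' z) * h₁
          + (3 * g * Y' z ^ 2 + 3 * Y' z * Y'' z) * h₂ + Y' z ^ 3 * h₃) = 0) :
    PowerTimesBranchSolves a b c α β (F122 (1 / 2) p₁ p₂ (1 - p₁) (1 - p₂) q (2 - q)) γ := by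
  intro U l₀ l₁ f hU hl₀ hl₁ hf
  have hne0 : ∀ z ∈ U, z ≠ 0 := fun z hz =>
    (hl₀.2 z hz).symm.trans_ne (Complex.exp_ne_zero _)
  have hne1' : ∀ z ∈ U, 1 - z ≠ 0 := fun z hz =>
    (hl₁.2 z hz).symm.trans_ne (Complex.exp_ne_zero _)
  have hne1 : ∀ z ∈ U, z ≠ 1 := fun z hz h => hne1' z hz (by rw [h, sub_self])
  have hconv := convOn_coef122 (a := 1 / 2) (p₁ := p₁) (p₂ := p₂) (q₁ := 1 - p₁) (q₂ := 1 - p₂)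
    hq hq'
  refine isSymSqSolution_of_local hU fun z hz => ?_
  obtain ⟨W, G, B, ω, ε, hG, hzB, hBS, hBU, H⟩ := hf.exists_wedgeData isOpen_dom122
    (hconv.differentiableOn bidiscCovered_dom122) hU hS (χ := fun ζ => ζ / (ζ - 1))
    (differentiableOn_id.div (differentiableOn_id.sub_const 1) fun ζ hζ =>
      sub_ne_zero.2 (hS1 ζ hζ)) hZ hγ (hYS z (hne0 z hz) (hne1 z hz))
    (by rwa [(hY₀ z (hne0 z hz) (hne1 z hz)).2])
  have hs := hG.sys122 fun p hp =>
    sys122_dser hconv bidiscCovered_dom122 isOpen_dom122 hq hq' hp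
  have hYU : ∀ z ∈ U, HasDerivAt Y (Y' z) z := fun z hz => hY z (hne0 z hz) (hne1 z hz)
  have hV : IsOpen (U ∩ Y ⁻¹' B) := ContinuousOn.isOpen_inter_preimage
    (fun z hz => (hYU z hz).continuousAt.continuousWithinAt) hU H.isOpen_base
  have hh := fun m ζ hζ => hasDerivAt_iterate_deriv H.isOpen_base H.differentiableOn_boundary m
    (ζ := ζ) hζ
  have hE : ∀ z ∈ U ∩ Y ⁻¹' B, HasDerivAt (fun z => Complex.exp (α * l₀ z + β * l₁ z))
      ((fun z => α / z + β / (z - 1)) z * Complex.exp (α * l₀ z + β * l₁ z)) z := by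
    intro z hz
    have h₀ := hl₀.hasDerivAt hU hz.1 (hasDerivAt_id z)
    have h₁ := hl₁.hasDerivAt hU hz.1 ((hasDerivAt_id z).const_sub 1)
    refine ((h₀.const_mul α).add (h₁.const_mul β)).cexp.congr_deriv ?_
    simp only [Pi.add_apply]
    rw [← neg_sub z 1, neg_div_neg_eq]
    ring
  have hi₀ : ∀ z ∈ U ∩ Y ⁻¹' B, HasDerivAt (fun z : ℂ => z⁻¹) (-z⁻¹ ^ 2) z := fun z hz =>
    (hasDerivAt_inv (hne0 z hz.1)).congr_deriv (by rw [inv_pow])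
  have hi₁ : ∀ z ∈ U ∩ Y ⁻¹' B, HasDerivAt (fun z : ℂ => (z - 1)⁻¹) (-(z - 1)⁻¹ ^ 2) z :=
    fun z hz => hasDerivAt_inv_sub_one (hne1 z hz.1)
  have hg : ∀ z ∈ U ∩ Y ⁻¹' B, HasDerivAt (fun z => α / z + β / (z - 1))
      ((fun z => -α / z ^ 2 - β / (z - 1) ^ 2) z) z := by
    intro z hz
    simp only [div_eq_mul_inv, ← inv_pow]
    refine (((hi₀ z hz).const_mul α).add ((hi₁ z hz).const_mul β)).congr_deriv ?_
    ring
  have hg' : ∀ z ∈ U ∩ Y ⁻¹' B, HasDerivAt (fun z => -α / z ^ 2 - β / (z - 1) ^ 2)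
      ((fun z => 2 * α / z ^ 3 + 2 * β / (z - 1) ^ 3) z) z := by
    intro z hz
    simp only [div_eq_mul_inv, ← inv_pow]
    refine ((((hi₀ z hz).pow 2).const_mul (-α)).sub
      (((hi₁ z hz).pow 2).const_mul β)).congr_deriv ?_
    push_cast
    ring
  have e : ∀ w ∈ U ∩ Y ⁻¹' B, Complex.exp (α * l₀ w + β * l₁ w) * f w =
      Complex.exp (α * l₀ w + β * l₁ w) * (fun ζ => f (Z ζ)) (Y w) := fun w hw => by
    simp only [(hY₀ w (hne0 w hw.1) (hne1 w hw.1)).2]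
  have e' : (fun w => Complex.exp (α * l₀ w + β * l₁ w) * f w) =ᶠ[𝓝 z]
      fun w => Complex.exp (α * l₀ w + β * l₁ w) * (fun ζ => f (Z ζ)) (Y w) := by
    filter_upwards [hV.mem_nhds ⟨hz, hzB⟩] with w hw using e w hw
  constructor
  · have := (hE z ⟨hz, hzB⟩).mul ((hh 0 _ hzB).comp z (hYU z hz))
    exact (this.congr_of_eventuallyEq e').differentiableAt
  · have key := symSqLHS_mul_comp hV hE hg hg' (fun z hz => hYU z hz.1)
      (fun z hz => hY' z (hne0 z hz.1) (hne1 z hz.1))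
      (fun z hz => hY'' z (hne0 z hz.1) (hne1 z hz.1)) (fun z hz => hh 0 _ hz.2)
      (fun z hz => hh 1 _ hz.2) (fun z hz => hh 2 _ hz.2) a b c (z := z) ⟨hz, hzB⟩
    rw [symSqLHS_congr e']
    refine key.trans (mul_eq_zero_of_right _ ?_)
    exact alg z (hne0 z hz) (hne1 z hz) _ _ _ _ _ _ _ rfl rfl rfl
      (H.curveEq122 (fun ζ hζ => hS1 ζ (hBS hζ)) hs hzB)

end Restriction

/-! ### The three curves with power factors -/

section PowerFactors

theorem isOpen_ne_zero_ne_one : IsOpen {ζ : ℂ | ζ ≠ 0 ∧ ζ ≠ 1} :=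
  isOpen_ne.inter isOpen_ne

theorem hasDerivAt_inv_pow_two {z : ℂ} (hz : z ≠ 0) :
    HasDerivAt (fun z : ℂ => z⁻¹ ^ 2) (-2 * z⁻¹ ^ 3) z := by
  refine ((hasDerivAt_inv hz).pow 2).congr_deriv ?_
  push_cast
  field_simp

/-- The branches on the curve `z ↦ (z, z / (z - 1))`. -/
theorem powerTimesBranchSolves_div_sub_one (a b c : ℂ) (hc : LowerOK c) (hc' : LowerOK (2 - c)) :
    PowerTimesBranchSolves a b c (1 - c) (c - a - b - 1 / 2)
      (F122 (1 / 2) (a - b + 1 / 2) (a + b - c + 1 / 2) (b - a + 1 / 2) (c - a - b + 1 / 2)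
        c (2 - c)) (fun z => (z, z / (z - 1))) := by
  rw [show b - a + 1 / 2 = 1 - (a - b + 1 / 2) by ring,
    show c - a - b + 1 / 2 = 1 - (a + b - c + 1 / 2) by ring]
  have hsub : ∀ z : ℂ, z ≠ 1 → z / (z - 1) - 1 = (z - 1)⁻¹ := fun z hz => by
    have := sub_ne_zero.2 hz
    field_simp
    ring
  have hne : ∀ z : ℂ, z ≠ 1 → z / (z - 1) ≠ 1 := fun z hz => by
    rw [← sub_ne_zero, hsub z hz]
    exact inv_ne_zero (sub_ne_zero.2 hz)
  refine powerTimesBranchSolves_of_curveEq122 (Y := fun z => z / (z - 1))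
    (Y' := fun z => -(z - 1)⁻¹ ^ 2) (Y'' := fun z => 2 * (z - 1)⁻¹ ^ 3)
    (Y''' := fun z => -6 * (z - 1)⁻¹ ^ 4) (S := {ζ | ζ ≠ 0 ∧ ζ ≠ 1}) (Z := fun ζ => ζ / (ζ - 1))
    hc hc' (fun z _ hz => ⟨hne z hz, ?_⟩) (fun z _ hz => ?_) (fun z _ hz => ?_) (fun z _ hz => ?_)
    isOpen_ne_zero_ne_one (fun z hz0 hz => ⟨div_ne_zero hz0 (sub_ne_zero.2 hz), hne z hz⟩)
    (fun ζ hζ => hζ.2) (fun ζ hζ => ?_) (fun ζ hζ => ?_)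
    (fun z hz0 hz g g' g'' h₀ h₁ h₂ h₃ hg hg' hg'' h => ?_)
  · have := sub_ne_zero.2 hz
    rw [hsub z hz]
    field_simp
  · have := sub_ne_zero.2 hz
    refine ((hasDerivAt_id z).mul (hasDerivAt_inv_sub_one hz)).congr_deriv ?_
    simp only [id]
    field_simp
    ring
  · refine (((hasDerivAt_inv_sub_one hz).pow 2).neg).congr_deriv ?_
    push_cast
    ring
  · refine (((hasDerivAt_inv_sub_one hz).pow 3).const_mul 2).congr_deriv ?_
    push_cast
    ring
  · exact ((hasDerivAt_id ζ).mul
      (hasDerivAt_inv_sub_one hζ.2)).differentiableAt.differentiableWithinAt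
  · rw [Prod.mk.injEq]
    have := sub_ne_zero.2 hζ.2
    refine ⟨rfl, ?_⟩
    rw [hsub ζ hζ.2]
    field_simp
  · have h1 := sub_ne_zero.2 hz
    simp only [CurveEq122, hsub z hz, div_inv_eq_mul] at h
    subst hg hg' hg''
    rw [symSqForm]
    -- The factor is the ratio of the coefficients of the third derivative.
    linear_combination (norm := (field_simp; ring)) (z - 1) / z ^ 3 * h

/-- The branches on the curve `z ↦ (1 - z, 1 - 1 / z)`. -/
theorem powerTimesBranchSolves_one_sub_inv (a b c : ℂ) (hc : LowerOK (a + b - c + 1))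
    (hc' : LowerOK (c - a - b + 1)) :
    PowerTimesBranchSolves a b c (1 / 2 - c) (c - a - b)
      (F122 (1 / 2) (a - b + 1 / 2) (c - 1 / 2) (b - a + 1 / 2) (3 / 2 - c)
        (a + b - c + 1) (c - a - b + 1)) (fun z => (1 - z, 1 - 1 / z)) := by
  rw [show b - a + 1 / 2 = 1 - (a - b + 1 / 2) by ring,
    show 3 / 2 - c = 1 - (c - 1 / 2) by ring]
  have e : c - a - b + 1 = 2 - (a + b - c + 1) := by ring
  rw [e] at hc' ⊢
  have hne : ∀ z : ℂ, z ≠ 0 → 1 - 1 / z ≠ 1 := fun z hz => by simpa using hz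
  refine powerTimesBranchSolves_of_curveEq122 (Y := fun z => 1 - 1 / z)
    (Y' := fun z => z⁻¹ ^ 2) (Y'' := fun z => -2 * z⁻¹ ^ 3)
    (Y''' := fun z => 6 * z⁻¹ ^ 4) (S := {ζ | ζ ≠ 0 ∧ ζ ≠ 1}) (Z := fun ζ => -(ζ - 1)⁻¹)
    hc hc' (fun z hz _ => ⟨hne z hz, ?_⟩) (fun z hz _ => ?_) (fun z hz _ => ?_) (fun z hz _ => ?_)
    isOpen_ne_zero_ne_one (fun z hz0 hz => ⟨?_, hne z hz0⟩)
    (fun ζ hζ => hζ.2) (fun ζ hζ => ?_) (fun ζ hζ => ?_)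
    (fun z hz0 hz g g' g'' h₀ h₁ h₂ h₃ hg hg' hg'' h => ?_)
  · field_simp
    simp
  · simp only [one_div]
    refine ((hasDerivAt_inv hz).const_sub 1).congr_deriv ?_
    simp [inv_pow]
  · exact hasDerivAt_inv_pow_two hz
  · refine (((hasDerivAt_inv hz).pow 3).const_mul (-2)).congr_deriv ?_
    push_cast
    field_simp
    norm_num
  · rw [sub_ne_zero, one_div]
    exact fun h => hz (inv_eq_one.1 h.symm)
  · exact (hasDerivAt_inv_sub_one hζ.2).neg.differentiableAt.differentiableWithinAt
  · rw [Prod.mk.injEq]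
    have := sub_ne_zero.2 hζ.2
    constructor <;> field_simp <;> ring
  · have h1 := sub_ne_zero.2 hz
    have hx : (1 - 1 / z) / (1 - 1 / z - 1) = 1 - z := by field_simp; ring
    have hy : 1 - 1 / z = (z - 1) / z := by field_simp
    simp only [CurveEq122, hx] at h
    rw [hy] at h
    subst hg hg' hg''
    rw [symSqForm]
    linear_combination (norm := (field_simp; ring)) -z ^ 3 / (z - 1) ^ 5 * h

/-- The branches on the curve `z ↦ (1 / z, 1 / (1 - z))`. -/
theorem powerTimesBranchSolves_inv (a b c : ℂ) (hc : LowerOK (a - b + 1))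
    (hc' : LowerOK (b - a + 1)) :
    PowerTimesBranchSolves a b c (1 / 2 - c) (c - a - b - 1 / 2)
      (F122 (1 / 2) (c - 1 / 2) (a + b - c + 1 / 2) (3 / 2 - c) (c - a - b + 1 / 2)
        (a - b + 1) (b - a + 1)) (fun z => (1 / z, 1 / (1 - z))) := by
  rw [show c - a - b + 1 / 2 = 1 - (a + b - c + 1 / 2) by ring,
    show 3 / 2 - c = 1 - (c - 1 / 2) by ring]
  have e : b - a + 1 = 2 - (a - b + 1) := by ring
  rw [e] at hc' ⊢
  have hinv : ∀ z : ℂ, 1 / (1 - z) = -(z - 1)⁻¹ := fun z => by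
    rw [← neg_sub z 1, one_div, inv_neg]
  have hne : ∀ z : ℂ, z ≠ 0 → z ≠ 1 → -(z - 1)⁻¹ ≠ 1 := fun z hz0 hz h => by
    have := sub_ne_zero.2 hz
    field_simp at h
    exact hz0 (by linear_combination -h)
  simp only [hinv]
  refine powerTimesBranchSolves_of_curveEq122 (Y := fun z => -(z - 1)⁻¹)
    (Y' := fun z => (z - 1)⁻¹ ^ 2) (Y'' := fun z => -2 * (z - 1)⁻¹ ^ 3)
    (Y''' := fun z => 6 * (z - 1)⁻¹ ^ 4) (S := {ζ | ζ ≠ 0 ∧ ζ ≠ 1}) (Z := fun ζ => 1 - ζ⁻¹)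
    hc hc' (fun z hz0 hz => ⟨hne z hz0 hz, ?_⟩) (fun z _ hz => ?_) (fun z _ hz => ?_)
    (fun z _ hz => ?_) isOpen_ne_zero_ne_one
    (fun z hz0 hz => ⟨neg_ne_zero.2 (inv_ne_zero (sub_ne_zero.2 hz)), hne z hz0 hz⟩)
    (fun ζ hζ => hζ.2) (fun ζ hζ => ?_) (fun ζ hζ => ?_)
    (fun z hz0 hz g g' g'' h₀ h₁ h₂ h₃ hg hg' hg'' h => ?_)
  · rw [inv_neg, inv_inv]
    ring
  · exact (hasDerivAt_inv_sub_one hz).neg.congr_deriv (neg_neg _)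
  · refine ((hasDerivAt_inv_sub_one hz).pow 2).congr_deriv ?_
    push_cast
    ring
  · refine (((hasDerivAt_inv_sub_one hz).pow 3).const_mul (-2)).congr_deriv ?_
    push_cast
    ring
  · exact ((hasDerivAt_inv hζ.1).const_sub 1).differentiableAt.differentiableWithinAt
  · rw [Prod.mk.injEq]
    have h0 := hζ.1
    have h1 := sub_ne_zero.2 hζ.2
    refine ⟨?_, ?_⟩
    · rw [show 1 - ζ⁻¹ = (ζ - 1) / ζ by field_simp]
      field_simp
    · rw [sub_sub_cancel_left, inv_neg, inv_inv, neg_neg]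
  · have h1 := sub_ne_zero.2 hz
    have hx : -(z - 1)⁻¹ / (-(z - 1)⁻¹ - 1) = 1 / z := by
      rw [show -(z - 1)⁻¹ - 1 = -z / (z - 1) by field_simp; ring]
      field_simp
    simp only [CurveEq122, hx] at h
    subst hg hg' hg''
    rw [symSqForm]
    linear_combination (norm := (field_simp; ring)) -z ^ 3 * (z - 1) * h

end PowerFactors

/-! ### Derivatives of double series with respect to the coefficients -/

section Shift

/-- The coefficients of the derivative in the first variable. -/
def shiftX (A : ℕ × ℕ → ℂ) (k : ℕ × ℕ) : ℂ := (k.1 + 1) * A (k.1 + 1, k.2)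

/-- The coefficients of the derivative in the second variable. -/
def shiftY (A : ℕ × ℕ → ℂ) (k : ℕ × ℕ) : ℂ := (k.2 + 1) * A (k.1, k.2 + 1)

/-- The coefficients of the derivative in the direction `(-1, 1)` of the line `x + y = 1`. -/
def shiftD (A : ℕ × ℕ → ℂ) (k : ℕ × ℕ) : ℂ := shiftY A k - shiftX A k

variable {A B : ℕ × ℕ → ℂ} {D : Set (ℂ × ℂ)} {e : ℝ}

theorem hasSum_shiftX (hA : ConvOn A D) (hD : BidiscCovered D) (hDo : IsOpen D) {p : ℂ × ℂ}
    (hp : p ∈ D) : HasSum (fun k => shiftX A k * p.1 ^ k.1 * p.2 ^ k.2) (dX (dser A) p) := by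
  have hinj : Function.Injective fun k : ℕ × ℕ => (k.1 + 1, k.2) := by
    rintro ⟨i, j⟩ ⟨i', j'⟩ h
    simpa using h
  have h := (hinj.hasSum_iff ?_).2 (hasSum_dX_dser hA hD hDo hp)
  · refine h.congr_fun fun k => ?_
    simp only [shiftX, Function.comp_apply, add_tsub_cancel_right]
    push_cast
    ring
  · rintro ⟨i, j⟩ hk
    rcases i with _ | i
    · simp
    · exact absurd ⟨(i, j), rfl⟩ hk

theorem hasSum_shiftY (hA : ConvOn A D) (hD : BidiscCovered D) (hDo : IsOpen D) {p : ℂ × ℂ}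
    (hp : p ∈ D) : HasSum (fun k => shiftY A k * p.1 ^ k.1 * p.2 ^ k.2) (dY (dser A) p) := by
  have hinj : Function.Injective fun k : ℕ × ℕ => (k.1, k.2 + 1) := by
    rintro ⟨i, j⟩ ⟨i', j'⟩ h
    simpa using h
  have h := (hinj.hasSum_iff ?_).2 (hasSum_dY_dser hA hD hDo hp)
  · refine h.congr_fun fun k => ?_
    simp only [shiftY, Function.comp_apply, add_tsub_cancel_right]
    push_cast
    ring
  · rintro ⟨i, j⟩ hk
    rcases j with _ | j
    · simp
    · exact absurd ⟨(i, j), rfl⟩ hk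

theorem CoefBound.linear_combination {e : ℝ} (hA : CoefBound e A) (hB : CoefBound e B) (u v : ℂ) :
    CoefBound e fun k => u * A k + v * B k := by
  obtain ⟨C, K, hC, hA⟩ := hA
  obtain ⟨C', K', hC', hB⟩ := hB
  have hmono : ∀ n i m : ℕ, n.choose i ≤ (n + 2 * m).choose (i + m) := by
    intro n i m
    induction m with
    | zero => simp
    | succ m ih =>
      refine ih.trans ?_
      rw [show n + 2 * (m + 1) = n + 2 * m + 1 + 1 by ring, ← add_assoc, Nat.choose_succ_succ,
        Nat.choose_succ_succ (n + 2 * m)]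
      omega
  refine ⟨‖u‖ * C + ‖v‖ * C', K + K', by positivity, fun i j => ?_⟩
  have h1 : ((i + j + 2 * K).choose (i + K) : ℝ) ≤ (i + j + 2 * (K + K')).choose (i + (K + K')) := by
    have := hmono (i + j + 2 * K) (i + K) K'
    rw [show i + j + 2 * K + 2 * K' = i + j + 2 * (K + K') by ring,
      show i + K + K' = i + (K + K') by ring] at this
    exact_mod_cast this
  have h2 : ((i + j + 2 * K').choose (i + K') : ℝ) ≤
      (i + j + 2 * (K + K')).choose (i + (K + K')) := by
    have := hmono (i + j + 2 * K') (i + K') K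
    rw [show i + j + 2 * K' + 2 * K = i + j + 2 * (K + K') by ring,
      show i + K' + K = i + (K + K') by ring] at this
    exact_mod_cast this
  calc ‖u * A (i, j) + v * B (i, j)‖ ≤ ‖u‖ * ‖A (i, j)‖ + ‖v‖ * ‖B (i, j)‖ := by
        rw [← norm_mul, ← norm_mul]
        exact norm_add_le _ _
    _ ≤ ‖u‖ * (C * (((i : ℝ) + j + 1) ^ e * (i + j + 2 * (K + K')).choose (i + (K + K')))) +
        ‖v‖ * (C' * (((i : ℝ) + j + 1) ^ e * (i + j + 2 * (K + K')).choose (i + (K + K')))) := by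
      gcongr
      · exact (hA i j).trans (by gcongr)
      · exact (hB i j).trans (by gcongr)
    _ = _ := by ring

theorem CoefBound.shiftX (hA : CoefBound e A) : CoefBound (e + 1) (shiftX A) := by
  obtain ⟨C, K, hC, hA⟩ := hA
  refine ⟨C * 2 ^ |e|, K + 1, by positivity, fun i j => ?_⟩
  have h1 := hA (i + 1) j
  have h2 : ((i + 1 + j + 2 * K).choose (i + 1 + K) : ℝ) ≤
      (i + j + 2 * (K + 1)).choose (i + (K + 1)) := by
    rw [show i + j + 2 * (K + 1) = i + 1 + j + 2 * K + 1 by ring, show i + (K + 1) = i + K + 1 by ring,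
      show i + 1 + K = i + K + 1 by ring, Nat.choose_succ_succ]
    push_cast
    linarith [(Nat.cast_nonneg ((i + 1 + j + 2 * K).choose (i + K)) : (0 : ℝ) ≤ _)]
  have h3 : ((i : ℝ) + 1 + j + 1) ^ e ≤ 2 ^ |e| * ((i : ℝ) + j + 1) ^ e := by
    have hn : (0 : ℝ) < (i : ℝ) + j + 1 := by positivity
    have : (((i : ℝ) + 1 + j + 1) / (i + j + 1)) ^ e ≤ 2 ^ |e| := by
      have l1 : 1 ≤ ((i : ℝ) + 1 + j + 1) / (i + j + 1) := by
        rw [le_div_iff₀ hn]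
        linarith
      have l2 : ((i : ℝ) + 1 + j + 1) / (i + j + 1) ≤ 2 := by
        rw [div_le_iff₀ hn]
        linarith [i.cast_nonneg (α := ℝ), j.cast_nonneg (α := ℝ)]
      exact (Real.rpow_le_rpow_of_exponent_le l1 (le_abs_self e)).trans
        (Real.rpow_le_rpow (by linarith) l2 (abs_nonneg e))
    rwa [Real.div_rpow (by positivity) hn.le, div_le_iff₀ (by positivity)] at this
  have h4 : ‖((i : ℂ) + 1)‖ ≤ (i : ℝ) + j + 1 := by
    have : ((i : ℂ) + 1) = ((i + 1 : ℕ) : ℂ) := by push_cast; rfl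
    rw [this, Complex.norm_natCast]
    push_cast
    linarith [j.cast_nonneg (α := ℝ)]
  push_cast at h1
  rw [_root_.shiftX, norm_mul, Real.rpow_add_one (by positivity)]
  calc ‖((i : ℂ) + 1)‖ * ‖A (i + 1, j)‖
      ≤ ((i : ℝ) + j + 1) * (C * (2 ^ |e| * ((i : ℝ) + j + 1) ^ e *
        (i + j + 2 * (K + 1)).choose (i + (K + 1)))) := by
        gcongr
        exact h1.trans (by gcongr)
    _ = _ := by ring

theorem shiftD_linear_combination (u v : ℂ) :
    shiftD (fun k => u * A k + v * B k) = fun k => u * shiftD A k + v * shiftD B k := by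
  ext k
  simp only [shiftD, shiftX, shiftY]
  ring

theorem iterate_shiftD_linear_combination (u v : ℂ) (m : ℕ) :
    shiftD^[m] (fun k => u * A k + v * B k) = fun k => u * shiftD^[m] A k + v * shiftD^[m] B k := by
  induction m generalizing A B with
  | zero => rfl
  | succ m ih => rw [Function.iterate_succ_apply, shiftD_linear_combination, ih]; rfl

variable {a b p₁ p₂ c q₁ q₂ : ℂ}

/-- By `(p + i) / (q (q + 1)_i) = 1 / (q)_i + (p - q) / (q (q + 1)_i)`, the derivative is a combination
of two series of the same type whose first terms agree for both variables. -/
theorem shiftX_coef211 (hc : LowerOK c) (hq₁ : LowerOK q₁) (hq₂ : LowerOK q₂) (k : ℕ × ℕ) :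
    shiftX (coef211 a b p₁ p₂ c q₁ q₂) k = a * b / c *
      (coef211 (a + 1) (b + 1) p₁ p₂ (c + 1) q₁ q₂ k +
        (p₁ - q₁) / q₁ * coef211 (a + 1) (b + 1) p₁ p₂ (c + 1) (q₁ + 1) q₂ k) := by
  obtain ⟨i, j⟩ := k
  have hqi := hq₁.add_ne_zero i
  have hq0 : q₁ ≠ 0 := by simpa using hq₁.add_ne_zero 0
  have hc0 : c ≠ 0 := by simpa using hc.add_ne_zero 0
  have n1 := (hq₁.add_nat 1).poch_ne_zero i
  have n2 := (hc.add_nat 1).poch_ne_zero (i + j)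
  have n3 := hq₂.poch_ne_zero j
  rw [Nat.cast_one] at n1 n2
  have e1 : poch q₁ i = q₁ * poch (q₁ + 1) i / (q₁ + i) := by
    rw [eq_div_iff hqi, ← poch_succ, poch_succ_left]
  have n4 : (i.factorial : ℂ) ≠ 0 := by exact_mod_cast i.factorial_ne_zero
  have n5 : (j.factorial : ℂ) ≠ 0 := by exact_mod_cast j.factorial_ne_zero
  have n6 : (i : ℂ) + 1 ≠ 0 := by exact_mod_cast i.succ_ne_zero
  simp only [shiftX, coef211, show i + 1 + j = i + j + 1 by ring, poch_succ_left a,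
    poch_succ_left b, poch_succ_left c, poch_succ_left q₁, poch_succ p₁, Nat.factorial_succ, e1]
  push_cast
  field_simp
  ring

theorem shiftY_coef211 (hc : LowerOK c) (hq₁ : LowerOK q₁) (hq₂ : LowerOK q₂) (k : ℕ × ℕ) :
    shiftY (coef211 a b p₁ p₂ c q₁ q₂) k = a * b / c *
      (coef211 (a + 1) (b + 1) p₁ p₂ (c + 1) q₁ q₂ k +
        (p₂ - q₂) / q₂ * coef211 (a + 1) (b + 1) p₁ p₂ (c + 1) q₁ (q₂ + 1) k) := by
  obtain ⟨i, j⟩ := k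
  have hqi := hq₂.add_ne_zero j
  have hq0 : q₂ ≠ 0 := by simpa using hq₂.add_ne_zero 0
  have hc0 : c ≠ 0 := by simpa using hc.add_ne_zero 0
  have n1 := (hq₂.add_nat 1).poch_ne_zero j
  have n2 := (hc.add_nat 1).poch_ne_zero (i + j)
  have n3 := hq₁.poch_ne_zero i
  rw [Nat.cast_one] at n1 n2
  have e1 : poch q₂ j = q₂ * poch (q₂ + 1) j / (q₂ + j) := by
    rw [eq_div_iff hqi, ← poch_succ, poch_succ_left]
  have n4 : (i.factorial : ℂ) ≠ 0 := by exact_mod_cast i.factorial_ne_zero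
  have n5 : (j.factorial : ℂ) ≠ 0 := by exact_mod_cast j.factorial_ne_zero
  have n6 : (j : ℂ) + 1 ≠ 0 := by exact_mod_cast j.succ_ne_zero
  simp only [shiftY, coef211, show i + (j + 1) = i + j + 1 by ring, poch_succ_left a,
    poch_succ_left b, poch_succ_left c, poch_succ_left q₂, poch_succ p₂, Nat.factorial_succ, e1]
  push_cast
  field_simp
  ring

/-- Although the derivatives of the double series in the directions of the axes are more singular
than the series, those in the direction of the line `x + y = 1` are not: they are linear combinations
of series of the same type, and with coefficients of the same order. -/
theorem coefBound_iterate_shiftD_coef211 (m : ℕ) (hc : LowerOK c) (hq₁ : LowerOK q₁)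
    (hq₂ : LowerOK q₂) : CoefBound ((a + b - c + p₁ - q₁ + p₂ - q₂).re - 1)
      (shiftD^[m] (coef211 a b p₁ p₂ c q₁ q₂)) := by
  induction m generalizing a b p₁ p₂ c q₁ q₂ with
  | zero => exact coefBound_coef211 hc hq₁ hq₂
  | succ m ih =>
    have e : shiftD (coef211 a b p₁ p₂ c q₁ q₂) = fun k =>
        a * b / c * ((p₂ - q₂) / q₂) * coef211 (a + 1) (b + 1) p₁ p₂ (c + 1) q₁ (q₂ + 1) k +
        -(a * b / c * ((p₁ - q₁) / q₁)) * coef211 (a + 1) (b + 1) p₁ p₂ (c + 1) (q₁ + 1) q₂ k := by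
      ext k
      rw [shiftD, shiftX_coef211 hc hq₁ hq₂, shiftY_coef211 hc hq₁ hq₂]
      ring
    have hc' := hc.add_nat 1
    have hq₁' := hq₁.add_nat 1
    have hq₂' := hq₂.add_nat 1
    rw [Nat.cast_one] at hc' hq₁' hq₂'
    rw [Function.iterate_succ_apply, e, iterate_shiftD_linear_combination]
    have h1 := ih (a := a + 1) (b := b + 1) (p₁ := p₁) (p₂ := p₂) hc' hq₁ hq₂'
    have h2 := ih (a := a + 1) (b := b + 1) (p₁ := p₁) (p₂ := p₂) hc' hq₁' hq₂
    rw [show a + 1 + (b + 1) - (c + 1) + p₁ - q₁ + p₂ - (q₂ + 1) = a + b - c + p₁ - q₁ + p₂ - q₂ by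
      ring] at h1
    rw [show a + 1 + (b + 1) - (c + 1) + p₁ - (q₁ + 1) + p₂ - q₂ = a + b - c + p₁ - q₁ + p₂ - q₂ by
      ring] at h2
    exact h1.linear_combination h2 _ _

end Shift

/-! ### Double series on the segment -/

section Segment

variable {A B : ℕ × ℕ → ℂ} {e : ℝ}

theorem CoefBound.exists_segment_bound (h : CoefBound e A) {δ : ℝ} (hδ : 0 < δ) :
    ∃ M, 0 ≤ M ∧ ∀ t ∈ Ioo δ (1 - δ), ∀ n : ℕ, ∑ k ∈ Finset.HasAntidiagonal.antidiagonal n,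
      ‖A k‖ * t ^ k.1 * (1 - t) ^ k.2 ≤ M * ((n : ℝ) + 1) ^ e := by
  obtain ⟨C, K, hC, h⟩ := h.exists_sum_antidiagonal_le
  refine ⟨C * ((δ * δ) ^ K)⁻¹, by positivity, fun t ht n => ?_⟩
  have h1 : δ < 1 - t := by linarith [ht.2]
  have h2 := h t (1 - t) (hδ.trans ht.1) (hδ.trans h1) n
  rw [add_sub_cancel, one_pow, mul_one] at h2
  calc _ ≤ C * ((n : ℝ) + 1) ^ e * ((t * (1 - t)) ^ K)⁻¹ := h2
    _ ≤ C * ((n : ℝ) + 1) ^ e * ((δ * δ) ^ K)⁻¹ := by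
      have h3 := ht.1
      have h4 := hδ.trans h3
      gcongr
    _ = _ := by ring

/-- A double series on the segment whose terms are weighted according to their degree. -/
theorem norm_dser_weighted_le {t M : ℝ} (ht : t ∈ Ioo (0 : ℝ) 1)
    (hA : ∀ n : ℕ, ∑ k ∈ Finset.HasAntidiagonal.antidiagonal n,
      ‖A k‖ * t ^ k.1 * (1 - t) ^ k.2 ≤ M * ((n : ℝ) + 1) ^ e) {c : ℕ → ℂ} {w : ℕ → ℝ}
    (hc : ∀ n, ‖c n‖ ≤ w n) (hs : Summable fun n : ℕ => w n * (M * ((n : ℝ) + 1) ^ e)) :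
    ‖dser (fun k => c (k.1 + k.2) * A k) (t, 1 - t)‖ ≤ ∑' n : ℕ, w n * (M * ((n : ℝ) + 1) ^ e) := by
  have h0 : (0 : ℝ) < 1 - t := by linarith [ht.2]
  have ht0 := ht.1
  have key : ∀ n : ℕ, ∑ k ∈ Finset.HasAntidiagonal.antidiagonal n,
      ‖c (k.1 + k.2) * A k * ((t : ℂ), 1 - (t : ℂ)).1 ^ k.1 * ((t : ℂ), 1 - (t : ℂ)).2 ^ k.2‖ ≤
        w n * (M * ((n : ℝ) + 1) ^ e) := by
    intro n
    have hw : 0 ≤ w n := (norm_nonneg _).trans (hc n)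
    refine le_trans ?_ (mul_le_mul_of_nonneg_left (hA n) hw)
    rw [Finset.mul_sum]
    refine Finset.sum_le_sum fun k hk => ?_
    rw [Finset.HasAntidiagonal.mem_antidiagonal] at hk
    have e1 : ‖(1 - (t : ℂ))‖ = 1 - t := by
      rw [← Complex.ofReal_one, ← Complex.ofReal_sub, Complex.norm_real, Real.norm_eq_abs,
        abs_of_pos h0]
    have e2 : ‖(t : ℂ)‖ = t := by rw [Complex.norm_real, Real.norm_eq_abs, abs_of_pos ht.1]
    rw [norm_mul, norm_mul, norm_mul, norm_pow, norm_pow, e1, e2, hk, mul_assoc, mul_assoc, mul_assoc]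
    exact mul_le_mul_of_nonneg_right (hc n) (by positivity)
  have hsum := summable_of_summable_sum_antidiagonal
    (Summable.of_nonneg_of_le (fun n => Finset.sum_nonneg fun k _ => norm_nonneg _) key hs)
  rw [← (hasSum_homPart hsum).tsum_eq]
  exact tsum_of_norm_bounded hs.hasSum fun n => (norm_sum_le _ _).trans (key n)

theorem CoefBound.summable_segment (h : CoefBound e A) (he : e < -1) {t : ℝ}
    (ht : t ∈ Ioo (0 : ℝ) 1) :
    Summable fun k : ℕ × ℕ => A k * (t : ℂ) ^ k.1 * (1 - (t : ℂ)) ^ k.2 := by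
  have h0 : (0 : ℝ) < 1 - t := by linarith [ht.2]
  refine h.summable (p := ((t : ℂ), 1 - (t : ℂ))) ht.1 h0 ?_ ?_
    (Or.inr ⟨(add_sub_cancel _ _).le, he⟩)
  · rw [Complex.norm_real, Real.norm_eq_abs, abs_of_pos ht.1]
  · rw [← Complex.ofReal_one, ← Complex.ofReal_sub, Complex.norm_real, Real.norm_eq_abs,
      abs_of_pos h0]

theorem mem_dom211_segment {r t : ℝ} (hr : r ∈ Ioo (0 : ℝ) 1) (ht : t ∈ Ioo (0 : ℝ) 1) :
    ((r : ℂ) * t, (r : ℂ) * (1 - t)) ∈ dom211 := by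
  have h0 : (0 : ℝ) < 1 - t := by linarith [ht.2]
  have : ‖(r : ℂ) * t‖ + ‖(r : ℂ) * (1 - t)‖ = r := by
    rw [← Complex.ofReal_one, ← Complex.ofReal_sub, ← Complex.ofReal_mul, ← Complex.ofReal_mul,
      Complex.norm_real, Complex.norm_real, Real.norm_eq_abs, Real.norm_eq_abs,
      abs_of_pos (mul_pos hr.1 ht.1), abs_of_pos (mul_pos hr.1 h0)]
    ring
  exact this.trans_lt hr.2

theorem summable_const_mul_rpow (M : ℝ) (he : e < -1) :
    Summable fun n : ℕ => M * ((n : ℝ) + 1) ^ e := by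
  have h1 : Summable fun n : ℕ => ((n + 1 : ℕ) : ℝ) ^ e :=
    (summable_nat_add_iff (f := fun n : ℕ => (n : ℝ) ^ e) 1).2 (Real.summable_nat_rpow.2 he)
  simpa using h1.mul_left M

theorem eventually_mem_Ioo_one : ∀ᶠ r : ℝ in 𝓝[<] 1, r ∈ Ioo (0 : ℝ) 1 :=
  Ioo_mem_nhdsLT one_pos

/-- Abel summation along the rays through the points of the segment, locally uniformly. -/
theorem CoefBound.tendstoLocallyUniformlyOn_segment (h : CoefBound e A) (he : e < -1) (m : ℕ) :
    TendstoLocallyUniformlyOn (fun (r : ℝ) (t : ℝ) => (r : ℂ) ^ m * dser A (r * t, r * (1 - t)))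
      (fun t => dser A (t, 1 - t)) (𝓝[<] 1) (Ioo 0 1) := by
  rw [Metric.tendstoLocallyUniformlyOn_iff]
  intro ε hε t₀ ht₀
  obtain ⟨δ, hδ, hδt⟩ : ∃ δ > 0, t₀ ∈ Ioo δ (1 - δ) :=
    ⟨min t₀ (1 - t₀) / 2, half_pos (lt_min ht₀.1 (sub_pos.2 ht₀.2)), by
      have h1 := min_le_left t₀ (1 - t₀)
      have h2 := min_le_right t₀ (1 - t₀)
      constructor <;> linarith [ht₀.1, ht₀.2]⟩
  obtain ⟨M, hM, hb⟩ := h.exists_segment_bound hδ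
  have hlim : Tendsto (fun r : ℝ => ∑' n : ℕ, (1 - r ^ (n + m)) * (M * ((n : ℝ) + 1) ^ e)) (𝓝[<] 1)
      (𝓝 (∑' n : ℕ, (0 : ℝ))) := by
    refine tendsto_tsum_of_dominated_convergence (summable_const_mul_rpow M he) (fun n => ?_) ?_
    · have : Continuous fun r : ℝ => (1 - r ^ (n + m)) * (M * ((n : ℝ) + 1) ^ e) := by fun_prop
      simpa using (this.tendsto 1).mono_left nhdsWithin_le_nhds
    · filter_upwards [eventually_mem_Ioo_one] with r hr n
      have h1 := pow_le_one₀ (n := n + m) hr.1.le hr.2.le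
      have h2 := pow_nonneg hr.1.le (n + m)
      rw [norm_mul, Real.norm_eq_abs, Real.norm_eq_abs, abs_of_nonneg (by linarith),
        abs_of_nonneg (by positivity)]
      exact mul_le_of_le_one_left (by positivity) (by linarith)
  rw [tsum_zero] at hlim
  refine ⟨Ioo δ (1 - δ), mem_nhdsWithin_of_mem_nhds (Ioo_mem_nhds hδt.1 hδt.2), ?_⟩
  filter_upwards [eventually_mem_Ioo_one, hlim.eventually (gt_mem_nhds hε)] with r hr hlt t ht
  have ht' : t ∈ Ioo (0 : ℝ) 1 := ⟨hδ.trans ht.1, by linarith [ht.2]⟩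
  have h0 := h.summable_segment he ht'
  have hr0 := h.convOn _ (mem_dom211_segment hr ht')
  have e1 : dser A (t, 1 - t) - (r : ℂ) ^ m * dser A (r * t, r * (1 - t)) =
      dser (fun k => (1 - (r : ℂ) ^ (k.1 + k.2 + m)) * A k) (t, 1 - t) := by
    rw [dser, dser, ← tsum_mul_left, ← h0.tsum_sub (hr0.mul_left _)]
    refine tsum_congr fun k => ?_
    simp only [mul_pow, pow_add]
    ring
  rw [dist_eq_norm, e1]
  refine (norm_dser_weighted_le (c := fun n => 1 - (r : ℂ) ^ (n + m)) ht' (hb t ht)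
    (w := fun n => 1 - r ^ (n + m)) (fun n => ?_) ?_).trans_lt hlt
  · have h1 := pow_le_one₀ (n := n + m) hr.1.le hr.2.le
    rw [← Complex.ofReal_pow, ← Complex.ofReal_one, ← Complex.ofReal_sub, Complex.norm_real,
      Real.norm_eq_abs, abs_of_nonneg (by linarith)]
  · refine Summable.of_nonneg_of_le (fun n => ?_) (fun n => ?_) (summable_const_mul_rpow M he)
    all_goals
      have h1 := pow_le_one₀ (n := n + m) hr.1.le hr.2.le
      have h2 := pow_nonneg hr.1.le (n + m)
    · exact mul_nonneg (by linarith) (by positivity)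
    · exact mul_le_of_le_one_left (by positivity) (by linarith)

theorem CoefBound.tendsto_segment (h : CoefBound e A) (he : e < -1) {t : ℝ}
    (ht : t ∈ Ioo (0 : ℝ) 1) :
    Tendsto (fun r : ℝ => dser A (r * t, r * (1 - t))) (𝓝[<] 1) (𝓝 (dser A (t, 1 - t))) := by
  simpa using (h.tendstoLocallyUniformlyOn_segment he 0).tendsto_at ht

theorem one_sub_mul_pow_mul_succ_le {r : ℝ} (hr : r ∈ Ioo (0 : ℝ) 1) (n : ℕ) :
    (1 - r) * r ^ n * (n + 1) ≤ 1 := by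
  have h1 : ((n : ℝ) + 1) * r ^ n ≤ ∑ k ∈ Finset.range (n + 1), r ^ k := by
    have : ∑ _k ∈ Finset.range (n + 1), r ^ n ≤ ∑ k ∈ Finset.range (n + 1), r ^ k :=
      Finset.sum_le_sum fun k hk => pow_le_pow_of_le_one hr.1.le hr.2.le
        (Nat.lt_succ_iff.1 (Finset.mem_range.1 hk))
    simpa using this
  have h2 := mul_neg_geom_sum r (n + 1)
  have h3 := pow_nonneg hr.1.le (n + 1)
  nlinarith [mul_le_mul_of_nonneg_left h1 (sub_nonneg.2 hr.2.le)]

/-- The derivative in the direction transversal to the segment is of smaller order than the inverse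
of the distance to the segment. -/
theorem CoefBound.tendsto_one_sub_mul_segment (h : CoefBound e A) (he : e < -1) {t : ℝ}
    (ht : t ∈ Ioo (0 : ℝ) 1) :
    Tendsto (fun r : ℝ => (1 - (r : ℂ)) * dser (_root_.shiftX A) (r * t, r * (1 - t))) (𝓝[<] 1)
      (𝓝 0) := by
  obtain ⟨δ, hδ, hδt⟩ : ∃ δ > 0, t ∈ Ioo δ (1 - δ) :=
    ⟨min t (1 - t) / 2, half_pos (lt_min ht.1 (sub_pos.2 ht.2)), by
      have h1 := min_le_left t (1 - t)
      have h2 := min_le_right t (1 - t)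
      constructor <;> linarith [ht.1, ht.2]⟩
  obtain ⟨M, hM, hb⟩ := h.shiftX.exists_segment_bound hδ
  have hle : ∀ r ∈ Ioo (0 : ℝ) 1, ∀ n : ℕ,
      (1 - r) * r ^ n * (M * ((n : ℝ) + 1) ^ (e + 1)) ≤ M * ((n : ℝ) + 1) ^ e := by
    intro r hr n
    rw [Real.rpow_add_one (by positivity)]
    calc (1 - r) * r ^ n * (M * (((n : ℝ) + 1) ^ e * (n + 1)))
        = (1 - r) * r ^ n * (n + 1) * (M * ((n : ℝ) + 1) ^ e) := by ring
      _ ≤ _ := mul_le_of_le_one_left (by positivity) (one_sub_mul_pow_mul_succ_le hr n)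
  have hnn : ∀ r ∈ Ioo (0 : ℝ) 1, ∀ n : ℕ, 0 ≤ (1 - r) * r ^ n * (M * ((n : ℝ) + 1) ^ (e + 1)) := by
    intro r hr n
    have := sub_pos.2 hr.2
    have := hr.1
    positivity
  have hlim : Tendsto (fun r : ℝ => ∑' n : ℕ, (1 - r) * r ^ n * (M * ((n : ℝ) + 1) ^ (e + 1)))
      (𝓝[<] 1) (𝓝 (∑' n : ℕ, (0 : ℝ))) := by
    refine tendsto_tsum_of_dominated_convergence (summable_const_mul_rpow M he) (fun n => ?_) ?_
    · have : Continuous fun r : ℝ => (1 - r) * r ^ n * (M * ((n : ℝ) + 1) ^ (e + 1)) := by fun_prop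
      simpa using (this.tendsto 1).mono_left nhdsWithin_le_nhds
    · filter_upwards [eventually_mem_Ioo_one] with r hr n
      rw [Real.norm_eq_abs, abs_of_nonneg (hnn r hr n)]
      exact hle r hr n
  rw [tsum_zero] at hlim
  refine squeeze_zero_norm' ?_ hlim
  filter_upwards [eventually_mem_Ioo_one] with r hr
  have e1 : (1 - (r : ℂ)) * dser (_root_.shiftX A) (r * t, r * (1 - t)) =
      dser (fun k => (1 - (r : ℂ)) * (r : ℂ) ^ (k.1 + k.2) * _root_.shiftX A k) (t, 1 - t) := by
    rw [dser, dser, ← tsum_mul_left]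
    refine tsum_congr fun k => ?_
    simp only [mul_pow, pow_add]
    ring
  rw [e1]
  refine norm_dser_weighted_le (c := fun n => (1 - (r : ℂ)) * (r : ℂ) ^ n) ht (hb t hδt)
    (w := fun n => (1 - r) * r ^ n) (fun n => ?_)
    (Summable.of_nonneg_of_le (hnn r hr) (hle r hr) (summable_const_mul_rpow M he))
  rw [← Complex.ofReal_one, ← Complex.ofReal_sub, ← Complex.ofReal_pow, ← Complex.ofReal_mul,
    Complex.norm_real, Real.norm_eq_abs, abs_of_nonneg
      (mul_nonneg (sub_nonneg.2 hr.2.le) (pow_nonneg hr.1.le n))]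

theorem tan₁_dser (hA : ConvOn A dom211) :
    EqOn (tan₁ (-1) (dser A)) (dser (shiftD A)) dom211 := by
  intro p hp
  have h := (hasSum_shiftY hA bidiscCovered_dom211 isOpen_dom211 hp).sub
    (hasSum_shiftX hA bidiscCovered_dom211 isOpen_dom211 hp)
  rw [tan₁, neg_one_mul, ← sub_eq_add_neg]
  refine (HasSum.tsum_eq (h.congr_fun fun k => ?_)).symm
  rw [shiftD]
  ring

/-- On the segment, the double series may be differentiated termwise. -/
theorem CoefBound.hasDerivAt_segment (h : CoefBound e A) (h' : CoefBound e (shiftD A)) (he : e < -1)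
    {t : ℝ} (ht : t ∈ Ioo (0 : ℝ) 1) :
    HasDerivAt (fun t : ℝ => dser A (t, 1 - t)) (-dser (shiftD A) (t, 1 - t)) t := by
  refine hasDerivAt_of_tendstoLocallyUniformlyOn (l := 𝓝[<] (1 : ℝ)) isOpen_Ioo
    (f := fun (r t : ℝ) => dser A (r * t, r * (1 - t)))
    (f' := fun (r t : ℝ) => -((r : ℂ) ^ 1 * dser (shiftD A) (r * t, r * (1 - t))))
    (g' := fun t => -dser (shiftD A) (t, 1 - t)) ?_ ?_ (fun t ht => h.tendsto_segment he ht) ht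
  · exact (h'.tendstoLocallyUniformlyOn_segment he 1).neg
  · filter_upwards [eventually_mem_Ioo_one] with r hr t ht
    have hp := mem_dom211_segment hr ht
    have hd := (h.convOn.differentiableOn bidiscCovered_dom211).differentiableAt
      (isOpen_dom211.mem_nhds hp)
    have h1 := hasDerivAt_comp_curve (z := (t : ℂ)) hd ((hasDerivAt_id (t : ℂ)).const_mul (r : ℂ))
      (((hasDerivAt_id (t : ℂ)).const_sub 1).const_mul (r : ℂ)) rfl
    refine h1.comp_ofReal.congr_deriv ?_
    rw [← tan₁_dser h.convOn hp, tan₁]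
    ring

end Segment

/-! ### Tangential derivatives along straight lines -/

section TangentIterates

variable {H : ℂ × ℂ → ℂ} {W : Set (ℂ × ℂ)} {p : ℂ × ℂ}

theorem DifferentiableOn.tan₁ (hW : IsOpen W) (hH : DifferentiableOn ℂ H W) (c : ℂ) :
    DifferentiableOn ℂ (tan₁ c H) W :=
  (hH.dY hW).add ((hH.dX hW).const_mul c)

theorem Set.EqOn.tan₁ (hW : IsOpen W) {H' : ℂ × ℂ → ℂ} (h : EqOn H H' W) (c : ℂ) :
    EqOn (tan₁ c H) (tan₁ c H') W := fun p hp => by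
  simp only [_root_.tan₁, h.dX hW hp, h.dY hW hp]

theorem dX_tan₁ (hW : IsOpen W) (hH : DifferentiableOn ℂ H W) (hp : p ∈ W) (c : ℂ) :
    dX (tan₁ c H) p = tan₁ c (dX H) p := by
  have h1 := hasDerivAt_left (((hH.tan₁ hW c)).differentiableAt (hW.mem_nhds hp))
  have h2 := (hasDerivAt_left ((hH.dY hW).differentiableAt (hW.mem_nhds hp))).add
    ((hasDerivAt_left ((hH.dX hW).differentiableAt (hW.mem_nhds hp))).const_mul c)
  rw [h1.unique h2, tan₁_dX hW hH hp]

theorem tan₁_tan₁ (hW : IsOpen W) (hH : DifferentiableOn ℂ H W) (hp : p ∈ W) (c : ℂ) :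
    tan₁ c (tan₁ c H) p = tan₂ c 0 H p := by
  have hχ : HasDerivAt (fun ζ : ℂ => c * ζ) c p.2 := by
    simpa using (hasDerivAt_id p.2).const_mul c
  have e : (c * p.2 + (p.1 - c * p.2), p.2) = p := by simp
  have h1 := hasDerivAt_along_curve (s := p.1 - c * p.2) hW (hH.tan₁ hW c) hχ (by rwa [e])
  have h2 := hasDerivAt_tan₁ (s := p.1 - c * p.2) (c := fun _ => c) (c' := fun _ => 0) hW hH hχ
    (hasDerivAt_const _ _) (by rwa [e])
  have := h1.unique h2
  rwa [e] at this

theorem tan₁_tan₁_tan₁ (hW : IsOpen W) (hH : DifferentiableOn ℂ H W) (hp : p ∈ W) (c : ℂ) :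
    tan₁ c (tan₁ c (tan₁ c H)) p = tan₃ c 0 0 H p := by
  have hχ : HasDerivAt (fun ζ : ℂ => c * ζ) c p.2 := by
    simpa using (hasDerivAt_id p.2).const_mul c
  have e : (c * p.2 + (p.1 - c * p.2), p.2) = p := by simp
  have h1 := hasDerivAt_along_curve (s := p.1 - c * p.2) hW ((hH.tan₁ hW c).tan₁ hW c) hχ
    (by rwa [e])
  have h2 := hasDerivAt_tan₂ (s := p.1 - c * p.2) (c := fun _ => c) (c' := fun _ => 0)
    (c'' := fun _ => 0) hW hH hχ (hasDerivAt_const _ _) (hasDerivAt_const _ _) (by rwa [e])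
  have hev : ∀ᶠ ζ in 𝓝 p.2, (c * ζ + (p.1 - c * p.2), ζ) ∈ W := by
    have : Continuous fun ζ : ℂ => (c * ζ + (p.1 - c * p.2), ζ) := by fun_prop
    exact this.continuousAt.eventually (hW.mem_nhds (by simpa only [e] using hp))
  have h3 := h2.congr_of_eventuallyEq (f₁ := fun ζ => tan₁ c (tan₁ c H) (c * ζ + (p.1 - c * p.2), ζ))
    (by filter_upwards [hev] with ζ hζ using tan₁_tan₁ hW hH hζ c)
  have := h1.unique h3
  rwa [e] at this

end TangentIterates

/-! ### The solution on the segment -/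

section SegmentSolution

theorem contDiffOn_of_hasDerivAt {s : Set ℝ} (hs : IsOpen s) (n : ℕ) {F : ℕ → ℝ → ℂ}
    (h : ∀ k, ∀ t ∈ s, HasDerivAt (F k) (F (k + 1) t) t) : ContDiffOn ℝ n (F 0) s := by
  induction n generalizing F with
  | zero =>
    exact contDiffOn_zero.2 fun t ht => (h 0 t ht).continuousAt.continuousWithinAt
  | succ n ih =>
    push_cast
    rw [contDiffOn_succ_iff_deriv_of_isOpen hs]
    refine ⟨fun t ht => (h 0 t ht).differentiableAt.differentiableWithinAt, by simp, ?_⟩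
    exact (ih fun k => h (k + 1)).congr fun t ht => (h 0 t ht).deriv

variable {A : ℕ × ℕ → ℂ} {e : ℝ}

/-- The limit along the ray through a point of the segment `x + y = 1`. -/
theorem lineEq211_segment {α β p₁ p₂ : ℂ}
    (hA : ∀ m, CoefBound e (shiftD^[m] A)) (he : e < -1)
    (hs : ∀ q ∈ dom211, Sys211 α β p₁ p₂ ((α + β + 1) / 2) (2 * p₁) (2 * p₂) (dser A) q) {t : ℝ}
    (ht : t ∈ Ioo (0 : ℝ) 1) :
    LineEq211 α β p₁ p₂ (1 - t) (dser A (t, 1 - t)) (dser (shiftD^[1] A) (t, 1 - t))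
      (dser (shiftD^[2] A) (t, 1 - t)) (dser (shiftD^[3] A) (t, 1 - t)) := by
  have hd := fun m => (hA m).convOn.differentiableOn bidiscCovered_dom211
  have hd₀ : DifferentiableOn ℂ (dser A) dom211 := hd 0
  have t1 : ∀ m, EqOn (tan₁ (-1) (dser (shiftD^[m] A))) (dser (shiftD^[m + 1] A)) dom211 := fun m => by
    rw [Function.iterate_succ_apply']
    exact tan₁_dser (hA m).convOn
  have t2 : ∀ m, EqOn (tan₁ (-1) (tan₁ (-1) (dser (shiftD^[m] A)))) (dser (shiftD^[m + 2] A))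
      dom211 := fun m => ((t1 m).tan₁ isOpen_dom211 (-1)).trans (t1 (m + 1))
  have e1 : EqOn (tan₁ (-1) (dser A)) (dser (shiftD^[1] A)) dom211 := t1 0
  have e2 : EqOn (tan₂ (-1) 0 (dser A)) (dser (shiftD^[2] A)) dom211 := fun p hp => by
    rw [← tan₁_tan₁ isOpen_dom211 hd₀ hp]
    exact t2 0 hp
  have e3 : EqOn (tan₃ (-1) 0 0 (dser A)) (dser (shiftD^[3] A)) dom211 := fun p hp => by
    rw [← tan₁_tan₁_tan₁ isOpen_dom211 hd₀ hp]
    exact ((t2 0).tan₁ isOpen_dom211 (-1)).trans (t1 2) hp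
  have eX : ∀ m, EqOn (dX (dser (shiftD^[m] A))) (dser (shiftX (shiftD^[m] A))) dom211 :=
    fun m p hp =>
      (hasSum_shiftX (hA m).convOn bidiscCovered_dom211 isOpen_dom211 hp).tsum_eq.symm
  have eX1 : EqOn (tan₁ (-1) (dX (dser A))) (dser (shiftX (shiftD^[1] A))) dom211 := fun p hp => by
    rw [← dX_tan₁ isOpen_dom211 hd₀ hp, e1.dX isOpen_dom211 hp, eX 1 hp]
  have eX2 : EqOn (tan₂ (-1) 0 (dX (dser A))) (dser (shiftX (shiftD^[2] A))) dom211 :=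
    fun p hp => by
      have h1 : EqOn (tan₁ (-1) (dX (dser A))) (dX (dser (shiftD^[1] A))) dom211 := fun q hq => by
        rw [eX1 hq, eX 1 hq]
      rw [← tan₁_tan₁ isOpen_dom211 (hd₀.dX isOpen_dom211) hp, h1.tan₁ isOpen_dom211 _ hp,
        ← dX_tan₁ isOpen_dom211 (hd 1) hp, (t1 1).dX isOpen_dom211 hp, eX 2 hp]
  have hmem : ∀ᶠ r : ℝ in 𝓝[<] 1, ((r : ℂ) * t, (r : ℂ) * (1 - t)) ∈ dom211 := by
    filter_upwards [eventually_mem_Ioo_one] with r hr using mem_dom211_segment hr ht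
  have lim : ∀ m {Φ : ℂ × ℂ → ℂ}, EqOn Φ (dser (shiftD^[m] A)) dom211 →
      Tendsto (fun r : ℝ => Φ (r * t, r * (1 - t))) (𝓝[<] 1)
        (𝓝 (dser (shiftD^[m] A) (t, 1 - t))) := fun m Φ hΦ =>
    ((hA m).tendsto_segment he ht).congr' (by
      filter_upwards [hmem] with r hr using (hΦ hr).symm)
  have limX : ∀ m {Φ : ℂ × ℂ → ℂ}, EqOn Φ (dser (shiftX (shiftD^[m] A))) dom211 →
      Tendsto (fun r : ℝ => ((r : ℂ) * t + (r : ℂ) * (1 - t) - 1) * Φ (r * t, r * (1 - t)))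
        (𝓝[<] 1) (𝓝 0) := fun m Φ hΦ => by
    have := ((hA m).tendsto_one_sub_mul_segment he ht).neg
    rw [neg_zero] at this
    refine this.congr' ?_
    filter_upwards [hmem] with r hr
    rw [hΦ hr]
    ring
  refine lineEq211_of_tendsto (l := 𝓝[<] (1 : ℝ)) (p := fun r => ((r : ℂ) * t, (r : ℂ) * (1 - t)))
    isOpen_dom211 hd₀ hmem hs ?_ (lim 0 fun _ _ => rfl) (lim 1 e1) (lim 2 e2) (lim 3 e3)
    (limX 0 (eX 0)) (limX 1 eX1) (limX 2 eX2)
  have : Continuous fun r : ℝ => ((r : ℂ) * t, (r : ℂ) * (1 - t)) := by fun_prop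
  simpa using (this.tendsto 1).mono_left nhdsWithin_le_nhds

theorem isSymSqSolution_segment (a b c : ℂ) (hγ : LowerOK (a + b + 1 / 2))
    (hq₁ : LowerOK (2 * c - 1)) (hq₂ : LowerOK (2 * a + 2 * b - 2 * c + 1)) :
    (∀ t ∈ Ioo (0 : ℝ) 1,
      Summable (term211 (2 * a) (2 * b) (c - 1 / 2) (a + b - c + 1 / 2)
        (a + b + 1 / 2) (2 * c - 1) (2 * a + 2 * b - 2 * c + 1) ((t : ℂ), 1 - (t : ℂ)))) ∧
    IsSymSqSolution a b c (Ioo (0 : ℝ) 1)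
      (fun t : ℝ => F211 (2 * a) (2 * b) (c - 1 / 2) (a + b - c + 1 / 2)
        (a + b + 1 / 2) (2 * c - 1) (2 * a + 2 * b - 2 * c + 1) ((t : ℂ), 1 - (t : ℂ))) := by
  have hA := fun m => coefBound_iterate_shiftD_coef211 (a := 2 * a) (b := 2 * b) (p₁ := c - 1 / 2)
    (p₂ := a + b - c + 1 / 2) m hγ hq₁ hq₂
  have he : (2 * a + 2 * b - (a + b + 1 / 2) + (c - 1 / 2) - (2 * c - 1) + (a + b - c + 1 / 2) -
      (2 * a + 2 * b - 2 * c + 1)).re - 1 < -1 := by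
    rw [show 2 * a + 2 * b - (a + b + 1 / 2) + (c - 1 / 2) - (2 * c - 1) + (a + b - c + 1 / 2) -
      (2 * a + 2 * b - 2 * c + 1) = ((-1 / 2 : ℝ) : ℂ) by push_cast; ring, Complex.ofReal_re]
    norm_num
  have hs := fun q hq => sys211_dser (hA 0).convOn bidiscCovered_dom211 isOpen_dom211 hγ hq₁ hq₂
    (p := q) hq
  set A := coef211 (2 * a) (2 * b) (c - 1 / 2) (a + b - c + 1 / 2)
    (a + b + 1 / 2) (2 * c - 1) (2 * a + 2 * b - 2 * c + 1) with hAdef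
  have hs' : ∀ q ∈ dom211, Sys211 (2 * a) (2 * b) (c - 1 / 2) (a + b - c + 1 / 2)
      ((2 * a + 2 * b + 1) / 2) (2 * (c - 1 / 2)) (2 * (a + b - c + 1 / 2)) (dser A) q := by
    rw [show (2 * a + 2 * b + 1) / 2 = a + b + 1 / 2 by ring,
      show 2 * (c - 1 / 2) = 2 * c - 1 by ring,
      show 2 * (a + b - c + 1 / 2) = 2 * a + 2 * b - 2 * c + 1 by ring]
    exact hs
  have hF : ∀ k, ∀ t ∈ Ioo (0 : ℝ) 1,
      HasDerivAt (fun t : ℝ => (-1) ^ k * dser (shiftD^[k] A) (t, 1 - t))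
        ((-1) ^ (k + 1) * dser (shiftD^[k + 1] A) (t, 1 - t)) t := by
    intro k t ht
    have h1 := hA (k + 1)
    rw [Function.iterate_succ_apply'] at h1 ⊢
    refine (((hA k).hasDerivAt_segment h1 he ht).const_mul ((-1) ^ k)).congr_deriv ?_
    ring
  have e0 : (fun t : ℝ => (-1) ^ 0 * dser (shiftD^[0] A) ((t : ℂ), 1 - (t : ℂ))) =
      fun t : ℝ => dser A (t, 1 - t) := by
    ext t
    simp
  refine ⟨fun t ht => (hA 0).summable_segment he ht, ?_, fun t ht => ?_⟩
  · have := contDiffOn_of_hasDerivAt isOpen_Ioo 3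
      (F := fun k t => (-1) ^ k * dser (shiftD^[k] A) (t, 1 - t)) hF
    rw [e0] at this
    exact this
  · have h0 := hF 0
    rw [e0] at h0
    have key := symSqLHS_eq_symSqForm isOpen_Ioo h0 (hF 1) (hF 2) a b c ht
    refine key.trans ?_
    have ht1 : (t : ℂ) ≠ 1 := by exact_mod_cast ht.2.ne
    have ode := symSqForm_eq_zero_of_lineEq211 ht1 (lineEq211_segment hA he hs' ht)
    rw [← ode]
    simp only [Complex.coe_algebraMap]
    congr 1 <;> ring

end SegmentSolution

theorem theorem1 (a b c : ℂ) :
    (LowerOK (a + b + 1 / 2) → LowerOK (2 * c - 1) → LowerOK (2 * a + 2 * b - 2 * c + 1) →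
      -- the series itself, on the real segment where it converges
      ((∀ t ∈ Ioo (0 : ℝ) 1,
          Summable (term211 (2 * a) (2 * b) (c - 1 / 2) (a + b - c + 1 / 2)
            (a + b + 1 / 2) (2 * c - 1) (2 * a + 2 * b - 2 * c + 1) ((t : ℂ), 1 - (t : ℂ)))) ∧
        IsSymSqSolution a b c (Ioo (0 : ℝ) 1)
          (fun t : ℝ => F211 (2 * a) (2 * b) (c - 1 / 2) (a + b - c + 1 / 2)
            (a + b + 1 / 2) (2 * c - 1) (2 * a + 2 * b - 2 * c + 1) ((t : ℂ), 1 - (t : ℂ)))) ∧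
      -- all branches
      (∀ (U : Set ℂ) (f : ℂ → ℂ), IsOpen U → 0 ∉ U → 1 ∉ U →
        IsBranchRestriction dom211
          (F211 (2 * a) (2 * b) (c - 1 / 2) (a + b - c + 1 / 2)
            (a + b + 1 / 2) (2 * c - 1) (2 * a + 2 * b - 2 * c + 1))
          (fun z => (z, 1 - z)) U f →
        IsSymSqSolution a b c U f)) ∧
    (LowerOK c → LowerOK (2 - c) →
      PowerTimesBranchSolves a b c (1 - c) (c - a - b - 1 / 2)
        (F122 (1 / 2) (a - b + 1 / 2) (a + b - c + 1 / 2) (b - a + 1 / 2) (c - a - b + 1 / 2)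
          c (2 - c))
        (fun z => (z, z / (z - 1)))) ∧
    (LowerOK (a + b - c + 1) → LowerOK (c - a - b + 1) →
      PowerTimesBranchSolves a b c (1 / 2 - c) (c - a - b)
        (F122 (1 / 2) (a - b + 1 / 2) (c - 1 / 2) (b - a + 1 / 2) (3 / 2 - c)
          (a + b - c + 1) (c - a - b + 1))
        (fun z => (1 - z, 1 - 1 / z))) ∧
    (LowerOK (a - b + 1) → LowerOK (b - a + 1) →
      PowerTimesBranchSolves a b c (1 / 2 - c) (c - a - b - 1 / 2)
        (F122 (1 / 2) (c - 1 / 2) (a + b - c + 1 / 2) (3 / 2 - c) (c - a - b + 1 / 2)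
          (a - b + 1) (b - a + 1))
        (fun z => (1 / z, 1 / (1 - z)))) := by
  refine ⟨fun hγ hq₁ hq₂ => ⟨isSymSqSolution_segment a b c hγ hq₁ hq₂,
      fun U f hU _ h1 hf => isSymSqSolution_branch211 a b c hγ hq₁ hq₂ hU h1 hf⟩,
    powerTimesBranchSolves_div_sub_one a b c, powerTimesBranchSolves_one_sub_inv a b c,
    powerTimesBranchSolves_inv a b c⟩
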